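/- Let $n_1,n_2,m,r$ be natural numbers with $r\ge 1$, put $n=\min\{n_1,n_2\}$, and let $A_1,\dots,A_m\in\mathbb{R}^{n_1\times n_2}$ be independent standard Gaussian random matrices, i.e. all entries of all the $A_j$ are independent $N(0,1)$ random variables. Define the linear map $\mathcal{A}:\mathbb{R}^{n_1\times n_2}\to\mathbb{R}^m$ by $\mathcal{A}(Z)=\left(\operatorname{tr}(ZA_j^*)\right)_{j=1}^m$. For a matrix $Z\in\mathbb{R}^{n_1\times n_2}$ with singular values $\sigma_1(Z)\ge\dots\ge\sigma_n(Z)$, let $\|Z\|_p=\left(\sum_{j=1}^n\sigma_j(Z)^p\right)^{1/p}$ be its Schatten $p$-norm ($p=1$: nuclear norm, $p=2$: Frobenius norm). If $X=\sum_{j=1}^n\sigma_j(X)u_jv_j^*$ is a singular value decomposition, let $X_c=\sum_{j=r+1}^n\sigma_j(X)u_jv_j^*$. Let $0<\rho<1$, $\kappa>1$, $0<\varepsilon<1$. If $$\frac{m^2}{m+1}\ \ge\ \frac{r\left(1+(1+\rho^{-1})^2\right)\kappa^2}{(\kappa-1)^2}\left[\sqrt{n_1}+\sqrt{n_2}+\sqrt{\frac{2\ln(\varepsilon^{-1})}{r\left(1+(1+\rho^{-1})^2\right)}}\,\right]^2,$$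 then with probability at least $1-\varepsilon$ the following holds simultaneously for every $X\in\mathbb{R}^{n_1\times n_2}$, every $\eta\in\mathbb{R}$ and every $w\in\mathbb{R}^m$ with $\|w\|_{\ell_2}\le\eta$: with $b=\mathcal{A}(X)+w$, every solution $X^\sharp$ of $$\min_{Z\in\mathbb{R}^{n_1\times n_2}}\|Z\|_1\quad\text{subject to}\quad\|\mathcal{A}(Z)-b\|_{\ell_2}\le\eta$$ satisfies $$\|X-X^\sharp\|_2\ \le\ \frac{2(1+\rho)^2}{(1-\rho)\sqrt r}\,\|X_c\|_1+\frac{2\sqrt2\,\kappa(3+\rho)}{\sqrt m\,(1-\rho)}\,\eta .$$ -/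

import Mathlib

open MeasureTheory ProbabilityTheory

namespace GaussianRecovery

/-- The singular values of a real `n₁ × n₂` matrix `Z` in non-increasing order. The index starts
at `0`, so the paper-and-pencil `σ_j(Z)` is `singularValue Z (j - 1)`; the values with index at
least `min n₁ n₂` are `0`. -/
noncomputable def singularValue {n₁ n₂ : ℕ} (Z : Matrix (Fin n₁) (Fin n₂) ℝ) (j : ℕ) : ℝ :=
  (Matrix.toEuclideanLin Z).singularValues j

/-- The Schatten `p`-norm `(∑_{j=1}^n σ_j(Z)^p)^{1/p}`, where `n = min n₁ n₂`. -/
noncomputable def schattenNorm {n₁ n₂ : ℕ} (p : ℝ) (Z : Matrix (Fin n₁) (Fin n₂) ℝ) : ℝ :=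
  (∑ j ∈ Finset.range (min n₁ n₂), singularValue Z j ^ p) ^ (1 / p)

/-- `X = ∑_{j=1}^n σ_j(X) u_j v_jᵀ`, with `n = min n₁ n₂`, is a singular value decomposition. -/
structure IsSVD {n₁ n₂ : ℕ} (X : Matrix (Fin n₁) (Fin n₂) ℝ)
    (u : Fin (min n₁ n₂) → EuclideanSpace ℝ (Fin n₁))
    (v : Fin (min n₁ n₂) → EuclideanSpace ℝ (Fin n₂)) : Prop where
  orthonormal_left : Orthonormal ℝ u
  orthonormal_right : Orthonormal ℝ v
  eq_sum : X = ∑ j : Fin (min n₁ n₂), singularValue X j • Matrix.vecMulVec (u j).ofLp (v j).ofLp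

/-- `Xc` is a remainder `X_c = ∑_{j=r+1}^n σ_j(X) u_j v_jᵀ` of the best rank-`r` approximation
`∑_{j=1}^r σ_j(X) u_j v_jᵀ` of `X`, for some singular value decomposition of `X`. -/
def IsRankTail {n₁ n₂ : ℕ} (r : ℕ) (X Xc : Matrix (Fin n₁) (Fin n₂) ℝ) : Prop :=
  ∃ u v, IsSVD X u v ∧
    Xc = ∑ j : Fin (min n₁ n₂) with r ≤ j.val,
      singularValue X j • Matrix.vecMulVec (u j).ofLp (v j).ofLp

/-- The measurement map `Z ↦ ∑_j tr(Z A_j^*) e_j`; the `A_j` are real, so `A_j^* = A_jᵀ`. -/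
noncomputable def measurementMap {n₁ n₂ m : ℕ} (A : Fin m → Matrix (Fin n₁) (Fin n₂) ℝ)
    (Z : Matrix (Fin n₁) (Fin n₂) ℝ) : EuclideanSpace ℝ (Fin m) :=
  WithLp.toLp 2 fun j => (Z * (A j).transpose).trace

/-- `Z` is a solution of: minimize `‖Z‖_1` subject to `‖𝒜(Z) - b‖_{ℓ₂} ≤ η`. -/
def IsNuclearNormSolution {n₁ n₂ m : ℕ} (A : Fin m → Matrix (Fin n₁) (Fin n₂) ℝ)
    (b : EuclideanSpace ℝ (Fin m)) (η : ℝ) (Z : Matrix (Fin n₁) (Fin n₂) ℝ) : Prop :=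
  ‖measurementMap A Z - b‖ ≤ η ∧
    ∀ Y : Matrix (Fin n₁) (Fin n₂) ℝ, ‖measurementMap A Y - b‖ ≤ η →
      schattenNorm 1 Z ≤ schattenNorm 1 Y

/-- `A_1, …, A_m` are independent standard Gaussian random matrices: all the entries of all the
`A_j` together are independent standard Gaussian random variables. -/
structure IsStandardGaussianSequence {Ω : Type*} [MeasurableSpace Ω] {n₁ n₂ m : ℕ}
    (A : Fin m → Ω → Matrix (Fin n₁) (Fin n₂) ℝ) (P : Measure Ω) : Prop where
  hasLaw : ∀ j i k, HasLaw (fun ω => A j ω i k) (gaussianReal 0 1) P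
  indep : iIndepFun (fun (q : Fin m × Fin n₁ × Fin n₂) ω => A q.1 ω q.2.1 q.2.2) P

/-- Every real matrix has a singular value decomposition. -/
theorem exists_isSVD {n₁ n₂ : ℕ} (X : Matrix (Fin n₁) (Fin n₂) ℝ) : ∃ u v, IsSVD X u v := by
  set T := Matrix.toEuclideanLin X with hT
  have hn2 : Module.finrank ℝ (EuclideanSpace ℝ (Fin n₂)) = n₂ := by simp
  have hn1 : Module.finrank ℝ (EuclideanSpace ℝ (Fin n₁)) = n₁ := by simp
  set b := T.isSymmetric_adjoint_comp_self.eigenvectorBasis hn2 with hb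
  have hin : ∀ i j : Fin n₂, inner ℝ (T (b i)) (T (b j)) =
      if i = j then T.singularValues j ^ 2 else 0 := by
    intro i j
    have h1 : LinearMap.adjoint T (T (b j)) = T.singularValues j ^ 2 • b j := by
      have := T.isSymmetric_adjoint_comp_self.apply_eigenvectorBasis hn2 j
      rw [← T.sq_singularValues_fin hn2] at this
      exact this
    rw [← LinearMap.adjoint_inner_right, h1, inner_smul_right,
      orthonormal_iff_ite.mp b.orthonormal i j]
    split_ifs <;> simp
  have hz : ∀ k : Fin n₂, T.singularValues k = 0 → T (b k) = 0 := by
    intro k hk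
    have := hin k k
    rw [if_pos rfl, hk] at this
    simpa using this
  have hbig : ∀ k : ℕ, n₁ ≤ k → T.singularValues k = 0 := by
    intro k hk
    by_contra h
    have h2 := (T.singularValues_pos_iff_lt_finrank_range).mp
      ((T.singularValues_pos_iff_ne_zero k).mpr h)
    have h3 := Submodule.finrank_le T.range
    omega
  let u₀ : Fin n₁ → EuclideanSpace ℝ (Fin n₁) := fun i =>
    if h : i.val < n₂ then (T.singularValues i)⁻¹ • T (b ⟨i, h⟩) else 0
  let s : Set (Fin n₁) := {i | i.val < n₂ ∧ T.singularValues i ≠ 0}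
  have hon : Orthonormal ℝ (s.domRestrict u₀) := by
    rw [orthonormal_iff_ite]
    rintro ⟨i, hi, hi'⟩ ⟨j, hj, hj'⟩
    simp only [Set.domRestrict_apply, u₀, dif_pos hi, dif_pos hj, inner_smul_left,
      inner_smul_right, hin]
    by_cases hij : i = j
    · subst hij
      simp
      field_simp
    · have : i.val ≠ j.val := fun h => hij (Fin.ext h)
      simp [hij, this]
  obtain ⟨c, hc⟩ := hon.exists_orthonormalBasis_extension_of_card_eq (by simp)
  have hc' : ∀ k : Fin (min n₁ n₂), T (b ⟨k, by omega⟩) =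
      T.singularValues k • c ⟨k, by omega⟩ := by
    intro k
    by_cases h : T.singularValues k = 0
    · rw [h, zero_smul, hz _ h]
    · have hk : k.val < n₂ := by omega
      rw [hc ⟨k, by omega⟩ ⟨hk, h⟩]
      simp only [u₀, dif_pos hk]
      rw [smul_smul, mul_inv_cancel₀ h, one_smul]
  refine ⟨fun k => c ⟨k, by omega⟩, fun k => b ⟨k, by omega⟩,
    c.orthonormal.comp _ fun i j h => ?_, b.orthonormal.comp _ fun i j h => ?_, ?_⟩
  · simpa [Fin.ext_iff] using h
  · simpa [Fin.ext_iff] using h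
  · apply Matrix.toEuclideanLin.injective
    apply b.toBasis.ext
    intro k
    have hv : ∀ (x : EuclideanSpace ℝ (Fin n₁)) (y z : EuclideanSpace ℝ (Fin n₂)),
        Matrix.toEuclideanLin (Matrix.vecMulVec x.ofLp y.ofLp) z = inner ℝ y z • x := by
      intro x y z
      ext i
      simp [Matrix.vecMulVec, Matrix.mulVec, dotProduct, PiLp.inner_apply, Finset.sum_mul]
      exact Finset.sum_congr rfl fun _ _ => by ring
    simp only [OrthonormalBasis.coe_toBasis, map_sum, map_smul, LinearMap.sum_apply,
      LinearMap.smul_apply, hv, orthonormal_iff_ite.mp b.orthonormal]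
    by_cases hk : k.val < n₁
    · rw [Finset.sum_eq_single (⟨k, by omega⟩ : Fin (min n₁ n₂))]
      · simpa [singularValue] using hc' ⟨k, by omega⟩
      · intro j _ hj
        have : j.val ≠ k.val := fun h => hj (Fin.ext h)
        simp [Fin.ext_iff, this]
      · simp
    · rw [Finset.sum_eq_zero]
      · exact hz k (hbig k (by omega))
      · intro j _
        have : j.val ≠ k.val := by omega
        simp [Fin.ext_iff, this]

/-- Hence every real matrix has a remainder `X_c`. -/
theorem exists_isRankTail {n₁ n₂ : ℕ} (r : ℕ) (X : Matrix (Fin n₁) (Fin n₂) ℝ) :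
    ∃ Xc, IsRankTail r X Xc := by
  obtain ⟨u, v, h⟩ := exists_isSVD X
  exact ⟨_, u, v, h, rfl⟩

end GaussianRecovery

/-! Since `X` is feasible, a solution `X♯` has nuclear norm at most that of `X`. This alone forces
the error `M = X - X♯` to satisfy `‖M‖₁ ≤ √5 √r ‖M‖₂ + 2 ‖X_c‖₁`
(`schattenNorm_one_le_of_isRankTail`). Put `K = √r √(1 + (1 + ρ⁻¹)²)`, which exceeds `√5 √r` because
`ρ < 1`. If `‖M‖₁ > K ‖M‖₂`, the gap between the constants bounds `‖M‖₂` by a multiple of `‖X_c‖₁`,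
without using the measurements. Otherwise `M` lies in the cone `‖M‖₁ ≤ K ‖M‖₂`; as `‖𝒜(M)‖ ≤ 2η`, a
lower bound `y` for `‖𝒜(·)‖` on the unit matrices of the cone gives `‖M‖₂ ≤ 2η / y`
(`schattenNorm_two_sub_le`).

Probability enters only through the infimum of `‖𝒜(t)‖` over these unit matrices. By Gordon's
inequality its mean is at least `E‖g‖ - E sup (-⟨H, t⟩)`, with `g` a Gaussian vector in `ℝ^m` and
`H` a Gaussian matrix. Here `E‖g‖ ≥ m / √(m + 1)`, the supremum is at most `K ‖H‖_op` by duality of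
nuclear and operator norm, and `E‖H‖_op ≤ √n₁ + √n₂` by the same comparison applied to maxima. The
infimum is a 1-Lipschitz function of the Gaussian entries, so it drops `x` below its mean with
probability at most `exp (-x² / 2)`, and `x = √(2 ln ε⁻¹)` makes this `ε`. The hypothesis on `m`
leaves a lower bound `y = √m / (√2 κ)`.

Both Gaussian inequalities come from one principle, `integral_comparison`: rotate one Gaussian
vector into an independent one and use Stein's identity to write the derivative of the expectation
as a difference of Hessian traces. For Gordon's inequality (`integral_logSumExp_matrix_le`) the
extremum is smoothed by `logSumExp` and the norm by `smoothNorm`; for concentration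
(`integral_exp_mul_le`) the principle is applied to weighted replicas of the function. These
arguments treat finite families, the smoothing parameter then tends to zero
(`stdGauss_exists_norm_lt_le`), and a countable dense sequence gives the whole set
(`one_sub_exp_le_stdGauss`). -/

namespace GaussianRecovery

/-! ### Growth bounds and Gaussian integration by parts. -/

section

/-- The standard Gaussian measure on `ι → ℝ`. -/
noncomputable abbrev stdGauss (ι : Type*) [Fintype ι] : Measure (ι → ℝ) :=
  Measure.pi fun _ => gaussianReal 0 1

/-- At most exponential growth. -/
def ExpGrowth {E : Type*} [Norm E] (f : E → ℝ) : Prop :=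
  ∃ C : ℝ, 0 ≤ C ∧ ∀ z, |f z| ≤ C * Real.exp (C * ‖z‖)

namespace ExpGrowth

variable {E : Type*} [SeminormedAddCommGroup E]

theorem mono {f g : E → ℝ} (hg : ExpGrowth g) (h : ∀ z, |f z| ≤ |g z|) : ExpGrowth f := by
  obtain ⟨C, hC, hg⟩ := hg
  exact ⟨C, hC, fun z => (h z).trans (hg z)⟩

theorem of_le {f : E → ℝ} {a b : ℝ} (ha : 0 ≤ a)
    (h : ∀ z, |f z| ≤ a * Real.exp (b * ‖z‖)) : ExpGrowth f := by
  refine ⟨max a b, le_max_of_le_left ha, fun z => (h z).trans ?_⟩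
  gcongr
  · exact le_max_left _ _
  · exact le_max_right _ _

theorem const (c : ℝ) : ExpGrowth fun _ : E => c :=
  of_le (b := 0) (abs_nonneg c) fun z => by simp

theorem of_le_add_mul_norm {f : E → ℝ} {a b : ℝ} (ha : 0 ≤ a) (hb : 0 ≤ b)
    (h : ∀ z, |f z| ≤ a + b * ‖z‖) : ExpGrowth f := by
  refine of_le (b := 1) (add_nonneg ha hb) fun z => (h z).trans ?_
  have h1 := Real.add_one_le_exp ‖z‖
  have h2 : 1 ≤ Real.exp ‖z‖ := Real.one_le_exp (norm_nonneg z)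
  rw [one_mul]
  nlinarith [norm_nonneg z]

theorem of_bounded {f : E → ℝ} (C : ℝ) (h : ∀ z, |f z| ≤ C) : ExpGrowth f :=
  of_le_add_mul_norm ((abs_nonneg _).trans (h 0)) le_rfl fun z => by simpa using h z

theorem mul {f g : E → ℝ} (hf : ExpGrowth f) (hg : ExpGrowth g) :
    ExpGrowth fun z => f z * g z := by
  obtain ⟨C, hC, hf⟩ := hf
  obtain ⟨D, hD, hg⟩ := hg
  refine of_le (b := C + D) (mul_nonneg hC hD) fun z => ?_
  rw [abs_mul, add_mul, Real.exp_add]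
  calc _ ≤ (C * Real.exp (C * ‖z‖)) * (D * Real.exp (D * ‖z‖)) :=
        mul_le_mul (hf z) (hg z) (abs_nonneg _) (by positivity)
    _ = _ := by ring

theorem add {f g : E → ℝ} (hf : ExpGrowth f) (hg : ExpGrowth g) :
    ExpGrowth fun z => f z + g z := by
  obtain ⟨C, hC, hf⟩ := hf
  obtain ⟨D, hD, hg⟩ := hg
  refine of_le (b := C + D) (add_nonneg hC hD) fun z => ?_
  have h1 : Real.exp (C * ‖z‖) ≤ Real.exp ((C + D) * ‖z‖) := by gcongr; linarith
  have h2 : Real.exp (D * ‖z‖) ≤ Real.exp ((C + D) * ‖z‖) := by gcongr; linarith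
  have := abs_add_le (f z) (g z)
  nlinarith [hf z, hg z]

theorem neg {f : E → ℝ} (hf : ExpGrowth f) : ExpGrowth fun z => -f z :=
  hf.mono fun z => by simp

theorem sub {f g : E → ℝ} (hf : ExpGrowth f) (hg : ExpGrowth g) :
    ExpGrowth fun z => f z - g z := by
  simpa [sub_eq_add_neg] using hf.add hg.neg

theorem sum {ι : Type*} {s : Finset ι} {f : ι → E → ℝ} (hf : ∀ i, ExpGrowth (f i)) :
    ExpGrowth fun z => ∑ i ∈ s, f i z := by
  classical
  induction s using Finset.induction_on with
  | empty => simpa using ExpGrowth.const (E := E) 0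
  | insert a s ha ih => simpa [Finset.sum_insert ha] using (hf a).add ih

theorem abs {f : E → ℝ} (hf : ExpGrowth f) : ExpGrowth fun z => |f z| :=
  hf.mono fun z => by simp

theorem comp {E' : Type*} [SeminormedAddCommGroup E'] {f : E → ℝ} (hf : ExpGrowth f) {g : E' → E}
    {K : ℝ} (hg : ∀ z, ‖g z‖ ≤ K * ‖z‖) : ExpGrowth fun z => f (g z) := by
  obtain ⟨C, hC, hf⟩ := hf
  refine of_le (b := C * K) hC fun z => (hf _).trans ?_
  rw [mul_assoc]
  gcongr
  exact hg z

theorem eval {ι : Type*} [Fintype ι] (i : ι) : ExpGrowth fun z : ι → ℝ => z i :=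
  of_le_add_mul_norm le_rfl zero_le_one fun z => by simpa using norm_le_pi_norm z i

theorem exp {f : E → ℝ} {a b : ℝ} (h : ∀ z, f z ≤ a + b * ‖z‖) :
    ExpGrowth fun z => Real.exp (f z) :=
  of_le (Real.exp_nonneg a) fun z => by
    rw [abs_of_nonneg (Real.exp_nonneg _), ← Real.exp_add]
    exact Real.exp_le_exp.2 (h z)

variable {ι : Type*} [Fintype ι]

/-- The sup norm is at most the sum of the `|z i|`, so the growth bound is dominated by a product of
the one-dimensional functions `exp (C |x|)`, each integrable for a Gaussian. -/
theorem integrable {f : (ι → ℝ) → ℝ} (hf : ExpGrowth f)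
    (hm : AEStronglyMeasurable f (stdGauss ι)) : Integrable f (stdGauss ι) := by
  obtain ⟨C, hC, hf⟩ := hf
  have h1 : Integrable (fun x : ℝ => Real.exp (C * |x|)) (gaussianReal 0 1) := by
    refine ((integrable_exp_mul_gaussianReal C).add (integrable_exp_mul_gaussianReal (-C))).mono'
      (by fun_prop) (ae_of_all _ fun x => ?_)
    rw [Real.norm_eq_abs, abs_of_nonneg (Real.exp_nonneg _), Pi.add_apply]
    rcases abs_cases x with h | h <;> rw [h.1]
    · linarith [Real.exp_nonneg (-C * x)]
    · rw [mul_neg, ← neg_mul]; linarith [Real.exp_nonneg (C * x)]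
  have h2 : Integrable (fun z : ι → ℝ => C * ∏ i, Real.exp (C * |z i|)) (stdGauss ι) :=
    (Integrable.fintype_prod (f := fun _ x => Real.exp (C * |x|)) fun _ => h1).const_mul C
  refine h2.mono' hm (ae_of_all _ fun z => (hf z).trans ?_)
  rw [← Real.exp_sum, ← Finset.mul_sum]
  gcongr
  refine (pi_norm_le_iff_of_nonneg (Finset.sum_nonneg fun i _ => abs_nonneg _)).2 fun i => ?_
  exact Finset.single_le_sum (f := fun i => |z i|) (fun i _ => abs_nonneg _) (Finset.mem_univ i)

theorem integrable_of_continuous {f : (ι → ℝ) → ℝ} (hf : ExpGrowth f) (hc : Continuous f) :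
    Integrable f (stdGauss ι) :=
  hf.integrable hc.aestronglyMeasurable

end ExpGrowth

theorem hasDerivAt_gaussianPDFReal (x : ℝ) :
    HasDerivAt (gaussianPDFReal 0 1) (-(x * gaussianPDFReal 0 1 x)) x := by
  have h : HasDerivAt (fun y : ℝ => (√(2 * Real.pi * 1))⁻¹ * Real.exp (-(y - 0) ^ 2 / (2 * 1)))
      ((√(2 * Real.pi * 1))⁻¹ * (Real.exp (-(x - 0) ^ 2 / (2 * 1)) * (-(2 * (x - 0)) / (2 * 1)))) x := by
    have h1 : HasDerivAt (fun y : ℝ => -(y - 0) ^ 2 / (2 * 1)) (-(2 * (x - 0)) / (2 * 1)) x := by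
      have := ((((hasDerivAt_id x).sub_const 0).pow 2).neg).div_const (2 * 1)
      simpa using this
    exact h1.exp.const_mul _
  have e : gaussianPDFReal 0 1 =
      fun y : ℝ => (√(2 * Real.pi * 1))⁻¹ * Real.exp (-(y - 0) ^ 2 / (2 * 1)) := by
    ext y; simp [gaussianPDFReal]
  rw [e]
  convert h using 1
  ring

/-- Stein's identity on the real line. -/
theorem integral_id_mul_gaussianReal {h h' : ℝ → ℝ} (hd : ∀ x, HasDerivAt h (h' x) x)
    (i0 : Integrable h (gaussianReal 0 1)) (i1 : Integrable h' (gaussianReal 0 1))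
    (i2 : Integrable (fun x => x * h x) (gaussianReal 0 1)) :
    ∫ x, x * h x ∂gaussianReal 0 1 = ∫ x, h' x ∂gaussianReal 0 1 := by
  have key : ∀ f : ℝ → ℝ, Integrable f (gaussianReal 0 1) →
      Integrable (fun x => gaussianPDFReal 0 1 x * f x) := by
    intro f hf
    rw [gaussianReal_of_var_ne_zero _ one_ne_zero,
      integrable_withDensity_iff_integrable_smul' (measurable_gaussianPDF _ _)
        (ae_of_all _ fun _ => gaussianPDF_lt_top)] at hf
    simpa [toReal_gaussianPDF] using hf
  rw [integral_gaussianReal_eq_integral_smul one_ne_zero,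
    integral_gaussianReal_eq_integral_smul one_ne_zero]
  have := integral_mul_deriv_eq_deriv_mul_of_integrable (u := h) (u' := h')
    (v := gaussianPDFReal 0 1) (v' := fun x => -(x * gaussianPDFReal 0 1 x))
    (fun x _ => hd x) (fun x _ => hasDerivAt_gaussianPDFReal x)
    ((key _ i2).neg.congr (ae_of_all _ fun x => by simp; ring))
    ((key _ i1).congr (ae_of_all _ fun x => by simp; ring))
    ((key _ i0).congr (ae_of_all _ fun x => by simp; ring))
  simp only [smul_eq_mul]
  rw [← neg_inj, ← integral_neg]
  convert this using 1
  · exact integral_congr_ae (ae_of_all _ fun x => by simp only; ring)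
  · congr 1
    exact integral_congr_ae (ae_of_all _ fun x => by simp only; ring)

variable {ι κ : Type*} [Fintype ι] [Fintype κ]

/-- Resampling one coordinate preserves the standard Gaussian measure. -/
theorem measurePreserving_update [DecidableEq ι] (k : ι) :
    MeasurePreserving (fun p : (ι → ℝ) × ℝ => Function.update p.1 k p.2)
      ((stdGauss ι).prod (gaussianReal 0 1)) (stdGauss ι) := by
  have hm : Measurable fun p : (ι → ℝ) × ℝ => Function.update p.1 k p.2 := by
    refine measurable_pi_lambda _ fun i => ?_
    by_cases h : i = k
    · subst h; simpa using measurable_snd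
    · simp only [Function.update_of_ne h]; fun_prop
  refine ⟨hm, (Measure.pi_eq fun s hs => ?_).symm⟩
  rw [Measure.map_apply hm (MeasurableSet.univ_pi hs)]
  have : (fun p : (ι → ℝ) × ℝ => Function.update p.1 k p.2) ⁻¹' Set.univ.pi s =
      (Set.univ.pi (Function.update s k Set.univ)) ×ˢ s k := by
    ext p
    simp only [Set.mem_preimage, Set.mem_pi, Set.mem_univ, true_imp_iff, Set.mem_prod]
    constructor
    · refine fun h => ⟨fun i => ?_, by simpa using h k⟩
      by_cases hi : i = k
      · subst hi; simp
      · simpa [hi] using h i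
    · rintro ⟨h1, h2⟩ i
      by_cases hi : i = k
      · subst hi; simpa using h2
      · simpa [hi] using h1 i
  rw [this, Measure.prod_prod, Measure.pi_pi, ← Finset.mul_prod_erase _ _ (Finset.mem_univ k),
    ← Finset.mul_prod_erase _ (fun i => gaussianReal 0 1 (s i)) (Finset.mem_univ k)]
  simp only [Function.update_self, measure_univ, one_mul]
  rw [mul_comm]
  congr 1
  exact Finset.prod_congr rfl fun i hi => by rw [Function.update_of_ne (Finset.ne_of_mem_erase hi)]

/-- Stein's identity for one coordinate of a standard Gaussian vector. -/
theorem integral_eval_mul_stdGauss [DecidableEq ι] (k : ι) {H H' : (ι → ℝ) → ℝ}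
    (hd : ∀ z, HasDerivAt (fun s : ℝ => H (z + s • Pi.single k 1)) (H' z) 0)
    (i0 : Integrable H (stdGauss ι)) (i1 : Integrable H' (stdGauss ι))
    (i2 : Integrable (fun z => z k * H z) (stdGauss ι)) :
    ∫ z, z k * H z ∂stdGauss ι = ∫ z, H' z ∂stdGauss ι := by
  have mp := measurePreserving_update (ι := ι) k
  have tr : ∀ {f : (ι → ℝ) → ℝ}, Integrable f (stdGauss ι) →
      Integrable (fun p : (ι → ℝ) × ℝ => f (Function.update p.1 k p.2))
        ((stdGauss ι).prod (gaussianReal 0 1)) := fun {f} hf =>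
    mp.integrable_comp_of_integrable hf
  -- Averaging over a resampled coordinate `k` leaves integrals unchanged, so the one-dimensional
  -- identity along almost every line in direction `k` suffices.
  have ev : ∀ {f : (ι → ℝ) → ℝ}, Integrable f (stdGauss ι) → ∫ z, f z ∂stdGauss ι =
      ∫ z, ∫ s, f (Function.update z k s) ∂gaussianReal 0 1 ∂stdGauss ι := fun {f} hf => by
    rw [← integral_prod (fun p : (ι → ℝ) × ℝ => f (Function.update p.1 k p.2)) (tr hf)]
    have := mp.map_eq
    conv_lhs => rw [← this]
    rw [integral_map mp.measurable.aemeasurable (by rw [this]; exact hf.aestronglyMeasurable)]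
  rw [ev i1, ev i2]
  refine integral_congr_ae ?_
  filter_upwards [(tr i0).prod_right_ae, (tr i1).prod_right_ae, (tr i2).prod_right_ae]
    with z h0 h1 h2
  simp only [Function.update_self] at h2 ⊢
  refine integral_id_mul_gaussianReal (h := fun s => H (Function.update z k s)) (fun x => ?_) h0 h1 h2
  have h3 := (HasDerivAt.comp_sub_const x x (by simpa using hd (Function.update z k x)))
  refine h3.congr_of_eventuallyEq (Filter.Eventually.of_forall fun s => ?_)
  simp only
  congr 1
  ext i
  by_cases hi : i = k
  · subst hi; simp
  · simp [hi]

/-- Lets two independent Gaussian vectors be realised as disjoint blocks of a single one. -/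
theorem measurePreserving_comp_stdGauss {e : ι → κ} (he : Function.Injective e) :
    MeasurePreserving (fun y : κ → ℝ => fun i => y (e i)) (stdGauss κ) (stdGauss ι) := by
  refine ⟨measurable_pi_lambda _ fun i => measurable_pi_apply (e i), ?_⟩
  simpa only [Measure.infinitePi_eq_pi] using
    Measure.map_infinitePi_infinitePi_of_inj (P := fun _ : κ => gaussianReal 0 1) he

theorem integral_comp_stdGauss {e : ι → κ} (he : Function.Injective e) {f : (ι → ℝ) → ℝ}
    (hf : AEStronglyMeasurable f (stdGauss ι)) :
    ∫ y, f (fun i => y (e i)) ∂stdGauss κ = ∫ z, f z ∂stdGauss ι := by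
  have h := (measurePreserving_comp_stdGauss he).map_eq
  conv_rhs => rw [← h]
  rw [integral_map (measurePreserving_comp_stdGauss he).measurable.aemeasurable (by rwa [h])]

theorem integral_eval_stdGauss (i : ι) {f : ℝ → ℝ}
    (hf : AEStronglyMeasurable f (gaussianReal 0 1)) :
    ∫ z, f (z i) ∂stdGauss ι = ∫ x, f x ∂gaussianReal 0 1 := by
  have h := (measurePreserving_eval (fun _ : ι => gaussianReal 0 1) i).map_eq
  conv_rhs => rw [← h]
  rw [integral_map (measurable_pi_apply i).aemeasurable (by rwa [h])]

/-- Independence of the rows of a standard Gaussian matrix. -/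
theorem integral_prod_curry_stdGauss (g : ι → (κ → ℝ) → ℝ) (hg : ∀ i, Measurable (g i)) :
    ∫ y : ι × κ → ℝ, ∏ i, g i (fun j => y (i, j)) ∂stdGauss (ι × κ) =
      ∏ i, ∫ z, g i z ∂stdGauss κ := by
  have h := Measure.infinitePi_map_curry (ι := ι) (κ := κ) (X := ℝ) fun _ _ => gaussianReal 0 1
  simp only [Measure.infinitePi_eq_pi] at h
  rw [← integral_fintype_prod_eq_prod, ← h, integral_map (by fun_prop)]
  · rfl
  · exact (Finset.measurable_prod _ fun i _ => (hg i).comp (measurable_pi_apply i)).aestronglyMeasurable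

end

/-! ### Gaussian comparison by rotation. -/

section

/-- `F` is twice continuously differentiable, with first and second derivatives `F₁ z v` and
`F₂ z v` at `z` in the direction `v`. -/
structure IsC2 {E : Type*} [NormedAddCommGroup E] [NormedSpace ℝ E] (F : E → ℝ)
    (F₁ F₂ : E → E → ℝ) : Prop where
  contDiff : ContDiff ℝ 2 F
  first : ∀ z v, HasDerivAt (fun s : ℝ => F (z + s • v)) (F₁ z v) 0
  second : ∀ z v, HasDerivAt (fun s : ℝ => F₁ (z + s • v) v) (F₂ z v) 0

namespace IsC2

variable {E : Type*} [NormedAddCommGroup E] [NormedSpace ℝ E] {F : E → ℝ} {F₁ F₂ : E → E → ℝ}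

theorem hasFDerivAt (h : IsC2 F F₁ F₂) (z : E) : HasFDerivAt F (fderiv ℝ F z) z :=
  (h.contDiff.differentiable (by norm_num) z).hasFDerivAt

theorem fderiv_apply (h : IsC2 F F₁ F₂) (z v : E) : fderiv ℝ F z v = F₁ z v := by
  have h1 : HasDerivAt (fun s : ℝ => z + s • v) v 0 := by
    simpa using ((hasDerivAt_id (0 : ℝ)).smul_const v).const_add z
  have h2 : HasFDerivAt F (fderiv ℝ F z) (z + (0 : ℝ) • v) := by simpa using h.hasFDerivAt z
  exact (h2.comp_hasDerivAt 0 h1).unique (h.first z v)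

theorem first_add (h : IsC2 F F₁ F₂) (z v w : E) : F₁ z (v + w) = F₁ z v + F₁ z w := by
  simp [← h.fderiv_apply]

theorem first_smul (h : IsC2 F F₁ F₂) (z v : E) (c : ℝ) : F₁ z (c • v) = c * F₁ z v := by
  simp [← h.fderiv_apply]

theorem first_sum (h : IsC2 F F₁ F₂) {κ : Type*} (s : Finset κ) (z : E) (v : κ → E) :
    F₁ z (∑ k ∈ s, v k) = ∑ k ∈ s, F₁ z (v k) := by
  simp [← h.fderiv_apply]

theorem continuous_first (h : IsC2 F F₁ F₂) (v : E) : Continuous fun z => F₁ z v := by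
  simp only [← h.fderiv_apply]
  exact (h.contDiff.continuous_fderiv (by norm_num)).clm_apply continuous_const

theorem contDiff_fderiv (h : IsC2 F F₁ F₂) : ContDiff ℝ 1 (fderiv ℝ F) :=
  h.contDiff.fderiv_right (m := 1) (by norm_num)

theorem second_eq (h : IsC2 F F₁ F₂) (z v : E) :
    fderiv ℝ (fderiv ℝ F) z v v = F₂ z v := by
  have h1 : HasDerivAt (fun s : ℝ => z + s • v) v 0 := by
    simpa using ((hasDerivAt_id (0 : ℝ)).smul_const v).const_add z
  have h2 : HasFDerivAt (fderiv ℝ F) (fderiv ℝ (fderiv ℝ F) z) (z + (0 : ℝ) • v) := by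
    simpa using (h.contDiff_fderiv.differentiable (by norm_num) z).hasFDerivAt
  have h3 : HasDerivAt (fun s : ℝ => fderiv ℝ F (z + s • v)) (fderiv ℝ (fderiv ℝ F) z v) 0 :=
    h2.comp_hasDerivAt 0 h1
  have h4 : HasDerivAt (fun s : ℝ => fderiv ℝ F (z + s • v) v)
      (fderiv ℝ (fderiv ℝ F) z v v) 0 := by
    simpa using h3.clm_apply (hasDerivAt_const (0 : ℝ) v)
  simp only [h.fderiv_apply] at h4
  exact h4.unique (h.second z v)

theorem second_zero (h : IsC2 F F₁ F₂) (z : E) : F₂ z 0 = 0 := by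
  simp [← h.second_eq]

theorem continuous_second (h : IsC2 F F₁ F₂) (v : E) : Continuous fun z => F₂ z v := by
  simp only [← h.second_eq]
  exact ((h.contDiff_fderiv.continuous_fderiv (by norm_num)).clm_apply
    continuous_const).clm_apply continuous_const

/-- Derivative along a scaled direction. -/
theorem hasDerivAt_first_smul (h : IsC2 F F₁ F₂) (z v : E) (c : ℝ) :
    HasDerivAt (fun s : ℝ => F₁ (z + s • c • v) v) (c * F₂ z v) 0 := by
  have h0 : HasDerivAt (fun s : ℝ => F₁ (z + s • v) v) (F₂ z v) (c * 0) := by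
    simpa using h.second z v
  have h1 := h0.comp (0 : ℝ) ((hasDerivAt_id (0 : ℝ)).const_mul c)
  simpa [Function.comp_def, smul_smul, mul_comm] using h1

theorem const_mul (h : IsC2 F F₁ F₂) (c : ℝ) :
    IsC2 (fun z => c * F z) (fun z v => c * F₁ z v) (fun z v => c * F₂ z v) where
  contDiff := contDiff_const.mul h.contDiff
  first z v := (h.first z v).const_mul c
  second z v := (h.second z v).const_mul c

theorem abs_le (h : IsC2 F F₁ F₂) {K : ℝ} (hK : 0 ≤ K) (hb : ∀ z v, |F₁ z v| ≤ K * ‖v‖) (z : E) :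
    |F z| ≤ |F 0| + K * ‖z‖ := by
  have h1 : ∀ z ∈ (Set.univ : Set E), ‖fderiv ℝ F z‖ ≤ K := fun z _ =>
    ContinuousLinearMap.opNorm_le_bound _ hK fun v => by rw [h.fderiv_apply]; exact hb z v
  have h2 := convex_univ.norm_image_sub_le_of_norm_fderiv_le (𝕜 := ℝ)
    (fun z _ => (h.hasFDerivAt z).differentiableAt) h1 (Set.mem_univ 0) (Set.mem_univ z)
  rw [sub_zero, Real.norm_eq_abs] at h2
  linarith [abs_sub_abs_le_abs_sub (F z) (F 0)]

theorem comp_linear (h : IsC2 F F₁ F₂) {E' : Type*} [NormedAddCommGroup E'] [NormedSpace ℝ E']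
    (L : E' →L[ℝ] E) :
    IsC2 (fun z => F (L z)) (fun z v => F₁ (L z) (L v)) (fun z v => F₂ (L z) (L v)) where
  contDiff := h.contDiff.comp L.contDiff
  first z v := by simpa using h.first (L z) (L v)
  second z v := by simpa using h.second (L z) (L v)

end IsC2

section Comparison

variable {E : Type*} [NormedAddCommGroup E] [NormedSpace ℝ E] {F : E → ℝ} {F₁ F₂ : E → E → ℝ}
  {κ : Type*} [Fintype κ] [DecidableEq κ]

theorem map_eq_sum_single (A : (κ → ℝ) →L[ℝ] E) (z : κ → ℝ) :
    A z = ∑ k, z k • A (Pi.single k 1) := by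
  conv_lhs => rw [← Finset.univ_sum_single z, map_sum]
  refine Finset.sum_congr rfl fun k _ => ?_
  rw [← map_smul]
  congr 1
  ext i
  simp [Pi.single_apply]

/-- The derivative of a Gaussian expectation along the rotation from `A` to `B`. -/
theorem hasDerivAt_integral_rotation (h : IsC2 F F₁ F₂) (A B : (κ → ℝ) →L[ℝ] E)
    (hAB : ∀ k, A (Pi.single k 1) = 0 ∨ B (Pi.single k 1) = 0) (g0 : ExpGrowth F)
    (gA : ∀ k, ExpGrowth fun z => F₁ z (A (Pi.single k 1)))
    (gB : ∀ k, ExpGrowth fun z => F₁ z (B (Pi.single k 1)))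
    (gA' : ∀ k, ExpGrowth fun z => F₂ z (A (Pi.single k 1)))
    (gB' : ∀ k, ExpGrowth fun z => F₂ z (B (Pi.single k 1))) (θ : ℝ) :
    HasDerivAt (fun θ : ℝ => ∫ z, F ((Real.cos θ • A + Real.sin θ • B) z) ∂stdGauss κ)
      (Real.sin θ * Real.cos θ * ∫ z, (∑ k, F₂ ((Real.cos θ • A + Real.sin θ • B) z)
          (B (Pi.single k 1)) - ∑ k, F₂ ((Real.cos θ • A + Real.sin θ • B) z)
          (A (Pi.single k 1))) ∂stdGauss κ) θ := by
  set Z : ℝ → (κ → ℝ) →L[ℝ] E := fun θ => Real.cos θ • A + Real.sin θ • B with hZ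
  set K := ‖A‖ + ‖B‖ with hK
  have hZn : ∀ θ z, ‖Z θ z‖ ≤ K * ‖z‖ := by
    intro θ z
    have h1 : ‖Real.cos θ • A z‖ ≤ ‖A‖ * ‖z‖ := by
      rw [norm_smul, Real.norm_eq_abs]
      nlinarith [A.le_opNorm z, Real.abs_cos_le_one θ, norm_nonneg (A z)]
    have h2 : ‖Real.sin θ • B z‖ ≤ ‖B‖ * ‖z‖ := by
      rw [norm_smul, Real.norm_eq_abs]
      nlinarith [B.le_opNorm z, Real.abs_sin_le_one θ, norm_nonneg (B z)]
    calc ‖Z θ z‖ ≤ ‖Real.cos θ • A z‖ + ‖Real.sin θ • B z‖ := norm_add_le _ _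
      _ ≤ K * ‖z‖ := by rw [hK, add_mul]; exact add_le_add h1 h2
  have hc0 : ∀ θ, Continuous fun z => F (Z θ z) := fun θ =>
    h.contDiff.continuous.comp (Z θ).continuous
  set D : ℝ → (κ → ℝ) →L[ℝ] E := fun θ => -Real.sin θ • A + Real.cos θ • B with hD
  have hexp : ∀ θ z, F₁ (Z θ z) (D θ z) = ∑ k, z k * F₁ (Z θ z) (D θ (Pi.single k 1)) := by
    intro θ z
    conv_lhs => rw [map_eq_sum_single (D θ) z, h.first_sum]
    simp only [h.first_smul]
  have hDk : ∀ θ z k, F₁ z (D θ (Pi.single k 1)) =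
      -Real.sin θ * F₁ z (A (Pi.single k 1)) + Real.cos θ * F₁ z (B (Pi.single k 1)) := by
    intro θ z k
    rw [← h.first_smul, ← h.first_smul, ← h.first_add]
    rfl
  have hDc : ∀ θ k, Continuous fun z => F₁ (Z θ z) (D θ (Pi.single k 1)) := fun θ k =>
    (h.continuous_first _).comp (Z θ).continuous
  have gD : ∀ θ k, ExpGrowth fun z => F₁ (Z θ z) (D θ (Pi.single k 1)) := by
    intro θ k
    refine ExpGrowth.comp (f := fun z => F₁ z (D θ (Pi.single k 1))) ?_ (hZn θ)
    simp only [hDk]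
    exact ((ExpGrowth.const _).mul (gA k)).add ((ExpGrowth.const _).mul (gB k))
  choose a ha0 ha using gA
  choose b hb0 hb using gB
  -- Since `|cos θ|` and `|sin θ|` are at most 1, a single dominating function serves every angle.
  have hmain := hasDerivAt_integral_of_dominated_loc_of_deriv_le (μ := stdGauss κ)
    (F := fun θ z => F (Z θ z)) (F' := fun θ z => F₁ (Z θ z) (D θ z)) (x₀ := θ) (s := Set.univ)
    (bound := fun z => ∑ k, |z k| * (a k * Real.exp (a k * (K * ‖z‖)) +
      b k * Real.exp (b k * (K * ‖z‖)))) Filter.univ_mem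
    (Filter.Eventually.of_forall fun θ => (hc0 θ).aestronglyMeasurable)
    ((g0.comp (hZn θ)).integrable_of_continuous (hc0 θ)) ?_ ?_ ?_ ?_
  rotate_left
  · simp only [hexp]
    exact (continuous_finsetSum _ fun k _ =>
      (continuous_apply k).mul (hDc θ k)).aestronglyMeasurable
  · refine ae_of_all _ fun z θ _ => ?_
    rw [hexp]
    refine (norm_sum_le _ _).trans (Finset.sum_le_sum fun k _ => ?_)
    rw [norm_mul, Real.norm_eq_abs, Real.norm_eq_abs, hDk]
    gcongr
    refine (abs_add_le _ _).trans (add_le_add ?_ ?_)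
    · rw [abs_mul, abs_neg]
      refine (mul_le_of_le_one_left (abs_nonneg _) (Real.abs_sin_le_one θ)).trans ((ha k _).trans ?_)
      have := ha0 k
      gcongr
      exact hZn θ z
    · rw [abs_mul]
      refine (mul_le_of_le_one_left (abs_nonneg _) (Real.abs_cos_le_one θ)).trans ((hb k _).trans ?_)
      have := hb0 k
      gcongr
      exact hZn θ z
  · refine ExpGrowth.integrable_of_continuous (ExpGrowth.sum fun k => ?_) (by fun_prop)
    have e : ∀ c : ℝ, 0 ≤ c → ExpGrowth fun z : κ → ℝ => c * Real.exp (c * (K * ‖z‖)) :=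
      fun c hc => ExpGrowth.of_le (b := c * K) hc fun z => by
        rw [abs_of_nonneg (by positivity), mul_assoc]
    exact (ExpGrowth.eval k).abs.mul ((e _ (ha0 k)).add (e _ (hb0 k)))
  · refine ae_of_all _ fun z θ _ => ?_
    have h1 : HasDerivAt (fun θ => Z θ z) (D θ z) θ := by
      have := ((Real.hasDerivAt_cos θ).smul_const (A z)).add
        ((Real.hasDerivAt_sin θ).smul_const (B z))
      simpa [hZ, hD] using! this
    have := (h.hasFDerivAt (Z θ z)).comp_hasDerivAt θ h1
    rwa [h.fderiv_apply] at this
  refine hmain.2.congr_deriv ?_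
  simp only [hexp]
  have gA2 : ∀ k, ExpGrowth fun z => F₂ (Z θ z) (A (Pi.single k 1)) := fun k =>
    ExpGrowth.comp (f := fun z => F₂ z _) (gA' k) (hZn θ)
  have gB2 : ∀ k, ExpGrowth fun z => F₂ (Z θ z) (B (Pi.single k 1)) := fun k =>
    ExpGrowth.comp (f := fun z => F₂ z _) (gB' k) (hZn θ)
  have c2 : ∀ v, Continuous fun z => F₂ (Z θ z) v := fun v =>
    (h.continuous_second v).comp (Z θ).continuous
  have iA : ∀ k, Integrable (fun z => F₂ (Z θ z) (A (Pi.single k 1))) (stdGauss κ) := fun k =>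
    (gA2 k).integrable_of_continuous (c2 _)
  have iB : ∀ k, Integrable (fun z => F₂ (Z θ z) (B (Pi.single k 1))) (stdGauss κ) := fun k =>
    (gB2 k).integrable_of_continuous (c2 _)
  have iD : ∀ k, Integrable (fun z => z k * F₁ (Z θ z) (D θ (Pi.single k 1))) (stdGauss κ) :=
    fun k => ((ExpGrowth.eval k).mul (gD θ k)).integrable_of_continuous
      ((continuous_apply k).mul (hDc θ k))
  rw [integral_finsetSum _ fun k _ => iD k,
    integral_sub (integrable_finsetSum _ fun k _ => iB k)
      (integrable_finsetSum _ fun k _ => iA k),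
    integral_finsetSum _ fun k _ => iB k, integral_finsetSum _ fun k _ => iA k,
    ← Finset.sum_sub_distrib, Finset.mul_sum]
  refine Finset.sum_congr rfl fun k _ => ?_
  rw [← integral_sub (iB k) (iA k), ← integral_const_mul]
  -- Stein's identity trades the factor `z k` for a derivative along coordinate `k`. Only one of
  -- `A`, `B` moves with that coordinate, so no mixed second derivative appears: the result is `sin
  -- θ cos θ` times `F₂` along `B`, or its negative along `A`.
  refine integral_eval_mul_stdGauss k (fun z => ?_)
    ((gD θ k).integrable_of_continuous (hDc θ k)) (((iB k).sub (iA k)).const_mul _) (iD k)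
  simp only [hDk]
  rcases hAB k with h0 | h0
  · have e1 : ∀ s : ℝ, Z θ (z + s • Pi.single k 1) =
        Z θ z + s • Real.sin θ • B (Pi.single k 1) := by
      intro s
      simp only [hZ, add_apply, smul_apply, map_add, map_smul, h0,
        smul_zero, smul_add]
      rw [smul_comm s]
      abel
    have h1 : ∀ z, F₁ z (0 : E) = 0 := fun z => by simpa using h.first_smul z 0 0
    simp only [h0, h.second_zero, e1, h1, mul_zero, zero_add, sub_zero]
    exact ((h.hasDerivAt_first_smul (Z θ z) (B (Pi.single k 1)) (Real.sin θ)).const_mul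
      (Real.cos θ)).congr_deriv (by ring)
  · have e1 : ∀ s : ℝ, Z θ (z + s • Pi.single k 1) =
        Z θ z + s • Real.cos θ • A (Pi.single k 1) := by
      intro s
      simp only [hZ, add_apply, smul_apply, map_add, map_smul, h0,
        smul_zero, add_zero]
    have h1 : ∀ z, F₁ z (0 : E) = 0 := fun z => by simpa using h.first_smul z 0 0
    simp only [h0, h.second_zero, e1, h1, mul_zero, add_zero, zero_sub]
    exact ((h.hasDerivAt_first_smul (Z θ z) (A (Pi.single k 1)) (Real.cos θ)).const_mul
      (-Real.sin θ)).congr_deriv (by ring)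

/-- On the quarter turn `sin θ cos θ ≥ 0`, so the rotated expectation decreases from its value for
`A` at angle `0` to its value for `B` at angle `π / 2`. -/
theorem integral_le_integral_of_second_le (h : IsC2 F F₁ F₂) (A B : (κ → ℝ) →L[ℝ] E)
    (hAB : ∀ k, A (Pi.single k 1) = 0 ∨ B (Pi.single k 1) = 0) (g0 : ExpGrowth F)
    (gA : ∀ k, ExpGrowth fun z => F₁ z (A (Pi.single k 1)))
    (gB : ∀ k, ExpGrowth fun z => F₁ z (B (Pi.single k 1)))
    (gA' : ∀ k, ExpGrowth fun z => F₂ z (A (Pi.single k 1)))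
    (gB' : ∀ k, ExpGrowth fun z => F₂ z (B (Pi.single k 1)))
    (hle : ∀ z, ∑ k, F₂ z (B (Pi.single k 1)) ≤ ∑ k, F₂ z (A (Pi.single k 1))) :
    ∫ z, F (B z) ∂stdGauss κ ≤ ∫ z, F (A z) ∂stdGauss κ := by
  have hd := hasDerivAt_integral_rotation h A B hAB g0 gA gB gA' gB'
  have hanti := antitoneOn_of_deriv_nonpos (convex_Icc 0 (Real.pi / 2))
    (fun x _ => (hd x).continuousAt.continuousWithinAt)
    (fun x _ => (hd x).differentiableAt.differentiableWithinAt) fun x hx => by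
      rw [interior_Icc] at hx
      rw [(hd x).deriv]
      refine mul_nonpos_of_nonneg_of_nonpos (mul_nonneg ?_ ?_)
        (integral_nonpos fun z => sub_nonpos.2 (hle _))
      · exact Real.sin_nonneg_of_nonneg_of_le_pi hx.1.le (by linarith [hx.2, Real.pi_pos])
      · exact Real.cos_nonneg_of_neg_pi_div_two_le_of_le (by linarith [hx.1, Real.pi_pos]) hx.2.le
  have := hanti (Set.left_mem_Icc.2 (by positivity)) (Set.right_mem_Icc.2 (by positivity))
    (by positivity)
  simpa using this

/-- **Gaussian comparison**: if `F` has at least as large a trace of the Hessian along the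
covariance of `L z` as along the covariance of `M y`, then `E F(M y) ≤ E F(L z)`. -/
theorem integral_comparison {κ' : Type*} [Fintype κ'] [DecidableEq κ'] (h : IsC2 F F₁ F₂)
    (L : (κ → ℝ) →L[ℝ] E) (M : (κ' → ℝ) →L[ℝ] E) (g0 : ExpGrowth F)
    (gL : ∀ k, ExpGrowth fun z => F₁ z (L (Pi.single k 1)))
    (gM : ∀ k, ExpGrowth fun z => F₁ z (M (Pi.single k 1)))
    (gL' : ∀ k, ExpGrowth fun z => F₂ z (L (Pi.single k 1)))
    (gM' : ∀ k, ExpGrowth fun z => F₂ z (M (Pi.single k 1)))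
    (hle : ∀ z, ∑ k, F₂ z (M (Pi.single k 1)) ≤ ∑ k, F₂ z (L (Pi.single k 1))) :
    ∫ y, F (M y) ∂stdGauss κ' ≤ ∫ z, F (L z) ∂stdGauss κ := by
  -- The two sources are put on disjoint blocks of one Gaussian vector: every coordinate is then
  -- invisible to one of the two maps, as the rotation requires.
  set pL : (κ ⊕ κ' → ℝ) →L[ℝ] (κ → ℝ) :=
    ContinuousLinearMap.pi fun k => ContinuousLinearMap.proj (Sum.inl k) with hpL
  set pM : (κ ⊕ κ' → ℝ) →L[ℝ] (κ' → ℝ) :=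
    ContinuousLinearMap.pi fun k => ContinuousLinearMap.proj (Sum.inr k) with hpM
  have l1 : ∀ k, pL (Pi.single (Sum.inl k) 1) = Pi.single k 1 := fun k => by
    ext i; simp [hpL, Pi.single_apply]
  have l2 : ∀ k, pL (Pi.single (Sum.inr k) 1) = 0 := fun k => by
    ext i; simp [hpL]
  have m1 : ∀ k, pM (Pi.single (Sum.inr k) 1) = Pi.single k 1 := fun k => by
    ext i; simp [hpM, Pi.single_apply]
  have m2 : ∀ k, pM (Pi.single (Sum.inl k) 1) = 0 := fun k => by
    ext i; simp [hpM]
  have z1 : ∀ z, F₁ z (0 : E) = 0 := fun z => by simpa using h.first_smul z 0 0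
  have := integral_le_integral_of_second_le h (L.comp pL) (M.comp pM)
    (by rintro (k | k) <;> simp [l2, m2]) g0
    (by rintro (k | k) <;> simp [l1, l2, z1, gL, ExpGrowth.const])
    (by rintro (k | k) <;> simp [m1, m2, z1, gM, ExpGrowth.const])
    (by rintro (k | k) <;> simp [l1, l2, h.second_zero, gL', ExpGrowth.const])
    (by rintro (k | k) <;> simp [m1, m2, h.second_zero, gM', ExpGrowth.const])
    (fun z => by simpa [l1, l2, m1, m2, h.second_zero] using hle z)
  rw [← integral_comp_stdGauss (f := fun y => F (M y)) (e := (Sum.inr : κ' → κ ⊕ κ')) Sum.inr_injective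
      (h.contDiff.continuous.comp M.continuous).aestronglyMeasurable,
    ← integral_comp_stdGauss (f := fun z => F (L z)) (e := (Sum.inl : κ → κ ⊕ κ')) Sum.inl_injective
      (h.contDiff.continuous.comp L.continuous).aestronglyMeasurable]
  exact this

end Comparison

end

/-! ### Gaussian concentration by replicas. -/

section

variable {ι : Type*} [Fintype ι] {f : (ι → ℝ) → ℝ} {f₁ f₂ : (ι → ℝ) → (ι → ℝ) → ℝ}

variable {τ : Type*} [Fintype τ]

/-- The test function for concentration. The extra scalar coordinate, with coefficient `σ`, is there
to pay for the squared gradients of the replicas. -/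
theorem isC2_exp_replica (h : IsC2 f f₁ f₂) (c : τ → ℝ) (σ : ℝ) :
    IsC2 (fun z : (τ → ι → ℝ) × ℝ => Real.exp (σ * z.2 + ∑ a, c a * f (z.1 a)))
      (fun z v => Real.exp (σ * z.2 + ∑ a, c a * f (z.1 a)) *
        (σ * v.2 + ∑ a, c a * f₁ (z.1 a) (v.1 a)))
      (fun z v => Real.exp (σ * z.2 + ∑ a, c a * f (z.1 a)) *
        ((σ * v.2 + ∑ a, c a * f₁ (z.1 a) (v.1 a)) ^ 2 + ∑ a, c a * f₂ (z.1 a) (v.1 a))) := by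
  have hψ : ∀ z v : (τ → ι → ℝ) × ℝ, HasDerivAt (fun s : ℝ => Real.exp (σ * (z + s • v).2 +
      ∑ a, c a * f ((z + s • v).1 a))) (Real.exp (σ * z.2 + ∑ a, c a * f (z.1 a)) *
        (σ * v.2 + ∑ a, c a * f₁ (z.1 a) (v.1 a))) 0 := by
    intro z v
    have h1 : HasDerivAt (fun s : ℝ => σ * (z.2 + s * v.2)) (σ * v.2) 0 := by
      simpa using (((hasDerivAt_id (0 : ℝ)).mul_const v.2).const_add z.2).const_mul σ
    have h2 : HasDerivAt (fun s : ℝ => ∑ a, c a * f (z.1 a + s • v.1 a))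
        (∑ a, c a * f₁ (z.1 a) (v.1 a)) 0 :=
      HasDerivAt.fun_sum fun a _ => (h.first (z.1 a) (v.1 a)).const_mul (c a)
    simpa using (h1.fun_add h2).exp
  refine ⟨?_, hψ, fun z v => ?_⟩
  · refine ContDiff.exp (ContDiff.add (by fun_prop) (ContDiff.sum fun a _ =>
      contDiff_const.mul (h.contDiff.comp (by fun_prop))))
  · have h2 : HasDerivAt (fun s : ℝ => σ * v.2 + ∑ a, c a * f₁ ((z + s • v).1 a) (v.1 a))
        (∑ a, c a * f₂ (z.1 a) (v.1 a)) 0 :=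
      (HasDerivAt.fun_sum fun a _ => (h.second (z.1 a) (v.1 a)).const_mul (c a)).const_add _
    have h3 := (hψ z v).fun_mul h2
    refine h3.congr_deriv ?_
    simp only [zero_smul, add_zero]
    ring

variable [DecidableEq ι]

theorem abs_first_le_of_sum_sq_le (h : IsC2 f f₁ f₂)
    (hg : ∀ z, ∑ k, f₁ z (Pi.single k 1) ^ 2 ≤ 1) (z v : ι → ℝ) :
    |f₁ z v| ≤ Fintype.card ι * ‖v‖ := by
  have e : f₁ z v = ∑ k, v k * f₁ z (Pi.single k 1) := by
    have := map_eq_sum_single (ContinuousLinearMap.id ℝ (ι → ℝ)) v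
    simp only [ContinuousLinearMap.id_apply] at this
    conv_lhs => rw [this, h.first_sum]
    simp only [h.first_smul]
  rw [e]
  refine (Finset.abs_sum_le_sum_abs _ _).trans ?_
  refine (Finset.sum_le_card_nsmul _ _ ‖v‖ fun k _ => ?_).trans (by simp)
  have h1 : f₁ z (Pi.single k 1) ^ 2 ≤ 1 :=
    (Finset.single_le_sum (f := fun k => f₁ z (Pi.single k 1) ^ 2) (fun _ _ => sq_nonneg _)
      (Finset.mem_univ k)).trans (hg z)
  rw [abs_mul]
  exact (mul_le_of_le_one_right (abs_nonneg _) ((sq_le_one_iff_abs_le_one _).1 h1)).trans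
    (norm_le_pi_norm v k)

theorem abs_le_of_sum_sq_le (h : IsC2 f f₁ f₂)
    (hg : ∀ z, ∑ k, f₁ z (Pi.single k 1) ^ 2 ≤ 1) (z : ι → ℝ) :
    |f z| ≤ |f 0| + Fintype.card ι * ‖z‖ :=
  h.abs_le (Nat.cast_nonneg _) (abs_first_le_of_sum_sq_le h hg) z

theorem expGrowth_of_sum_sq_le (h : IsC2 f f₁ f₂)
    (hg : ∀ z, ∑ k, f₁ z (Pi.single k 1) ^ 2 ≤ 1) : ExpGrowth f :=
  ExpGrowth.of_le_add_mul_norm (abs_nonneg _) (Nat.cast_nonneg _) (abs_le_of_sum_sq_le h hg)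

theorem expGrowth_exp_mul_of_sum_sq_le (h : IsC2 f f₁ f₂)
    (hg : ∀ z, ∑ k, f₁ z (Pi.single k 1) ^ 2 ≤ 1) (c : ℝ) :
    ExpGrowth fun z => Real.exp (c * f z) :=
  ExpGrowth.exp (a := |c| * |f 0|) (b := |c| * Fintype.card ι) fun z => by
    calc c * f z ≤ |c| * |f z| := by rw [← abs_mul]; exact le_abs_self _
      _ ≤ |c| * (|f 0| + Fintype.card ι * ‖z‖) := by
        gcongr; exact abs_le_of_sum_sq_le h hg z
      _ = _ := by ring

variable [DecidableEq τ]

/-- Exponential moments of a function with unit gradient bound, evaluated at independent copies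
with weights adding up to zero. -/
theorem prod_integral_exp_le (h : IsC2 f f₁ f₂)
    (hg : ∀ z, ∑ k, f₁ z (Pi.single k 1) ^ 2 ≤ 1) (h2 : ∀ v, ExpGrowth fun z => f₂ z v)
    (c : τ → ℝ) (hc : ∑ a, c a = 0) :
    ∏ a, ∫ z, Real.exp (c a * f z) ∂stdGauss ι ≤ Real.exp ((∑ a, c a ^ 2) / 2) := by
  set σ := √(∑ a, c a ^ 2) with hσ
  have hσ2 : σ ^ 2 = ∑ a, c a ^ 2 := Real.sq_sqrt (Finset.sum_nonneg fun _ _ => sq_nonneg _)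
  -- Under `L` all replicas coincide and the scalar is an independent Gaussian; under `M` the
  -- replicas are independent and the scalar is zero. Since the weights add up to zero, `f`
  -- disappears from the exponent under `L`.
  set L : (Option ι → ℝ) →L[ℝ] (τ → ι → ℝ) × ℝ :=
    (ContinuousLinearMap.pi fun _ => ContinuousLinearMap.pi fun i =>
      ContinuousLinearMap.proj (some i)).prod (ContinuousLinearMap.proj none) with hL
  set M : (τ × ι → ℝ) →L[ℝ] (τ → ι → ℝ) × ℝ :=
    (ContinuousLinearMap.pi fun a => ContinuousLinearMap.pi fun i =>
      ContinuousLinearMap.proj (a, i)).prod 0 with hM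
  have ln : L (Pi.single none 1) = (0, 1) := by
    ext <;> simp [hL]
  have ls : ∀ i, L (Pi.single (some i) 1) = (fun _ => Pi.single i 1, 0) := by
    intro i
    ext <;> simp [hL, Pi.single_apply]
  have mm : ∀ p : τ × ι, M (Pi.single p 1) = (Pi.single p.1 (Pi.single p.2 1), 0) := by
    rintro ⟨a, i⟩
    ext b j
    · by_cases hb : b = a
      · subst hb; simp [hM, Pi.single_apply]
      · simp [hM, Pi.single_apply, hb]
    · simp [hM]
  have z1 : ∀ z, f₁ z (0 : ι → ℝ) = 0 := fun z => by simpa using h.first_smul z 0 0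
  have hn : ∀ a, ∀ z : (τ → ι → ℝ) × ℝ, ‖z.1 a‖ ≤ 1 * ‖z‖ := fun a z => by
    rw [one_mul]; exact (norm_le_pi_norm z.1 a).trans (norm_fst_le z)
  have gF : ExpGrowth fun z : (τ → ι → ℝ) × ℝ =>
      Real.exp (σ * z.2 + ∑ a, c a * f (z.1 a)) := by
    refine ExpGrowth.exp (a := (∑ a, |c a|) * |f 0|) (b := |σ| + ∑ a, |c a| * Fintype.card ι)
      fun z => ?_
    have e1 : σ * z.2 ≤ |σ| * ‖z‖ := by
      refine (le_abs_self _).trans ?_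
      rw [abs_mul]
      gcongr
      exact norm_snd_le z
    have e2 : ∑ a, c a * f (z.1 a) ≤
        ∑ a, (|c a| * |f 0| + |c a| * Fintype.card ι * ‖z‖) := by
      refine Finset.sum_le_sum fun a _ => ?_
      calc c a * f (z.1 a) ≤ |c a| * |f (z.1 a)| := by rw [← abs_mul]; exact le_abs_self _
        _ ≤ |c a| * (|f 0| + Fintype.card ι * ‖z‖) := by
          gcongr
          refine (abs_le_of_sum_sq_le h hg _).trans ?_
          gcongr
          simpa using hn a z
        _ = _ := by ring
    rw [Finset.sum_add_distrib, ← Finset.sum_mul, ← Finset.sum_mul] at e2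
    rw [add_mul]
    linarith
  have g1 : ∀ a w, ExpGrowth fun z : (τ → ι → ℝ) × ℝ => f₁ (z.1 a) w := fun a w =>
    ExpGrowth.of_le_add_mul_norm (a := Fintype.card ι * ‖w‖) (b := 0) (by positivity) le_rfl
      fun z => by simpa using abs_first_le_of_sum_sq_le h hg (z.1 a) w
  have g2 : ∀ a w, ExpGrowth fun z : (τ → ι → ℝ) × ℝ => f₂ (z.1 a) w := fun a w =>
    (h2 w).comp (hn a)
  have gψ : ∀ v : (τ → ι → ℝ) × ℝ, ExpGrowth fun z : (τ → ι → ℝ) × ℝ =>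
      σ * v.2 + ∑ a, c a * f₁ (z.1 a) (v.1 a) := fun v =>
    (ExpGrowth.const _).add (ExpGrowth.sum fun a => (ExpGrowth.const _).mul (g1 a _))
  have G1 := fun v => gF.mul (gψ v)
  have G2 : ∀ v : (τ → ι → ℝ) × ℝ, ExpGrowth fun z : (τ → ι → ℝ) × ℝ =>
      Real.exp (σ * z.2 + ∑ a, c a * f (z.1 a)) *
        ((σ * v.2 + ∑ a, c a * f₁ (z.1 a) (v.1 a)) ^ 2 + ∑ a, c a * f₂ (z.1 a) (v.1 a)) :=
    fun v => gF.mul (((gψ v).mul (gψ v)).mono (fun z => by rw [sq]) |>.add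
      (ExpGrowth.sum fun a => (ExpGrowth.const _).mul (g2 a _)))
  -- The `f₂` terms of the two traces are the same sum. What remains for `M` is the sum of `c a ^ 2`
  -- times a squared gradient, hence at most `σ ^ 2`; what remains for `L` is `σ ^ 2` plus a sum of
  -- squares.
  have main := integral_comparison (isC2_exp_replica h c σ) L M gF (fun k => G1 _) (fun k => G1 _)
    (fun k => G2 _) (fun k => G2 _) fun z => by
      rw [Fintype.sum_option, ln, ← Finset.mul_sum, ← Finset.mul_sum, ← mul_add]
      refine mul_le_mul_of_nonneg_left ?_ (Real.exp_nonneg _)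
      simp only [ls, mm, Pi.zero_apply, z1, h.second_zero, mul_zero, mul_one, Finset.sum_const_zero,
        add_zero, zero_add, hσ2]
      have s1 : ∀ (x : τ × ι) (g : (ι → ℝ) → (ι → ℝ) → ℝ), (∀ z, g z 0 = 0) →
          ∑ a, c a * g (z.1 a) ((Pi.single x.1 (Pi.single x.2 1) : τ → ι → ℝ) a) =
          c x.1 * g (z.1 x.1) (Pi.single x.2 1) := by
        intro x g h0
        rw [Finset.sum_eq_single x.1]
        · simp
        · intro b _ hb
          rw [Pi.single_eq_of_ne hb, h0, mul_zero]
        · simp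
      simp only [s1 _ _ z1, s1 _ _ h.second_zero, Finset.sum_add_distrib, Fintype.sum_prod_type]
      rw [Finset.sum_comm (f := fun (x : ι) (a : τ) => c a * f₂ (z.1 a) (Pi.single x 1)),
        ← add_assoc]
      refine add_le_add_left ?_ _
      refine le_add_of_le_of_nonneg (Finset.sum_le_sum fun a _ => ?_)
        (Finset.sum_nonneg fun _ _ => sq_nonneg _)
      simp only [mul_pow, ← Finset.mul_sum]
      exact mul_le_of_le_one_right (sq_nonneg _) (hg _)
  have e1 : ∀ y, Real.exp (σ * (M y).2 + ∑ a, c a * f ((M y).1 a)) =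
      ∏ a, Real.exp (c a * f fun i => y (a, i)) := by
    intro y
    rw [← Real.exp_sum]
    simp [hM]
  have e2 : ∀ x, Real.exp (σ * (L x).2 + ∑ a, c a * f ((L x).1 a)) = Real.exp (σ * x none) := by
    intro x
    have : ∀ a, (L x).1 a = fun i => x (some i) := fun a => rfl
    simp only [this, ← Finset.sum_mul, hc, zero_mul, add_zero]
    rfl
  have hmeas : ∀ a, Measurable fun z => Real.exp (c a * f z) := fun a =>
    (Real.continuous_exp.comp (continuous_const.mul h.contDiff.continuous)).measurable
  simp only [e1, e2] at main
  rw [integral_prod_curry_stdGauss (fun a z => Real.exp (c a * f z)) hmeas,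
    integral_eval_stdGauss none (f := fun x => Real.exp (σ * x)) (by fun_prop)] at main
  refine main.trans_eq ?_
  have := congrFun (mgf_id_gaussianReal (μ := 0) (v := 1)) σ
  simp only [mgf, id] at this
  rw [this, ← hσ2]
  simp

/-- **Gaussian concentration**: a function with gradient bounded by `1` is sub-Gaussian with
variance proxy `1`. -/
theorem integral_exp_mul_le (h : IsC2 f f₁ f₂)
    (hg : ∀ z, ∑ k, f₁ z (Pi.single k 1) ^ 2 ≤ 1) (h2 : ∀ v, ExpGrowth fun z => f₂ z v) (t : ℝ) :
    ∫ z, Real.exp (t * f z) ∂stdGauss ι ≤ Real.exp (t * ∫ z, f z ∂stdGauss ι + t ^ 2 / 2) := by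
  set m := ∫ z, f z ∂stdGauss ι with hm
  have hfi : Integrable f (stdGauss ι) :=
    (expGrowth_of_sum_sq_le h hg).integrable_of_continuous h.contDiff.continuous
  have jensen : ∀ c : ℝ, Real.exp (c * m) ≤ ∫ z, Real.exp (c * f z) ∂stdGauss ι := by
    intro c
    have hi : Integrable (fun z => Real.exp (c * f z)) (stdGauss ι) :=
      (expGrowth_exp_mul_of_sum_sq_le h hg c).integrable_of_continuous
        (Real.continuous_exp.comp (continuous_const.mul h.contDiff.continuous))
    have h0 : Integrable (fun z => c * f z - c * m) (stdGauss ι) :=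
      (hfi.const_mul c).sub (integrable_const _)
    have h3 : Integrable (fun z => Real.exp (c * m) * (c * f z - c * m + 1)) (stdGauss ι) :=
      (h0.add (integrable_const _)).const_mul _
    have h4 : ∫ z, Real.exp (c * m) * (c * f z - c * m + 1) ∂stdGauss ι = Real.exp (c * m) := by
      rw [integral_const_mul, integral_add h0 (integrable_const _), integral_sub (hfi.const_mul c) (integrable_const _),
        integral_const_mul]
      simp [← hm]
    rw [← h4]
    refine integral_mono h3 hi fun z => ?_
    have := mul_le_mul_of_nonneg_left (Real.add_one_le_exp (c * f z - c * m))
      (Real.exp_nonneg (c * m))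
    rwa [← Real.exp_add, add_sub_cancel] at this
  have key : ∀ n : ℕ, ∫ z, Real.exp (t * f z) ∂stdGauss ι ≤
      Real.exp (t * m + (t ^ 2 + t ^ 2 * (1 / ((n : ℝ) + 1))) / 2) := by
    intro n
    have hn : (n : ℝ) + 1 ≠ 0 := by positivity
    -- One replica carries the weight `t` and `n + 1` others share `-t` equally. By Jensen the
    -- others contribute a factor of at least `exp (-t m)`, while their squared weights add up to
    -- only `t ^ 2 / (n + 1)`, which vanishes as `n` grows.
    have := prod_integral_exp_le (τ := Option (Fin (n + 1))) h hg h2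
      (fun a => a.elim t fun _ => -t / (n + 1)) (by
        simp [Fintype.sum_option]
        field_simp
        ring)
    simp only [Fintype.prod_option, Fintype.sum_option, Option.elim, Finset.prod_const,
      Finset.sum_const, Finset.card_univ, Fintype.card_fin, nsmul_eq_mul, Nat.cast_add,
      Nat.cast_one] at this
    have h5 : Real.exp (-(t * m)) ≤
        (∫ z, Real.exp (-t / (n + 1) * f z) ∂stdGauss ι) ^ (n + 1) := by
      calc Real.exp (-(t * m)) = Real.exp (-t / (n + 1) * m) ^ (n + 1) := by
            rw [← Real.exp_nat_mul]; congr 1; push_cast; field_simp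
        _ ≤ _ := by gcongr; exact jensen _
    have h6 := (mul_le_mul_of_nonneg_left h5 (integral_nonneg fun z =>
      Real.exp_nonneg (t * f z))).trans this
    have h7 := mul_le_mul_of_nonneg_right h6 (Real.exp_nonneg (t * m))
    rw [mul_assoc, ← Real.exp_add, neg_add_cancel, Real.exp_zero, mul_one, ← Real.exp_add] at h7
    refine h7.trans_eq ?_
    congr 1
    field_simp
    ring
  have lim : Filter.Tendsto (fun n : ℕ =>
      Real.exp (t * m + (t ^ 2 + t ^ 2 * (1 / ((n : ℝ) + 1))) / 2)) Filter.atTop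
      (nhds (Real.exp (t * m + (t ^ 2 + t ^ 2 * 0) / 2))) :=
    (Real.continuous_exp.tendsto _).comp (((tendsto_one_div_add_atTop_nhds_zero_nat.const_mul
      _).const_add _).div_const _ |>.const_add _)
  simpa using ge_of_tendsto' lim key

end

/-! ### Smoothed norm, soft maximum and the Gordon functional. -/

section

section Smooth

variable {μ τ ι : Type*} [Fintype μ] [Fintype τ] [Fintype ι]

/-- A smooth approximation of the Euclidean norm. -/
noncomputable def smoothNorm (δ : ℝ) (v : μ → ℝ) : ℝ := √(∑ j, v j ^ 2 + δ)

/-- `log ∑ exp`, a smooth approximation of the maximum. -/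
noncomputable def logSumExp (y : τ → ℝ) : ℝ := Real.log (∑ a, Real.exp (y a))

/-- The gradient of `logSumExp`. -/
noncomputable def softWeight (y : τ → ℝ) (a : τ) : ℝ := Real.exp (y a) / ∑ b, Real.exp (y b)

theorem sum_sq_add_pos {δ : ℝ} (hδ : 0 < δ) (v : μ → ℝ) : 0 < ∑ j, v j ^ 2 + δ :=
  add_pos_of_nonneg_of_pos (Finset.sum_nonneg fun _ _ => sq_nonneg _) hδ

theorem smoothNorm_pos {δ : ℝ} (hδ : 0 < δ) (v : μ → ℝ) : 0 < smoothNorm δ v :=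
  Real.sqrt_pos.2 (sum_sq_add_pos hδ v)

theorem sq_smoothNorm {δ : ℝ} (hδ : 0 < δ) (v : μ → ℝ) :
    smoothNorm δ v ^ 2 = ∑ j, v j ^ 2 + δ :=
  Real.sq_sqrt (sum_sq_add_pos hδ v).le

theorem sqrt_le_smoothNorm {δ : ℝ} (hδ : 0 < δ) (v : μ → ℝ) :
    √(∑ j, v j ^ 2) ≤ smoothNorm δ v :=
  Real.sqrt_le_sqrt (by linarith)

theorem smoothNorm_le {δ : ℝ} (hδ : 0 < δ) (v : μ → ℝ) :
    smoothNorm δ v ≤ √(∑ j, v j ^ 2) + √δ := by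
  have h : 0 ≤ ∑ j, v j ^ 2 := Finset.sum_nonneg fun _ _ => sq_nonneg _
  refine Real.sqrt_le_iff.2 ⟨by positivity, ?_⟩
  nlinarith [Real.sq_sqrt h, Real.sq_sqrt hδ.le, Real.sqrt_nonneg (∑ j, v j ^ 2),
    Real.sqrt_nonneg δ]

theorem sum_sq_div_smoothNorm_le {δ : ℝ} (hδ : 0 < δ) (v : μ → ℝ) :
    ∑ j, (v j / smoothNorm δ v) ^ 2 ≤ 1 := by
  simp only [div_pow, ← Finset.sum_div]
  rw [sq_smoothNorm hδ, div_le_one (sum_sq_add_pos hδ v)]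
  linarith

theorem abs_div_smoothNorm_le {δ : ℝ} (hδ : 0 < δ) (v : μ → ℝ) (j : μ) :
    |v j / smoothNorm δ v| ≤ 1 := by
  rw [← sq_le_one_iff_abs_le_one]
  exact (Finset.single_le_sum (f := fun j => (v j / smoothNorm δ v) ^ 2)
    (fun _ _ => sq_nonneg _) (Finset.mem_univ j)).trans (sum_sq_div_smoothNorm_le hδ v)

theorem abs_inv_smoothNorm_le {δ : ℝ} (hδ : 0 < δ) (v : μ → ℝ) :
    |(smoothNorm δ v)⁻¹| ≤ (√δ)⁻¹ := by
  rw [abs_of_pos (inv_pos.2 (smoothNorm_pos hδ v))]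
  refine inv_anti₀ (Real.sqrt_pos.2 hδ) (Real.sqrt_le_sqrt ?_)
  linarith [Finset.sum_nonneg (s := Finset.univ) fun j _ => sq_nonneg (v j)]

theorem hasDerivAt_smoothNorm {δ : ℝ} (hδ : 0 < δ) (V v : μ → ℝ) :
    HasDerivAt (fun s : ℝ => smoothNorm δ (V + s • v)) (∑ j, V j / smoothNorm δ V * v j) 0 := by
  have h1 : HasDerivAt (fun s : ℝ => ∑ j, (V j + s * v j) ^ 2 + δ) (∑ j, 2 * V j * v j) 0 := by
    refine (HasDerivAt.fun_sum fun j _ => ?_).add_const δ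
    simpa using (((hasDerivAt_id (0 : ℝ)).mul_const (v j)).const_add (V j)).fun_pow 2
  have h2 := h1.sqrt (by simpa using (sum_sq_add_pos hδ V).ne')
  refine HasDerivAt.congr_deriv (f := fun s : ℝ => smoothNorm δ (V + s • v)) h2 ?_
  simp only [zero_mul, add_zero]
  rw [Finset.sum_div]
  refine Finset.sum_congr rfl fun j _ => ?_
  change _ / (2 * smoothNorm δ V) = _
  have := (smoothNorm_pos hδ V).ne'
  field_simp

theorem hasDerivAt_smoothNorm_deriv {δ : ℝ} (hδ : 0 < δ) (V v : μ → ℝ) :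
    HasDerivAt (fun s : ℝ => ∑ j, (V + s • v) j / smoothNorm δ (V + s • v) * v j)
      ((∑ j, v j ^ 2 - (∑ j, V j / smoothNorm δ V * v j) ^ 2) * (smoothNorm δ V)⁻¹) 0 := by
  have hN := (smoothNorm_pos hδ V).ne'
  have h1 : HasDerivAt (fun s : ℝ => ∑ j, (V + s • v) j * v j) (∑ j, v j * v j) 0 := by
    refine HasDerivAt.fun_sum fun j _ => HasDerivAt.mul_const ?_ (v j)
    simpa using ((hasDerivAt_id (0 : ℝ)).mul_const (v j)).const_add (V j)
  have h2 := h1.fun_div (hasDerivAt_smoothNorm hδ V v) (by simpa using hN)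
  have e : (fun s : ℝ => ∑ j, (V + s • v) j / smoothNorm δ (V + s • v) * v j) =
      fun s : ℝ => (∑ j, (V + s • v) j * v j) / smoothNorm δ (V + s • v) := by
    ext s
    rw [Finset.sum_div]
    exact Finset.sum_congr rfl fun j _ => by ring
  rw [e]
  refine h2.congr_deriv ?_
  have e2 : ∑ j, V j / smoothNorm δ V * v j = (∑ j, V j * v j) / smoothNorm δ V := by
    rw [Finset.sum_div]
    exact Finset.sum_congr rfl fun j _ => by ring
  simp only [zero_smul, add_zero, e2, sq]
  field_simp

theorem contDiff_smoothNorm {δ : ℝ} (hδ : 0 < δ) :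
    ContDiff ℝ 2 (smoothNorm δ : (μ → ℝ) → ℝ) := by
  unfold smoothNorm
  exact ContDiff.sqrt (by fun_prop) fun v => (sum_sq_add_pos hδ v).ne'

section LogSumExp

theorem sum_exp_pos [Nonempty τ] (y : τ → ℝ) : 0 < ∑ a, Real.exp (y a) :=
  Finset.sum_pos (fun _ _ => Real.exp_pos _) Finset.univ_nonempty

theorem softWeight_nonneg (y : τ → ℝ) (a : τ) : 0 ≤ softWeight y a :=
  div_nonneg (Real.exp_nonneg _) (Finset.sum_nonneg fun _ _ => Real.exp_nonneg _)

theorem sum_softWeight [Nonempty τ] (y : τ → ℝ) : ∑ a, softWeight y a = 1 := by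
  simp only [softWeight, ← Finset.sum_div]
  exact div_self (sum_exp_pos y).ne'

theorem softWeight_le_one [Nonempty τ] (y : τ → ℝ) (a : τ) : softWeight y a ≤ 1 :=
  (Finset.single_le_sum (f := softWeight y) (fun b _ => softWeight_nonneg y b)
    (Finset.mem_univ a)).trans_eq (sum_softWeight y)

theorem le_logSumExp [Nonempty τ] (y : τ → ℝ) (a : τ) : y a ≤ logSumExp y := by
  rw [logSumExp, Real.le_log_iff_exp_le (sum_exp_pos y)]
  exact Finset.single_le_sum (f := fun a => Real.exp (y a)) (fun _ _ => Real.exp_nonneg _)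
    (Finset.mem_univ a)

/-- Together with `le_logSumExp` this traps the maximum up to `log (card τ)`. When the argument is
scaled by `1 / e` and the result by `e`, the error becomes `e log (card τ)`. -/
theorem logSumExp_le [Nonempty τ] {y : τ → ℝ} {M : ℝ} (h : ∀ a, y a ≤ M) :
    logSumExp y ≤ M + Real.log (Fintype.card τ) := by
  have hc : (0 : ℝ) < Fintype.card τ := by exact_mod_cast Fintype.card_pos
  rw [logSumExp, Real.log_le_iff_le_exp (sum_exp_pos y), Real.exp_add, Real.exp_log hc, mul_comm]
  refine (Finset.sum_le_card_nsmul _ _ (Real.exp M) fun a _ => Real.exp_le_exp.2 (h a)).trans ?_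
  simp

theorem hasDerivAt_logSumExp [Nonempty τ] {y : τ → ℝ → ℝ} {y' : τ → ℝ} {s : ℝ}
    (h : ∀ a, HasDerivAt (y a) (y' a) s) :
    HasDerivAt (fun s => logSumExp fun a => y a s)
      (∑ a, softWeight (fun a => y a s) a * y' a) s := by
  have h1 : HasDerivAt (fun s => ∑ a, Real.exp (y a s)) (∑ a, Real.exp (y a s) * y' a) s :=
    HasDerivAt.fun_sum fun a _ => (h a).exp
  refine HasDerivAt.congr_deriv (h1.log (sum_exp_pos _).ne') ?_
  rw [Finset.sum_div]
  exact Finset.sum_congr rfl fun a _ => by rw [softWeight]; ring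

theorem hasDerivAt_softWeight [Nonempty τ] {y : τ → ℝ → ℝ} {y' : τ → ℝ} {s : ℝ}
    (h : ∀ a, HasDerivAt (y a) (y' a) s) (a : τ) :
    HasDerivAt (fun s => softWeight (fun a => y a s) a) (softWeight (fun a => y a s) a *
      (y' a - ∑ b, softWeight (fun a => y a s) b * y' b)) s := by
  have h1 : HasDerivAt (fun s => ∑ a, Real.exp (y a s)) (∑ a, Real.exp (y a s) * y' a) s :=
    HasDerivAt.fun_sum fun a _ => (h a).exp
  have hS := (sum_exp_pos fun a => y a s).ne'
  refine HasDerivAt.congr_deriv ((h a).exp.fun_div h1 hS) ?_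
  have e : ∑ b, softWeight (fun a => y a s) b * y' b =
      (∑ b, Real.exp (y b s) * y' b) / ∑ b, Real.exp (y b s) := by
    rw [Finset.sum_div]
    exact Finset.sum_congr rfl fun a _ => by rw [softWeight]; ring
  rw [e, softWeight]
  field_simp

end LogSumExp

/-- The functional `log ∑ exp (b (‖V_a‖ + c_a))`, with a smoothed norm. -/
noncomputable def gordonFun (b δ : ℝ) (z : (τ → μ → ℝ) × (τ → ℝ)) : ℝ :=
  logSumExp fun a => b * (smoothNorm δ (z.1 a) + z.2 a)

/-- Gibbs weights, favouring large values of `‖V_a‖ + c_a` for `b > 0` and small ones for `b < 0`.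
-/
noncomputable def gordonWeight (b δ : ℝ) (z : (τ → μ → ℝ) × (τ → ℝ)) : τ → ℝ :=
  softWeight fun a => b * (smoothNorm δ (z.1 a) + z.2 a)

/-- Derivative of `‖V_a‖ + c_a`. -/
noncomputable def gordonSlope (δ : ℝ) (z v : (τ → μ → ℝ) × (τ → ℝ)) (a : τ) : ℝ :=
  ∑ j, z.1 a j / smoothNorm δ (z.1 a) * v.1 a j + v.2 a

/-- Second derivative of `‖V_a‖ + c_a`. -/
noncomputable def gordonCurv (δ : ℝ) (z v : (τ → μ → ℝ) × (τ → ℝ)) (a : τ) : ℝ :=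
  (∑ j, v.1 a j ^ 2 - (∑ j, z.1 a j / smoothNorm δ (z.1 a) * v.1 a j) ^ 2) *
    (smoothNorm δ (z.1 a))⁻¹

noncomputable def gordonFirst (b δ : ℝ) (z v : (τ → μ → ℝ) × (τ → ℝ)) : ℝ :=
  b * ∑ a, gordonWeight b δ z a * gordonSlope δ z v a

/-- The mean curvature under the Gibbs weights, times `b`, plus `b ^ 2` times the variance of the
slopes. -/
noncomputable def gordonSecond (b δ : ℝ) (z v : (τ → μ → ℝ) × (τ → ℝ)) : ℝ :=
  b * ∑ a, gordonWeight b δ z a * gordonCurv δ z v a +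
    b ^ 2 * (∑ a, gordonWeight b δ z a * gordonSlope δ z v a ^ 2 -
      (∑ a, gordonWeight b δ z a * gordonSlope δ z v a) ^ 2)

theorem gordonWeight_nonneg (b δ : ℝ) (z : (τ → μ → ℝ) × (τ → ℝ)) (a : τ) :
    0 ≤ gordonWeight b δ z a := softWeight_nonneg _ a

theorem expGrowth_gordonNormal {δ : ℝ} (hδ : 0 < δ) (v : μ → ℝ) (a : τ) :
    ExpGrowth fun z : (τ → μ → ℝ) × (τ → ℝ) =>
      ∑ j, z.1 a j / smoothNorm δ (z.1 a) * v j :=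
  .sum fun j => .mul (f := fun z : (τ → μ → ℝ) × (τ → ℝ) => z.1 a j / smoothNorm δ (z.1 a))
    (.of_bounded 1 fun z => abs_div_smoothNorm_le hδ (z.1 a) j) (.const _)

theorem expGrowth_gordonSlope {δ : ℝ} (hδ : 0 < δ) (v : (τ → μ → ℝ) × (τ → ℝ)) (a : τ) :
    ExpGrowth fun z => gordonSlope δ z v a :=
  (expGrowth_gordonNormal hδ (v.1 a) a).add (.const _)

variable [Nonempty τ]

theorem isC2_gordonFun (b : ℝ) {δ : ℝ} (hδ : 0 < δ) :
    IsC2 (gordonFun b δ : (τ → μ → ℝ) × (τ → ℝ) → ℝ) (gordonFirst b δ) (gordonSecond b δ) := by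
  have hy : ∀ (z v : (τ → μ → ℝ) × (τ → ℝ)) (a : τ), HasDerivAt
      (fun s : ℝ => b * (smoothNorm δ ((z + s • v).1 a) + (z + s • v).2 a))
      (b * gordonSlope δ z v a) 0 := by
    intro z v a
    refine HasDerivAt.const_mul b (HasDerivAt.fun_add (hasDerivAt_smoothNorm hδ (z.1 a) (v.1 a)) ?_)
    simpa using ((hasDerivAt_id (0 : ℝ)).mul_const (v.2 a)).const_add (z.2 a)
  have hz : ∀ z v : (τ → μ → ℝ) × (τ → ℝ), z + (0 : ℝ) • v = z := fun z v => by simp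
  refine ⟨?_, fun z v => ?_, fun z v => ?_⟩
  · unfold gordonFun logSumExp
    refine ContDiff.log (ContDiff.sum fun a _ => ContDiff.exp (contDiff_const.mul
      (ContDiff.add ?_ (by fun_prop)))) fun z => (sum_exp_pos _).ne'
    exact (contDiff_smoothNorm hδ).comp (by fun_prop)
  · refine (hasDerivAt_logSumExp (hy z v)).congr_deriv ?_
    simp only [hz, gordonFirst, gordonWeight, Finset.mul_sum]
    exact Finset.sum_congr rfl fun a _ => by ring
  · have h1 := fun a => (hasDerivAt_softWeight (hy z v) a).fun_mul
      ((hasDerivAt_smoothNorm_deriv hδ (z.1 a) (v.1 a)).add_const (v.2 a))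
    have h2 := (HasDerivAt.fun_sum (u := Finset.univ) fun a _ => h1 a).const_mul b
    refine h2.congr_deriv ?_
    simp only [hz, gordonSecond, gordonCurv]
    have e1 : ∀ a, (z.1 a + (0 : ℝ) • v.1 a) = z.1 a := fun a => by simp
    simp only [e1]
    change b * ∑ a, (gordonWeight b δ z a * (b * gordonSlope δ z v a -
      ∑ c, gordonWeight b δ z c * (b * gordonSlope δ z v c)) * gordonSlope δ z v a +
      gordonWeight b δ z a * _) = _
    have e2 : ∑ c, gordonWeight b δ z c * (b * gordonSlope δ z v c) =
        b * ∑ c, gordonWeight b δ z c * gordonSlope δ z v c := by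
      rw [Finset.mul_sum]; exact Finset.sum_congr rfl fun a _ => by ring
    rw [e2, Finset.sum_add_distrib]
    set S := ∑ c, gordonWeight b δ z c * gordonSlope δ z v c with hS
    clear_value S
    have e3 : ∑ a, gordonWeight b δ z a * (b * gordonSlope δ z v a - b * S) *
        gordonSlope δ z v a = b * (∑ a, gordonWeight b δ z a * gordonSlope δ z v a ^ 2 - S ^ 2) := by
      have e4 : S ^ 2 = ∑ a, S * (gordonWeight b δ z a * gordonSlope δ z v a) := by
        rw [← Finset.mul_sum, ← hS, sq]
      rw [e4, ← Finset.sum_sub_distrib, Finset.mul_sum]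
      exact Finset.sum_congr rfl fun a _ => by ring
    rw [e3]
    ring

theorem sum_gordonWeight (b δ : ℝ) (z : (τ → μ → ℝ) × (τ → ℝ)) :
    ∑ a, gordonWeight b δ z a = 1 := sum_softWeight _

theorem expGrowth_gordonWeight (b δ : ℝ) (a : τ) :
    ExpGrowth fun z : (τ → μ → ℝ) × (τ → ℝ) => gordonWeight b δ z a :=
  .of_bounded 1 fun z => by
    rw [abs_of_nonneg (gordonWeight_nonneg b δ z a)]; exact softWeight_le_one _ a

theorem expGrowth_gordonFirst (b : ℝ) {δ : ℝ} (hδ : 0 < δ) (v : (τ → μ → ℝ) × (τ → ℝ)) :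
    ExpGrowth fun z => gordonFirst b δ z v :=
  (ExpGrowth.const _).mul (.sum fun a => (expGrowth_gordonWeight b δ a).mul
    (expGrowth_gordonSlope hδ v a))

theorem expGrowth_gordonSecond (b : ℝ) {δ : ℝ} (hδ : 0 < δ) (v : (τ → μ → ℝ) × (τ → ℝ)) :
    ExpGrowth fun z => gordonSecond b δ z v := by
  have hs := fun a => expGrowth_gordonSlope hδ v a
  have hw := fun a : τ => expGrowth_gordonWeight (μ := μ) b δ a
  have hn := fun a => expGrowth_gordonNormal hδ (v.1 a) a
  have hS := ExpGrowth.sum (s := Finset.univ) fun a => (hw a).mul (hs a)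
  refine ((ExpGrowth.const _).mul (.sum fun a => (hw a).mul ?_)).add
    ((ExpGrowth.const _).mul ((ExpGrowth.sum fun a => (hw a).mul ?_).sub ?_))
  · refine ((ExpGrowth.const _).sub ?_).mul
      (.of_bounded (√δ)⁻¹ fun z => abs_inv_smoothNorm_le hδ (z.1 a))
    simpa only [sq] using (hn a).mul (hn a)
  · simpa only [sq] using (hs a).mul (hs a)
  · simpa only [sq] using hS.mul hS

theorem abs_gordonFirst_le (b : ℝ) {δ : ℝ} (hδ : 0 < δ) (z v : (τ → μ → ℝ) × (τ → ℝ)) :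
    |gordonFirst b δ z v| ≤ |b| * (Fintype.card μ + 1) * ‖v‖ := by
  have h1 : ∀ a, |gordonSlope δ z v a| ≤ (Fintype.card μ + 1) * ‖v‖ := by
    intro a
    rw [add_mul, one_mul]
    refine (abs_add_le _ _).trans (add_le_add ((Finset.abs_sum_le_sum_abs _ _).trans ?_)
      ((norm_le_pi_norm v.2 a).trans (norm_snd_le v)))
    refine (Finset.sum_le_card_nsmul _ _ ‖v‖ fun j _ => ?_).trans (by simp)
    rw [abs_mul]
    exact (mul_le_of_le_one_left (abs_nonneg _) (abs_div_smoothNorm_le hδ _ j)).trans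
      ((norm_le_pi_norm (v.1 a) j).trans ((norm_le_pi_norm v.1 a).trans (norm_fst_le v)))
  rw [gordonFirst, abs_mul, mul_assoc]
  gcongr
  refine (Finset.abs_sum_le_sum_abs _ _).trans ?_
  calc ∑ a, |gordonWeight b δ z a * gordonSlope δ z v a|
      ≤ ∑ a, gordonWeight b δ z a * ((Fintype.card μ + 1) * ‖v‖) := by
        refine Finset.sum_le_sum fun a _ => ?_
        rw [abs_mul, abs_of_nonneg (gordonWeight_nonneg b δ z a)]
        exact mul_le_mul_of_nonneg_left (h1 a) (gordonWeight_nonneg b δ z a)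
    _ = _ := by rw [← Finset.sum_mul, sum_gordonWeight, one_mul]

theorem expGrowth_gordonFun (b : ℝ) {δ : ℝ} (hδ : 0 < δ) :
    ExpGrowth (gordonFun b δ : (τ → μ → ℝ) × (τ → ℝ) → ℝ) :=
  .of_le_add_mul_norm (abs_nonneg _) (by positivity)
    ((isC2_gordonFun b hδ).abs_le (by positivity) (abs_gordonFirst_le b hδ))

end Smooth

end

/-! ### Gordon's inequality and concentration for soft extrema of `‖G t_a‖`. -/

section

section Gordon

variable {μ τ ι : Type*} [Fintype μ] [Fintype ι]

theorem sqrt_sum_sq_le_mul_norm (g : μ → ℝ) : √(∑ j, g j ^ 2) ≤ √(Fintype.card μ) * ‖g‖ := by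
  refine Real.sqrt_le_iff.2 ⟨by positivity, ?_⟩
  rw [mul_pow, Real.sq_sqrt (Nat.cast_nonneg _)]
  refine (Finset.sum_le_card_nsmul _ _ (‖g‖ ^ 2) fun j _ => ?_).trans (by simp)
  rw [← sq_abs]
  gcongr
  exact norm_le_pi_norm g j

theorem expGrowth_smoothNorm {δ : ℝ} (hδ : 0 < δ) : ExpGrowth (smoothNorm δ : (μ → ℝ) → ℝ) := by
  refine .of_le_add_mul_norm (a := √δ) (b := √(Fintype.card μ)) (Real.sqrt_nonneg _)
    (Real.sqrt_nonneg _) fun g => ?_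
  rw [abs_of_pos (smoothNorm_pos hδ g)]
  linarith [smoothNorm_le hδ g, sqrt_sum_sq_le_mul_norm g]

theorem expGrowth_sqrt_sum_sq : ExpGrowth fun g : μ → ℝ => √(∑ j, g j ^ 2) :=
  .of_le_add_mul_norm (a := 0) (b := √(Fintype.card μ)) le_rfl (Real.sqrt_nonneg _) fun g => by
    rw [abs_of_nonneg (Real.sqrt_nonneg _), zero_add]
    exact sqrt_sum_sq_le_mul_norm g

theorem continuous_smoothNorm {δ : ℝ} (hδ : 0 < δ) :
    Continuous (smoothNorm δ : (μ → ℝ) → ℝ) := (contDiff_smoothNorm hδ).continuous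

/-- The family `(G t_a)_a` as a linear function of the matrix `G`. -/
noncomputable def matrixField (μ : Type*) [Fintype μ] (t : τ → ι → ℝ) :
    (μ × ι → ℝ) →L[ℝ] (τ → μ → ℝ) × (τ → ℝ) :=
  (ContinuousLinearMap.pi fun a => ContinuousLinearMap.pi fun j =>
    ∑ i, t a i • ContinuousLinearMap.proj (j, i)).prod 0

/-- The family `(g, ⟨h, t_a⟩)_a` as a linear function of the vectors `g` and `h`. -/
noncomputable def decoupledField (μ : Type*) [Fintype μ] (t : τ → ι → ℝ) :
    (μ ⊕ ι → ℝ) →L[ℝ] (τ → μ → ℝ) × (τ → ℝ) :=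
  (ContinuousLinearMap.pi fun _ => ContinuousLinearMap.pi fun j =>
    ContinuousLinearMap.proj (Sum.inl j)).prod
  (ContinuousLinearMap.pi fun a => ∑ i, t a i • ContinuousLinearMap.proj (Sum.inr i))

theorem matrixField_apply (t : τ → ι → ℝ) (G : μ × ι → ℝ) :
    matrixField μ t G = (fun a j => ∑ i, G (j, i) * t a i, 0) := by
  ext <;> simp [matrixField, mul_comm]

theorem decoupledField_apply (t : τ → ι → ℝ) (y : μ ⊕ ι → ℝ) :
    decoupledField μ t y =
      (fun _ j => y (Sum.inl j), fun a => ∑ i, y (Sum.inr i) * t a i) := by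
  ext <;> simp [decoupledField, mul_comm]

section Single

variable [DecidableEq μ] [DecidableEq ι]

theorem matrixField_single (t : τ → ι → ℝ) (p : μ × ι) :
    matrixField μ t (Pi.single p 1) = (fun a => Pi.single p.1 (t a p.2), 0) := by
  obtain ⟨j, i⟩ := p
  rw [matrixField_apply]
  ext a k
  · by_cases hk : k = j
    · subst hk; simp [Pi.single_apply]
    · simp [hk]
  · rfl

theorem decoupledField_single_inl (t : τ → ι → ℝ) (j : μ) :
    decoupledField μ t (Pi.single (Sum.inl j) 1) = (fun _ => Pi.single j 1, 0) := by
  rw [decoupledField_apply]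
  ext a k <;> simp [Pi.single_apply]

theorem decoupledField_single_inr (t : τ → ι → ℝ) (i : ι) :
    decoupledField μ t (Pi.single (Sum.inr i) 1) = (0, fun a => t a i) := by
  rw [decoupledField_apply]
  ext a k <;> simp [Pi.single_apply]

end Single

variable [Fintype τ]

theorem sum_sq_weighted_sum {k : Type*} [Fintype k] (w : τ → ℝ) (u : τ → k → ℝ) :
    ∑ i, (∑ a, w a * u a i) ^ 2 = ∑ a, ∑ c, w a * w c * ∑ i, u a i * u c i := by
  have e : ∀ i, (∑ a, w a * u a i) ^ 2 = ∑ a, ∑ c, w a * w c * (u a i * u c i) := fun i => by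
    rw [sq, Finset.sum_mul_sum]
    exact Finset.sum_congr rfl fun a _ => Finset.sum_congr rfl fun c _ => by ring
  simp only [e, Finset.mul_sum]
  rw [Finset.sum_comm]
  exact Finset.sum_congr rfl fun a _ => Finset.sum_comm

theorem sum_mul_le_one {k : Type*} [Fintype k] {u v : k → ℝ} (hu : ∑ i, u i ^ 2 ≤ 1)
    (hv : ∑ i, v i ^ 2 ≤ 1) : ∑ i, u i * v i ≤ 1 := by
  have : ∑ i, u i * v i ≤ ∑ i, (u i ^ 2 + v i ^ 2) / 2 :=
    Finset.sum_le_sum fun i _ => by nlinarith [sq_nonneg (u i - v i)]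
  rw [← Finset.sum_div, Finset.sum_add_distrib] at this
  linarith

/-- The algebraic core of Gordon's inequality. Expanded over pairs `a`, `c`, the difference of the
two sides is the `w a * w c`-weighted sum of `(1 - ⟨n_a, n_c⟩) (1 - ⟨t_a, t_c⟩)`, and both factors
are nonnegative by Cauchy–Schwarz. -/
theorem sum_sq_weighted_add_le {w : τ → ℝ} (hw : ∀ a, 0 ≤ w a) (hw1 : ∑ a, w a = 1)
    {n : τ → μ → ℝ} {t : τ → ι → ℝ} (hn : ∀ a, ∑ j, n a j ^ 2 ≤ 1) (ht : ∀ a, ∑ i, t a i ^ 2 ≤ 1) :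
    ∑ j, (∑ a, w a * n a j) ^ 2 + ∑ i, (∑ a, w a * t a i) ^ 2 ≤
      1 + ∑ p : μ × ι, (∑ a, w a * (n a p.1 * t a p.2)) ^ 2 := by
  have h1 : ∑ a, ∑ c, w a * w c = 1 := by
    rw [← Finset.sum_mul_sum, hw1, one_mul]
  rw [sum_sq_weighted_sum, sum_sq_weighted_sum, sum_sq_weighted_sum, ← h1, ← sub_nonneg]
  simp only [← Finset.sum_add_distrib, ← Finset.sum_sub_distrib]
  refine Finset.sum_nonneg fun a _ => Finset.sum_nonneg fun c _ => ?_
  have e : ∑ p : μ × ι, n a p.1 * t a p.2 * (n c p.1 * t c p.2) =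
      (∑ j, n a j * n c j) * ∑ i, t a i * t c i := by
    rw [Finset.sum_mul_sum, Fintype.sum_prod_type]
    exact Finset.sum_congr rfl fun j _ => Finset.sum_congr rfl fun i _ => by ring
  rw [e]
  have h2 := mul_nonneg (mul_nonneg (hw a) (hw c)) (mul_nonneg
    (sub_nonneg.2 (sum_mul_le_one (hn a) (hn c))) (sub_nonneg.2 (sum_mul_le_one (ht a) (ht c))))
  nlinarith [h2]

theorem continuous_logSumExp [Nonempty τ] : Continuous (logSumExp : (τ → ℝ) → ℝ) := by
  unfold logSumExp
  exact Continuous.log (by fun_prop) fun y => (sum_exp_pos y).ne'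

theorem abs_logSumExp_le [Nonempty τ] (y : τ → ℝ) :
    |logSumExp y| ≤ ∑ a, |y a| + Real.log (Fintype.card τ) := by
  have h : ∀ a, |y a| ≤ ∑ a, |y a| := fun a =>
    Finset.single_le_sum (f := fun a => |y a|) (fun _ _ => abs_nonneg _) (Finset.mem_univ a)
  have h0 : 0 ≤ Real.log (Fintype.card τ) := Real.log_natCast_nonneg _
  refine abs_le.2 ⟨?_, logSumExp_le fun a => (le_abs_self _).trans (h a)⟩
  have a := Classical.arbitrary τ
  linarith [le_logSumExp y a, neg_abs_le (y a), h a]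

theorem ExpGrowth.logSumExp [Nonempty τ] {E : Type*} [SeminormedAddCommGroup E] {Y : τ → E → ℝ}
    (h : ∀ a, ExpGrowth (Y a)) : ExpGrowth fun z => GaussianRecovery.logSumExp fun a => Y a z :=
  ((ExpGrowth.sum (s := Finset.univ) fun a => (h a).abs).add (.const _)).mono fun _ =>
    (abs_logSumExp_le _).trans (le_abs_self _)

theorem logSumExp_const_add [Nonempty τ] (c : ℝ) (y : τ → ℝ) :
    logSumExp (fun a => c + y a) = c + logSumExp y := by
  simp only [logSumExp, Real.exp_add, ← Finset.mul_sum]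
  rw [Real.log_mul (Real.exp_pos c).ne' (sum_exp_pos y).ne', Real.log_exp]

variable [DecidableEq μ] [DecidableEq ι]

variable [Nonempty τ]

/-- Because `‖t_a‖ = 1`, the curvature terms of the two fields agree, so only the variances of the
slopes are compared. These carry the factor `b ^ 2`, which is why the sign of `b` plays no role. -/
theorem sum_gordonSecond_le (b : ℝ) {δ : ℝ} (hδ : 0 < δ) {t : τ → ι → ℝ}
    (ht : ∀ a, ∑ i, t a i ^ 2 = 1) (z : (τ → μ → ℝ) × (τ → ℝ)) :
    ∑ p, gordonSecond b δ z (matrixField μ t (Pi.single p 1)) ≤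
      ∑ k, gordonSecond b δ z (decoupledField μ t (Pi.single k 1)) := by
  set w := gordonWeight b δ z with hw
  set n : τ → μ → ℝ := fun a j => z.1 a j / smoothNorm δ (z.1 a) with hn
  have l1 : ∀ p a, gordonSlope δ z (matrixField μ t (Pi.single p 1)) a = n a p.1 * t a p.2 := by
    intro p a
    rw [matrixField_single]
    simp [gordonSlope, Pi.single_apply, hn]
  have l2 : ∀ p a, gordonCurv δ z (matrixField μ t (Pi.single p 1)) a =
      (1 - n a p.1 ^ 2) * t a p.2 ^ 2 * (smoothNorm δ (z.1 a))⁻¹ := by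
    intro p a
    rw [matrixField_single]
    have : ∑ j, (Pi.single p.1 (t a p.2) : μ → ℝ) j ^ 2 = t a p.2 ^ 2 := by
      simp [Pi.single_apply]
    have h2 : ∑ j, n a j * (Pi.single p.1 (t a p.2) : μ → ℝ) j = n a p.1 * t a p.2 := by
      simp [Pi.single_apply]
    simp only [gordonCurv, this]
    rw [h2]
    ring
  have m1 : ∀ j a, gordonSlope δ z (decoupledField μ t (Pi.single (Sum.inl j) 1)) a = n a j := by
    intro j a
    rw [decoupledField_single_inl]
    simp [gordonSlope, Pi.single_apply, hn]
  have m2 : ∀ i a, gordonSlope δ z (decoupledField μ t (Pi.single (Sum.inr i) 1)) a = t a i := by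
    intro i a
    rw [decoupledField_single_inr]
    simp [gordonSlope]
  have m3 : ∀ j a, gordonCurv δ z (decoupledField μ t (Pi.single (Sum.inl j) 1)) a =
      (1 - n a j ^ 2) * (smoothNorm δ (z.1 a))⁻¹ := by
    intro j a
    rw [decoupledField_single_inl]
    simp [gordonCurv, Pi.single_apply, hn]
  have m4 : ∀ i a, gordonCurv δ z (decoupledField μ t (Pi.single (Sum.inr i) 1)) a = 0 := by
    intro i a
    rw [decoupledField_single_inr]
    simp [gordonCurv]
  simp only [gordonSecond, ← hw, l1, l2, m1, m2, m3, m4, Fintype.sum_sum_type, mul_zero,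
    Finset.sum_const_zero, Finset.sum_add_distrib, ← Finset.mul_sum,
    Finset.sum_sub_distrib]
  have c1 : ∑ p : μ × ι, ∑ a, w a * ((1 - n a p.1 ^ 2) * t a p.2 ^ 2 * (smoothNorm δ (z.1 a))⁻¹) =
      ∑ j, ∑ a, w a * ((1 - n a j ^ 2) * (smoothNorm δ (z.1 a))⁻¹) := by
    rw [Finset.sum_comm, Finset.sum_comm (s := (Finset.univ : Finset μ))]
    refine Finset.sum_congr rfl fun a _ => ?_
    rw [Fintype.sum_prod_type]
    refine Finset.sum_congr rfl fun j _ => ?_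
    calc _ = w a * ((1 - n a j ^ 2) * (smoothNorm δ (z.1 a))⁻¹) * ∑ i, t a i ^ 2 := by
          rw [Finset.mul_sum]; exact Finset.sum_congr rfl fun i _ => by ring
      _ = _ := by rw [ht, mul_one]
  have c2 : ∑ p : μ × ι, ∑ a, w a * (n a p.1 * t a p.2) ^ 2 = ∑ j, ∑ a, w a * n a j ^ 2 := by
    rw [Finset.sum_comm, Finset.sum_comm (s := (Finset.univ : Finset μ))]
    refine Finset.sum_congr rfl fun a _ => ?_
    rw [Fintype.sum_prod_type]
    refine Finset.sum_congr rfl fun j _ => ?_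
    calc _ = w a * n a j ^ 2 * ∑ i, t a i ^ 2 := by
          rw [Finset.mul_sum]; exact Finset.sum_congr rfl fun i _ => by ring
      _ = _ := by rw [ht, mul_one]
  have c3 : ∑ i, ∑ a, w a * t a i ^ 2 = 1 := by
    rw [Finset.sum_comm]
    simp only [← Finset.mul_sum, ht, mul_one]
    exact sum_gordonWeight b δ z
  rw [c1, c2, c3, add_zero, add_le_add_iff_left]
  refine mul_le_mul_of_nonneg_left ?_ (sq_nonneg b)
  linarith [sum_sq_weighted_add_le (gordonWeight_nonneg b δ z) (sum_gordonWeight b δ z)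
    (n := n) (t := t) (fun a => sum_sq_div_smoothNorm_le hδ _) fun a => (ht a).le]

/-- **Gordon's comparison inequality** for the Gaussian operator, in smoothed form. For `b > 0` it
compares maxima, for `b < 0` minima. -/
theorem integral_logSumExp_matrix_le (b : ℝ) {δ : ℝ} (hδ : 0 < δ) {t : τ → ι → ℝ}
    (ht : ∀ a, ∑ i, t a i ^ 2 = 1) :
    ∫ G : μ × ι → ℝ, logSumExp (fun a => b * smoothNorm δ fun j => ∑ i, G (j, i) * t a i)
        ∂stdGauss (μ × ι) ≤
      b * ∫ g, smoothNorm δ g ∂stdGauss μ +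
        ∫ h, logSumExp (fun a => b * ∑ i, h i * t a i) ∂stdGauss ι := by
  have hC := (isC2_gordonFun (μ := μ) (τ := τ) b hδ).const_mul (-1)
  have g1 := fun v : (τ → μ → ℝ) × (τ → ℝ) =>
    (ExpGrowth.const (-1)).mul (expGrowth_gordonFirst b hδ v)
  have g2 := fun v : (τ → μ → ℝ) × (τ → ℝ) =>
    (ExpGrowth.const (-1)).mul (expGrowth_gordonSecond b hδ v)
  have main := integral_comparison hC (matrixField μ t) (decoupledField μ t)
    ((ExpGrowth.const (-1)).mul (expGrowth_gordonFun b hδ)) (fun _ => g1 _) (fun _ => g1 _)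
    (fun _ => g2 _) (fun _ => g2 _) fun z => by
      rw [← Finset.mul_sum, ← Finset.mul_sum]
      linarith [sum_gordonSecond_le b hδ ht z]
  rw [integral_const_mul, integral_const_mul] at main
  have main' : ∫ z, gordonFun b δ (matrixField μ t z) ∂stdGauss (μ × ι) ≤
      ∫ y, gordonFun b δ (decoupledField μ t y) ∂stdGauss (μ ⊕ ι) := by linarith
  have e1 : ∀ G, gordonFun b δ (matrixField μ t G) =
      logSumExp fun a => b * smoothNorm δ fun j => ∑ i, G (j, i) * t a i := by
    intro G
    simp [gordonFun, matrixField_apply]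
  -- In the decoupled field every index `a` sees the same vector `g`, so its norm leaves `logSumExp`
  -- as an additive constant.
  have e2 : ∀ y : μ ⊕ ι → ℝ, gordonFun b δ (decoupledField μ t y) =
      b * smoothNorm δ (fun j => y (Sum.inl j)) +
        logSumExp fun a => b * ∑ i, y (Sum.inr i) * t a i := by
    intro y
    simp only [gordonFun, decoupledField_apply, mul_add]
    exact logSumExp_const_add _ _
  simp only [e1, e2] at main'
  refine main'.trans_eq ?_
  have k1 : Continuous fun g : μ → ℝ => smoothNorm δ g := (contDiff_smoothNorm hδ).continuous
  have k2 : Continuous fun h : ι → ℝ => logSumExp fun a => b * ∑ i, h i * t a i :=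
    continuous_logSumExp.comp (by fun_prop)
  have i1 : Integrable (fun y : μ ⊕ ι → ℝ => b * smoothNorm δ fun j => y (Sum.inl j))
      (stdGauss (μ ⊕ ι)) :=
    ((measurePreserving_comp_stdGauss Sum.inl_injective).integrable_comp_of_integrable
      ((expGrowth_smoothNorm hδ).integrable_of_continuous k1)).const_mul b
  have i2 : Integrable (fun y : μ ⊕ ι → ℝ => logSumExp fun a => b * ∑ i, y (Sum.inr i) * t a i)
      (stdGauss (μ ⊕ ι)) :=
    (ExpGrowth.logSumExp fun a => (ExpGrowth.const b).mul (.sum fun i =>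
      (ExpGrowth.eval (Sum.inr i)).mul (.const _))).integrable_of_continuous
      (continuous_logSumExp.comp (by fun_prop))
  rw [integral_add i1 i2, integral_const_mul,
    integral_comp_stdGauss (e := (Sum.inl : μ → μ ⊕ ι)) Sum.inl_injective
      (f := fun g => smoothNorm δ g) k1.aestronglyMeasurable,
    integral_comp_stdGauss (e := (Sum.inr : ι → μ ⊕ ι)) Sum.inr_injective
      (f := fun h => logSumExp fun a => b * ∑ i, h i * t a i) k2.aestronglyMeasurable]

/-- Concentration of the smoothed minimum (`b < 0`) or maximum (`b > 0`) of the norms `‖G t_a‖`. -/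
theorem integral_exp_logSumExp_matrix_le {b : ℝ} (hb : b ≠ 0) {δ : ℝ} (hδ : 0 < δ) {t : τ → ι → ℝ}
    (ht : ∀ a, ∑ i, t a i ^ 2 = 1) (s : ℝ) :
    Integrable (fun G : μ × ι → ℝ => Real.exp (s * (b⁻¹ * logSumExp
      (fun a => b * smoothNorm δ fun j => ∑ i, G (j, i) * t a i)))) (stdGauss (μ × ι)) ∧
    ∫ G : μ × ι → ℝ, Real.exp (s * (b⁻¹ * logSumExp
      (fun a => b * smoothNorm δ fun j => ∑ i, G (j, i) * t a i))) ∂stdGauss (μ × ι) ≤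
    Real.exp (s * (b⁻¹ * ∫ G : μ × ι → ℝ, logSumExp
      (fun a => b * smoothNorm δ fun j => ∑ i, G (j, i) * t a i) ∂stdGauss (μ × ι)) +
      s ^ 2 / 2) := by
  have hC := ((isC2_gordonFun (μ := μ) (τ := τ) b hδ).comp_linear (matrixField μ t)).const_mul b⁻¹
  have e1 : ∀ G, gordonFun b δ (matrixField μ t G) =
      logSumExp fun a => b * smoothNorm δ fun j => ∑ i, G (j, i) * t a i := by
    intro G
    simp [gordonFun, matrixField_apply]
  have hg : ∀ G, ∑ p, (b⁻¹ * gordonFirst b δ (matrixField μ t G)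
      (matrixField μ t (Pi.single p 1))) ^ 2 ≤ 1 := by
    intro G
    set z := matrixField μ t G
    set w := gordonWeight b δ z with hw
    set n : τ → μ → ℝ := fun a j => z.1 a j / smoothNorm δ (z.1 a) with hn
    have l1 : ∀ p a, gordonSlope δ z (matrixField μ t (Pi.single p 1)) a =
        n a p.1 * t a p.2 := by
      intro p a
      rw [matrixField_single]
      simp [gordonSlope, Pi.single_apply, hn]
    have hw0 : ∀ a, 0 ≤ w a := gordonWeight_nonneg b δ z
    have hw1 : ∑ a, w a = 1 := sum_gordonWeight b δ z
    simp only [gordonFirst, inv_mul_cancel_left₀ hb, l1, ← hw]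
    -- The gradient is the weighted mean of the rank-one matrices `n_a ⊗ t_a`, each of Frobenius
    -- norm at most 1; convexity of the square bounds the mean.
    calc ∑ p : μ × ι, (∑ a, w a * (n a p.1 * t a p.2)) ^ 2
        ≤ ∑ p : μ × ι, ∑ a, w a * (n a p.1 * t a p.2) ^ 2 := by
          refine Finset.sum_le_sum fun p _ => ?_
          have := Finset.sum_sq_le_sum_mul_sum_of_sq_le_mul Finset.univ
            (r := fun a => w a * (n a p.1 * t a p.2)) (f := w)
            (g := fun a => w a * (n a p.1 * t a p.2) ^ 2) (fun a _ => hw0 a)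
            (fun a _ => mul_nonneg (hw0 a) (sq_nonneg _)) fun a _ => le_of_eq (by ring)
          rwa [hw1, one_mul] at this
      _ = ∑ a, w a * ∑ j, n a j ^ 2 := by
          rw [Finset.sum_comm]
          refine Finset.sum_congr rfl fun a _ => ?_
          rw [← Finset.mul_sum, Fintype.sum_prod_type]
          congr 1
          refine Finset.sum_congr rfl fun j _ => ?_
          simp only [mul_pow, ← Finset.mul_sum, ht, mul_one]
      _ ≤ ∑ a, w a * 1 := Finset.sum_le_sum fun a _ =>
          mul_le_mul_of_nonneg_left (sum_sq_div_smoothNorm_le hδ _) (hw0 a)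
      _ = 1 := by simp [hw1]
  have h2 : ∀ v, ExpGrowth fun G => b⁻¹ * gordonSecond b δ (matrixField μ t G)
      (matrixField μ t v) := fun v =>
    (ExpGrowth.const _).mul (ExpGrowth.comp (f := fun z => gordonSecond b δ z _)
      (expGrowth_gordonSecond b hδ _) (matrixField μ t).le_opNorm)
  have main := integral_exp_mul_le hC hg h2 s
  have int := (expGrowth_exp_mul_of_sum_sq_le hC hg s).integrable_of_continuous
    (Real.continuous_exp.comp (continuous_const.mul hC.contDiff.continuous))
  rw [integral_const_mul] at main
  simp only [e1] at main int
  exact ⟨int, main⟩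

end Gordon

end

/-! ### Expected norm of a standard Gaussian vector. -/

section

section Chi

variable {μ : Type*} [Fintype μ]

theorem integrable_sq_eval (j : μ) : Integrable (fun g : μ → ℝ => g j ^ 2) (stdGauss μ) := by
  simpa only [sq] using
    ((ExpGrowth.eval j).mul (.eval j)).integrable_of_continuous (by fun_prop)

theorem integral_sum_sq : ∫ g : μ → ℝ, ∑ j, g j ^ 2 ∂stdGauss μ = Fintype.card μ := by
  classical
  rw [integral_finsetSum _ fun j _ => integrable_sq_eval j]
  have : ∀ j : μ, ∫ g : μ → ℝ, g j ^ 2 ∂stdGauss μ = 1 := by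
    intro j
    have := integral_eval_mul_stdGauss (ι := μ) j (H := fun g => g j) (H' := fun _ => 1)
      (fun z => by simpa using (hasDerivAt_id (0 : ℝ)).const_add (z j))
      ((ExpGrowth.eval j).integrable_of_continuous (by fun_prop)) (integrable_const _)
      (by simpa only [sq] using integrable_sq_eval j)
    simpa only [sq, integral_const, probReal_univ, smul_eq_mul, mul_one] using this
  simp [this]

/-- Integrate `x ≤ x² / (2c) + c / 2` with `c = √(card μ)`, the square root of the mean of `x²`. -/
theorem integral_sqrt_sum_sq_le :
    ∫ g : μ → ℝ, √(∑ j, g j ^ 2) ∂stdGauss μ ≤ √(Fintype.card μ) := by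
  rcases isEmpty_or_nonempty μ with h | h
  · simp
  have hc : (0 : ℝ) < √(Fintype.card μ) := Real.sqrt_pos.2 (by exact_mod_cast Fintype.card_pos)
  have hi : Integrable (fun g : μ → ℝ => ∑ j, g j ^ 2) (stdGauss μ) :=
    integrable_finsetSum _ fun j _ => integrable_sq_eval j
  have : ∫ g : μ → ℝ, √(∑ j, g j ^ 2) ∂stdGauss μ ≤
      ∫ g : μ → ℝ, ((∑ j, g j ^ 2) * (√(Fintype.card μ))⁻¹ / 2 + √(Fintype.card μ) / 2)
        ∂stdGauss μ := by
    refine integral_mono (expGrowth_sqrt_sum_sq.integrable_of_continuous (by fun_prop))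
      (((hi.mul_const _).div_const 2).add (integrable_const _)) fun g => ?_
    have h0 : 0 ≤ ∑ j, g j ^ 2 := Finset.sum_nonneg fun _ _ => sq_nonneg _
    have h1 := Real.sq_sqrt h0
    set x := √(∑ j, g j ^ 2)
    set c := √(Fintype.card μ : ℝ)
    simp only
    rw [← h1]
    have : x ^ 2 * c⁻¹ / 2 + c / 2 - x = (x - c) ^ 2 / (2 * c) := by
      field_simp
      ring
    have : 0 ≤ (x - c) ^ 2 / (2 * c) := by positivity
    linarith
  refine this.trans_eq ?_
  rw [integral_add ((hi.mul_const _).div_const 2) (integrable_const _), integral_div,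
    integral_mul_const, integral_sum_sq]
  simp only [integral_const, probReal_univ, smul_eq_mul, one_mul]
  have := Real.mul_self_sqrt (Nat.cast_nonneg (α := ℝ) (Fintype.card μ))
  set c := √(Fintype.card μ : ℝ)
  rw [← this, mul_assoc, mul_inv_cancel₀ hc.ne']
  ring

/-- The lower bound `m / √(m + 1)` for the expected norm of a standard Gaussian vector. -/
theorem card_div_sqrt_le_integral_smoothNorm {δ : ℝ} (hδ : 0 < δ) :
    (Fintype.card μ : ℝ) / √(Fintype.card μ + 1) ≤ ∫ g : μ → ℝ, smoothNorm δ g ∂stdGauss μ := by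
  classical
  set m := (Fintype.card μ : ℝ) with hm
  have hm0 : 0 ≤ m := Nat.cast_nonneg _
  have hs : 0 < √(m + 1) := Real.sqrt_pos.2 (by linarith)
  have cN : Continuous (smoothNorm δ : (μ → ℝ) → ℝ) := continuous_smoothNorm hδ
  have gN : ExpGrowth (smoothNorm δ : (μ → ℝ) → ℝ) := expGrowth_smoothNorm hδ
  have iN := gN.integrable_of_continuous cN
  have gE : ∀ j, ExpGrowth fun g : μ → ℝ => g j := ExpGrowth.eval
  have cR : Continuous fun g : μ → ℝ => ∑ j, g j ^ 2 := by fun_prop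
  have gR : ExpGrowth fun g : μ → ℝ => ∑ j, g j ^ 2 := by
    simpa only [sq] using ExpGrowth.sum (s := Finset.univ) fun j => (gE j).mul (gE j)
  have gD : ∀ j, ExpGrowth fun g : μ → ℝ => g j / smoothNorm δ g := fun j =>
    .of_bounded 1 fun g => abs_div_smoothNorm_le hδ g j
  have cD : ∀ j, Continuous fun g : μ → ℝ => g j / smoothNorm δ g := fun j =>
    (continuous_apply j).div cN fun g => (smoothNorm_pos hδ g).ne'
  have stein : ∀ j, ∫ g : μ → ℝ, g j * (g j * smoothNorm δ g) ∂stdGauss μ =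
      ∫ g : μ → ℝ, (smoothNorm δ g + g j * (g j / smoothNorm δ g)) ∂stdGauss μ := by
    intro j
    refine integral_eval_mul_stdGauss j (fun z => ?_)
      (((gE j).mul gN).integrable_of_continuous ((continuous_apply j).mul cN))
      ((gN.add ((gE j).mul (gD j))).integrable_of_continuous
        (cN.add ((continuous_apply j).mul (cD j))))
      (((gE j).mul ((gE j).mul gN)).integrable_of_continuous
        ((continuous_apply j).mul ((continuous_apply j).mul cN)))
    have h1 := hasDerivAt_smoothNorm hδ z (Pi.single j 1)
    have h2 : HasDerivAt (fun s : ℝ => (z + s • (Pi.single j 1 : μ → ℝ)) j) 1 0 := by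
      simpa using (hasDerivAt_id (0 : ℝ)).const_add (z j)
    refine (h2.fun_mul h1).congr_deriv ?_
    simp [Pi.single_apply]
  -- Writing `N` for the smoothed norm, the Stein identities add up to `E ‖g‖² N = m E N + E (‖g‖² /
  -- N)`, and `‖g‖² / N ≤ N`.
  have third : ∫ g : μ → ℝ, (∑ j, g j ^ 2) * smoothNorm δ g ∂stdGauss μ ≤
      (m + 1) * ∫ g, smoothNorm δ g ∂stdGauss μ := by
    have e1 : ∀ g : μ → ℝ, (∑ j, g j ^ 2) * smoothNorm δ g =
        ∑ j, g j * (g j * smoothNorm δ g) := fun g => by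
      rw [Finset.sum_mul]; exact Finset.sum_congr rfl fun j _ => by ring
    simp only [e1]
    rw [integral_finsetSum _ fun j _ => ((gE j).mul ((gE j).mul gN)).integrable_of_continuous
        ((continuous_apply j).mul ((continuous_apply j).mul cN)), Finset.sum_congr rfl fun j _ =>
        stein j, ← integral_finsetSum _ fun j _ =>
        (gN.add ((gE j).mul (gD j))).integrable_of_continuous
        (cN.add ((continuous_apply j).mul (cD j))), ← integral_const_mul]
    refine integral_mono (integrable_finsetSum _ fun j _ =>
        (gN.add ((gE j).mul (gD j))).integrable_of_continuous
        (cN.add ((continuous_apply j).mul (cD j)))) (iN.const_mul _) fun g => ?_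
    have h0 := smoothNorm_pos hδ g
    have h1 : ∑ j, g j * (g j / smoothNorm δ g) ≤ smoothNorm δ g := by
      have e : ∑ j, g j * (g j / smoothNorm δ g) = (∑ j, g j ^ 2) / smoothNorm δ g := by
        rw [Finset.sum_div]; exact Finset.sum_congr rfl fun j _ => by ring
      rw [e, div_le_iff₀ h0, ← sq, sq_smoothNorm hδ]
      linarith
    simp only [Finset.sum_add_distrib, Finset.sum_const, Finset.card_univ, nsmul_eq_mul]
    rw [← hm]
    linarith
  have i3 : Integrable (fun g : μ → ℝ => (∑ j, g j ^ 2) * smoothNorm δ g) (stdGauss μ) :=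
    (gR.mul gN).integrable_of_continuous (cR.mul cN)
  -- Pointwise `x² ≤ x N`, and `x ≤ s / 2 + x² / (2s)` with `s = √(m + 1)`. This `s` balances the
  -- terms: by `third`, each has mean at most `s E N / 2`, so `m ≤ s E N`.
  have key : m ≤ ∫ g : μ → ℝ, (√(m + 1) / 2 * smoothNorm δ g +
      (2 * √(m + 1))⁻¹ * ((∑ j, g j ^ 2) * smoothNorm δ g)) ∂stdGauss μ := by
    rw [hm, ← integral_sum_sq]
    refine integral_mono (gR.integrable_of_continuous cR) ((iN.const_mul _).add (i3.const_mul _))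
      fun g => ?_
    rw [integral_sum_sq]
    have h0 : 0 ≤ ∑ j, g j ^ 2 := Finset.sum_nonneg fun _ _ => sq_nonneg _
    have h1 := Real.sq_sqrt h0
    have h2 := sqrt_le_smoothNorm hδ g
    set x := √(∑ j, g j ^ 2)
    have hx : 0 ≤ x := Real.sqrt_nonneg _
    simp only [← hm]
    rw [← h1]
    set s := √(m + 1)
    set N := smoothNorm δ g
    have e : s / 2 * N + (2 * s)⁻¹ * (x ^ 2 * N) = x * N + N * (s - x) ^ 2 / (2 * s) := by
      field_simp
      ring
    have h3 : 0 ≤ N * (s - x) ^ 2 / (2 * s) :=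
      div_nonneg (mul_nonneg (hx.trans h2) (sq_nonneg _)) (by linarith)
    rw [e]
    nlinarith
  rw [integral_add (iN.const_mul _) (i3.const_mul _), integral_const_mul, integral_const_mul] at key
  rw [div_le_iff₀ hs]
  refine key.trans ?_
  have h4 := mul_le_mul_of_nonneg_left third (inv_nonneg.2 (by linarith : 0 ≤ 2 * √(m + 1)))
  have h5 : (2 * √(m + 1))⁻¹ * ((m + 1) * ∫ g, smoothNorm δ g ∂stdGauss μ) =
      √(m + 1) / 2 * ∫ g, smoothNorm δ g ∂stdGauss μ := by
    have := Real.mul_self_sqrt (by linarith : 0 ≤ m + 1)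
    field_simp
    rw [sq, this]
  linarith

end Chi

/-! ### Escape through a mesh for finite families. -/

section Escape

variable {μ : Type*} [Fintype μ] [DecidableEq μ] {ι₁ ι₂ : Type*} [Fintype ι₁] [Fintype ι₂]
  [DecidableEq ι₁] [DecidableEq ι₂] {τ σ : Type*} [Fintype τ] [Nonempty τ] [Fintype σ] [Nonempty σ]

/-- Upper bound for the expected largest norm `‖H v_c‖` over finitely many unit vectors. -/
theorem integral_softMax_matrix_le {e : ℝ} (he : 0 < e) {v : σ → ι₂ → ℝ}
    (hv : ∀ c, ∑ i, v c i ^ 2 = 1) :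
    e * ∫ H : ι₁ × ι₂ → ℝ, logSumExp (fun c => e⁻¹ * smoothNorm (e ^ 2) fun j => ∑ i, H (j, i) * v c i)
      ∂stdGauss (ι₁ × ι₂) ≤
    √(Fintype.card ι₁) + √(Fintype.card ι₂) + e * (1 + Real.log (Fintype.card σ)) := by
  have hδ : 0 < e ^ 2 := by positivity
  have main := mul_le_mul_of_nonneg_left (integral_logSumExp_matrix_le (μ := ι₁) e⁻¹ hδ hv) he.le
  rw [mul_add, mul_inv_cancel_left₀ he.ne'] at main
  have h1 : ∫ g : ι₁ → ℝ, smoothNorm (e ^ 2) g ∂stdGauss ι₁ ≤ √(Fintype.card ι₁) + e := by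
    have hi : Integrable (fun g : ι₁ → ℝ => √(∑ j, g j ^ 2)) (stdGauss ι₁) :=
      expGrowth_sqrt_sum_sq.integrable_of_continuous (by fun_prop)
    have := integral_mono ((expGrowth_smoothNorm hδ).integrable_of_continuous
      (continuous_smoothNorm hδ)) (hi.add (integrable_const (√(e ^ 2))))
      (fun g => smoothNorm_le hδ g)
    refine this.trans ?_
    simp only [Pi.add_apply]
    rw [integral_add hi (integrable_const _), Real.sqrt_sq he.le]
    simp only [integral_const, probReal_univ, smul_eq_mul, one_mul]
    linarith [integral_sqrt_sum_sq_le (μ := ι₁)]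
  have h2 : ∫ h : ι₂ → ℝ, logSumExp (fun c => e⁻¹ * ∑ i, h i * v c i) ∂stdGauss ι₂ ≤
      e⁻¹ * √(Fintype.card ι₂) + Real.log (Fintype.card σ) := by
    have hi : Integrable (fun g : ι₂ → ℝ => √(∑ j, g j ^ 2)) (stdGauss ι₂) :=
      expGrowth_sqrt_sum_sq.integrable_of_continuous (by fun_prop)
    have h3 : Integrable (fun h : ι₂ → ℝ => logSumExp fun c => e⁻¹ * ∑ i, h i * v c i)
        (stdGauss ι₂) :=
      (ExpGrowth.logSumExp fun a => (ExpGrowth.const _).mul (.sum fun i =>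
        (ExpGrowth.eval i).mul (.const _))).integrable_of_continuous
        (continuous_logSumExp.comp (by fun_prop))
    have := integral_mono h3 ((hi.const_mul e⁻¹).add
      (integrable_const (Real.log (Fintype.card σ)))) fun h => logSumExp_le (M := e⁻¹ *
        √(∑ j, h j ^ 2)) fun c => by
        refine mul_le_mul_of_nonneg_left ?_ (inv_nonneg.2 he.le)
        have := Real.sum_mul_le_sqrt_mul_sqrt Finset.univ h (v c)
        rwa [hv, Real.sqrt_one, mul_one] at this
    refine this.trans ?_
    simp only [Pi.add_apply]
    rw [integral_add (hi.const_mul _) (integrable_const _), integral_const_mul]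
    simp only [integral_const, probReal_univ, smul_eq_mul, one_mul]
    have := mul_le_mul_of_nonneg_left (integral_sqrt_sum_sq_le (μ := ι₂)) (inv_nonneg.2 he.le)
    linarith
  have h3 := mul_le_mul_of_nonneg_left h2 he.le
  rw [mul_add, mul_inv_cancel_left₀ he.ne'] at h3
  linarith

/-- **Escape through a mesh** for finitely many unit matrices `t_a`: if `⟨H, t_a⟩` is controlled by
`K` times the largest norm `‖H v_c‖` of finitely many unit vectors, then all the norms `‖G t_a‖` of
a standard Gaussian operator `G` are at least `m / √(m + 1) - K (√n₁ + √n₂) - x`, except with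
probability `exp (-x² / 2)`. -/
theorem stdGauss_exists_norm_lt_le {t : τ → ι₁ × ι₂ → ℝ} (ht : ∀ a, ∑ p, t a p ^ 2 = 1)
    {v : σ → ι₂ → ℝ} (hv : ∀ c, ∑ i, v c i ^ 2 = 1) {K : ℝ} (hK : 0 ≤ K)
    (hw : ∀ (H : ι₁ × ι₂ → ℝ) (B : ℝ), (∀ c, √(∑ j, (∑ i, H (j, i) * v c i) ^ 2) ≤ B) →
      ∀ a, -∑ p, H p * t a p ≤ K * B) {x y : ℝ} (hx : 0 ≤ x)
    (hy : y ≤ Fintype.card μ / √(Fintype.card μ + 1) -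
      K * (√(Fintype.card ι₁) + √(Fintype.card ι₂)) - x) :
    (stdGauss (μ × ι₁ × ι₂)).real
      {G | ∃ a, √(∑ j, (∑ p, G (j, p) * t a p) ^ 2) < y} ≤ Real.exp (-x ^ 2 / 2) := by
  -- Collects the errors of order `e`: `1` from the smoothed norm in the event, the multiple of `K`
  -- from the soft maximum of the `‖H v_c‖`, and the last logarithm from the soft minimum over `τ`.
  set C := 1 + K * (1 + Real.log (Fintype.card σ)) + Real.log (Fintype.card τ) with hC
  have key : ∀ e : ℝ, 0 < e → (stdGauss (μ × ι₁ × ι₂)).real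
      {G | ∃ a, √(∑ j, (∑ p, G (j, p) * t a p) ^ 2) < y} ≤
        Real.exp (-x ^ 2 / 2 + x * (e * C)) := by
    intro e he
    have hδ : 0 < e ^ 2 := by positivity
    -- With `b = -1 / e`, the expression `b⁻¹ log ∑ exp (b ·)` is a soft minimum, lying below each
    -- of the smoothed norms.
    have hb : -e⁻¹ ≠ 0 := neg_ne_zero.2 (inv_ne_zero he.ne')
    obtain ⟨int, conc⟩ := integral_exp_logSumExp_matrix_le (μ := μ) hb hδ ht (-x)
    set f : (μ × ι₁ × ι₂ → ℝ) → ℝ := fun G => (-e⁻¹)⁻¹ * logSumExp fun a => -e⁻¹ *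
      smoothNorm (e ^ 2) fun j => ∑ p, G (j, p) * t a p with hf
    set I := ∫ G : μ × ι₁ × ι₂ → ℝ, logSumExp (fun a => -e⁻¹ *
      smoothNorm (e ^ 2) fun j => ∑ p, G (j, p) * t a p) ∂stdGauss (μ × ι₁ × ι₂) with hI
    have sub : {G : μ × ι₁ × ι₂ → ℝ | ∃ a, √(∑ j, (∑ p, G (j, p) * t a p) ^ 2) < y} ⊆
        {G | f G ≤ y + e} := by
      rintro G ⟨a, ha⟩
      have h1 := le_logSumExp (fun a => -e⁻¹ *
        smoothNorm (e ^ 2) fun j => ∑ p, G (j, p) * t a p) a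
      have h2 := smoothNorm_le hδ fun j => ∑ p, G (j, p) * t a p
      rw [Real.sqrt_sq he.le] at h2
      have h3 : f G ≤ smoothNorm (e ^ 2) fun j => ∑ p, G (j, p) * t a p := by
        have := mul_le_mul_of_nonneg_left h1 he.le
        rw [← mul_assoc, mul_neg, mul_inv_cancel₀ he.ne'] at this
        simp only [hf, inv_neg, inv_inv]
        linarith
      simp only [Set.mem_ofPred_eq]
      linarith
    have gordon : I ≤ -e⁻¹ * (Fintype.card μ / √(Fintype.card μ + 1) -
        K * (√(Fintype.card ι₁) + √(Fintype.card ι₂)) - e * (C - 1)) := by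
      have h1 := integral_logSumExp_matrix_le (μ := μ) (-e⁻¹) hδ ht
      have h2 := card_div_sqrt_le_integral_smoothNorm (μ := μ) hδ
      have h3 := integral_softMax_matrix_le (ι₁ := ι₁) he hv
      set S : (ι₁ × ι₂ → ℝ) → ℝ := fun H => logSumExp fun c => e⁻¹ *
        smoothNorm (e ^ 2) fun j => ∑ i, H (j, i) * v c i with hS
      have iS : Integrable S (stdGauss (ι₁ × ι₂)) := by
        have c1 : ∀ c, Continuous fun H : ι₁ × ι₂ → ℝ =>
          smoothNorm (e ^ 2) fun j => ∑ i, H (j, i) * v c i := fun c =>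
          (continuous_smoothNorm hδ).comp (by fun_prop)
        have g1 : ∀ c, ExpGrowth fun H : ι₁ × ι₂ → ℝ =>
            smoothNorm (e ^ 2) fun j => ∑ i, H (j, i) * v c i := fun c => by
          have := (expGrowth_smoothNorm (μ := ι₁) hδ).comp (K := ‖matrixField ι₁ v‖)
            (g := fun H : ι₁ × ι₂ → ℝ => (matrixField ι₁ v H).1 c) fun H =>
              (norm_le_pi_norm _ c).trans ((norm_fst_le _).trans
                ((matrixField ι₁ v).le_opNorm H))
          simpa only [matrixField_apply] using this
        exact (ExpGrowth.logSumExp fun c => (ExpGrowth.const _).mul (g1 c)).integrable_of_continuous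
          (continuous_logSumExp.comp (continuous_pi fun c => continuous_const.mul (c1 c)))
      have i1 : Integrable (fun H : ι₁ × ι₂ → ℝ => logSumExp fun a => -e⁻¹ * ∑ p, H p * t a p)
          (stdGauss (ι₁ × ι₂)) :=
        (ExpGrowth.logSumExp fun a => (ExpGrowth.const _).mul (.sum fun i =>
          (ExpGrowth.eval i).mul (.const _))).integrable_of_continuous
          (continuous_logSumExp.comp (by fun_prop))
      have h4 : ∫ H : ι₁ × ι₂ → ℝ, logSumExp (fun a => -e⁻¹ * ∑ p, H p * t a p)
          ∂stdGauss (ι₁ × ι₂) ≤ K * ∫ H, S H ∂stdGauss (ι₁ × ι₂) +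
          Real.log (Fintype.card τ) := by
        have := integral_mono i1 ((iS.const_mul K).add
          (integrable_const (Real.log (Fintype.card τ)))) fun H => logSumExp_le (M := K * S H)
            fun a => by
              -- The scaled soft maximum `e * S H` dominates every `‖H v_c‖`, so it is admissible as
              -- `B`.
              have h5 := hw H (e * S H) (fun c => by
                refine (sqrt_le_smoothNorm hδ _).trans ?_
                have := mul_le_mul_of_nonneg_left (le_logSumExp (fun c => e⁻¹ *
                  smoothNorm (e ^ 2) fun j => ∑ i, H (j, i) * v c i) c) he.le
                rwa [mul_inv_cancel_left₀ he.ne'] at this) a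
              have h6 := mul_le_mul_of_nonneg_left h5 (inv_nonneg.2 he.le)
              have h7 : e⁻¹ * (K * (e * S H)) = K * S H := by field_simp
              linarith
        refine this.trans_eq ?_
        simp only [Pi.add_apply]
        rw [integral_add (iS.const_mul _) (integrable_const _), integral_const_mul]
        simp
      have h5 := mul_le_mul_of_nonneg_left h3 hK
      have h6 : K * ∫ H, S H ∂stdGauss (ι₁ × ι₂) = e⁻¹ * (K * (e * ∫ H, S H ∂stdGauss (ι₁ × ι₂))) := by
        field_simp
      have h7 := mul_le_mul_of_nonneg_left h5 (inv_nonneg.2 he.le)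
      have h8 := mul_le_mul_of_nonneg_left h2 (inv_nonneg.2 he.le)
      have h9 : -e⁻¹ * (Fintype.card μ / √(Fintype.card μ + 1) -
          K * (√(Fintype.card ι₁) + √(Fintype.card ι₂)) - e * (C - 1)) =
          -(e⁻¹ * (Fintype.card μ / √(Fintype.card μ + 1))) +
          e⁻¹ * (K * (√(Fintype.card ι₁) + √(Fintype.card ι₂) +
            e * (1 + Real.log (Fintype.card σ)))) + Real.log (Fintype.card τ) := by
        rw [hC]
        field_simp
        ring
      rw [h9]
      linarith
    -- Chernoff's bound at `-x` has exponent `x (y + e) + x e I + x² / 2`. Since `e I ≤ -(y + x) + e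
    -- (C - 1)`, it is at most `-x² / 2 + x e C`.
    refine (measureReal_mono sub).trans ((measure_le_le_exp_mul_mgf (y + e)
      (neg_nonpos.2 hx) int).trans ?_)
    have conc' : mgf f (stdGauss (μ × ι₁ × ι₂)) (-x) ≤
        Real.exp (-x * ((-e⁻¹)⁻¹ * I) + (-x) ^ 2 / 2) := conc
    refine (mul_le_mul_of_nonneg_left conc' (Real.exp_nonneg _)).trans ?_
    rw [← Real.exp_add]
    refine Real.exp_le_exp.2 ?_
    have h1 := mul_le_mul_of_nonneg_left gordon he.le
    rw [← mul_assoc, mul_neg, mul_inv_cancel₀ he.ne'] at h1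
    have h2 : (-e⁻¹)⁻¹ * I = -(e * I) := by rw [inv_neg, inv_inv]; ring
    rw [h2]
    nlinarith
  have lim : Filter.Tendsto (fun e : ℝ => Real.exp (-x ^ 2 / 2 + x * (e * C)))
      (nhdsWithin 0 (Set.Ioi 0)) (nhds (Real.exp (-x ^ 2 / 2 + x * (0 * C)))) := by
    refine Filter.Tendsto.mono_left (Continuous.tendsto ?_ 0) nhdsWithin_le_nhds
    fun_prop
  have := ge_of_tendsto lim (by filter_upwards [self_mem_nhdsWithin] with e he using key e he)
  simpa using this

end Escape

end

/-! ### Frobenius inner product and contractions. -/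

section

open Matrix

section Frobenius

variable {k l p : Type*} [Fintype k] [Fintype l] [Fintype p]

/-- The Frobenius inner product. -/
def frobInner (A B : Matrix k l ℝ) : ℝ := (Aᵀ * B).trace

theorem frobInner_eq_sum (A B : Matrix k l ℝ) :
    frobInner A B = ∑ q : k × l, A q.1 q.2 * B q.1 q.2 := by
  simp only [frobInner, Matrix.trace, diag_apply, mul_apply, transpose_apply]
  rw [Fintype.sum_prod_type_right]

theorem frobInner_add_right (A B C : Matrix k l ℝ) :
    frobInner A (B + C) = frobInner A B + frobInner A C := by
  simp [frobInner, Matrix.mul_add]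

theorem frobInner_sub_right (A B C : Matrix k l ℝ) :
    frobInner A (B - C) = frobInner A B - frobInner A C := by
  simp [frobInner, Matrix.mul_sub]

theorem frobInner_sub_left (A B C : Matrix k l ℝ) :
    frobInner (A - B) C = frobInner A C - frobInner B C := by
  simp [frobInner, Matrix.sub_mul]

theorem frobInner_mul_left_right (A : Matrix k l ℝ) (P : Matrix k p ℝ) (B : Matrix p l ℝ) :
    frobInner A (P * B) = frobInner (Pᵀ * A) B := by
  simp [frobInner, Matrix.mul_assoc]

theorem frobInner_mul_right_right (A : Matrix k l ℝ) (B : Matrix k p ℝ) (Q : Matrix p l ℝ) :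
    frobInner A (B * Q) = frobInner (A * Qᵀ) B := by
  rw [frobInner, frobInner, transpose_mul, transpose_transpose, ← Matrix.mul_assoc,
    Matrix.trace_mul_comm, Matrix.mul_assoc]

theorem frobInner_self_nonneg (A : Matrix k l ℝ) : 0 ≤ frobInner A A := by
  rw [frobInner_eq_sum]
  exact Finset.sum_nonneg fun q _ => mul_self_nonneg _

theorem frobInner_transpose_self (A : Matrix k l ℝ) : frobInner Aᵀ Aᵀ = frobInner A A := by
  rw [frobInner, frobInner, transpose_transpose, Matrix.trace_mul_comm]

theorem frobInner_le (A B : Matrix k l ℝ) :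
    frobInner A B ≤ √(frobInner A A) * √(frobInner B B) := by
  simp only [frobInner_eq_sum, ← sq]
  exact Real.sum_mul_le_sqrt_mul_sqrt _ _ _

theorem frobInner_self_eq_sum_col (A : Matrix k l ℝ) :
    frobInner A A = ∑ j, A.col j ⬝ᵥ A.col j := by
  simp [frobInner, Matrix.trace, mul_apply, dotProduct]

/-- `W` is a contraction for the Euclidean norms. -/
def IsContraction (W : Matrix k l ℝ) : Prop := ∀ x, W *ᵥ x ⬝ᵥ W *ᵥ x ≤ x ⬝ᵥ x

theorem mulVec_dotProduct_mulVec (A : Matrix k l ℝ) (B : Matrix k p ℝ) (x : l → ℝ) (y : p → ℝ) :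
    A *ᵥ x ⬝ᵥ B *ᵥ y = x ⬝ᵥ (Aᵀ * B) *ᵥ y := by
  rw [← Matrix.mulVec_mulVec, dotProduct_mulVec, dotProduct_mulVec, vecMul_transpose,
    dotProduct_mulVec]

theorem dotProduct_self_nonneg' (x : l → ℝ) : 0 ≤ x ⬝ᵥ x :=
  Finset.sum_nonneg fun _ _ => mul_self_nonneg _

theorem IsContraction.mul {A : Matrix k l ℝ} {B : Matrix l p ℝ} (hA : IsContraction A)
    (hB : IsContraction B) : IsContraction (A * B) := fun x => by
  rw [← Matrix.mulVec_mulVec]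
  exact (hA _).trans (hB x)

theorem IsContraction.of_transpose_mul_self [DecidableEq l] {U : Matrix k l ℝ} (h : Uᵀ * U = 1) :
    IsContraction U := fun x => by
  rw [mulVec_dotProduct_mulVec, h, one_mulVec]

/-- `U Uᵀ` is an orthogonal projection, so `‖Uᵀ x‖² = ‖x‖² - ‖(1 - U Uᵀ) x‖²`. -/
theorem IsContraction.transpose_of_transpose_mul_self [DecidableEq k] [DecidableEq l]
    {U : Matrix k l ℝ} (h : Uᵀ * U = 1) : IsContraction Uᵀ := fun x => by
  have h0 := dotProduct_self_nonneg' ((1 - U * Uᵀ) *ᵥ x)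
  have e : (1 - U * Uᵀ)ᵀ * (1 - U * Uᵀ) = 1 - U * Uᵀ := by
    have : U * Uᵀ * (U * Uᵀ) = U * Uᵀ := by
      rw [Matrix.mul_assoc, ← Matrix.mul_assoc Uᵀ, h, Matrix.one_mul]
    simp [Matrix.mul_sub, Matrix.sub_mul, this]
  rw [mulVec_dotProduct_mulVec, e, sub_mulVec, one_mulVec, dotProduct_sub] at h0
  rw [mulVec_dotProduct_mulVec, transpose_transpose]
  linarith

/-- Pythagoras for a symmetric idempotent matrix. -/
theorem compl_mulVec_dotProduct_self [DecidableEq l] {Q : Matrix l l ℝ} (hs : Qᵀ = Q)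
    (hi : Q * Q = Q) (x : l → ℝ) :
    (1 - Q) *ᵥ x ⬝ᵥ (1 - Q) *ᵥ x = x ⬝ᵥ x - x ⬝ᵥ Q *ᵥ x := by
  have e : (1 - Q)ᵀ * (1 - Q) = 1 - Q := by
    simp [Matrix.mul_sub, Matrix.sub_mul, hs, hi]
  rw [mulVec_dotProduct_mulVec, e, sub_mulVec, one_mulVec, dotProduct_sub]

theorem IsContraction.frobInner_mul_le {A : Matrix k l ℝ} (hA : IsContraction A)
    (B : Matrix l p ℝ) : frobInner (A * B) (A * B) ≤ frobInner B B := by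
  rw [frobInner_self_eq_sum_col, frobInner_self_eq_sum_col]
  exact Finset.sum_le_sum fun j _ => hA (B.col j)

theorem IsContraction.dotProduct_mulVec_le {W : Matrix k l ℝ} (hW : IsContraction W)
    {x : k → ℝ} {y : l → ℝ} (hx : x ⬝ᵥ x ≤ 1) (hy : y ⬝ᵥ y ≤ 1) : x ⬝ᵥ W *ᵥ y ≤ 1 := by
  have h := (hW y).trans hy
  refine sum_mul_le_one ?_ ?_ <;> simpa only [sq]

end Frobenius

/-! ### Nuclear norm duality and the cone containing the error. -/

section SVD

variable {n₁ n₂ : ℕ}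

/-- The matrix with the given columns. -/
def colMatrix {n : ℕ} {κ : Type*} (u : κ → EuclideanSpace ℝ (Fin n)) : Matrix (Fin n) κ ℝ :=
  Matrix.of fun i j => u j i

theorem colMatrix_transpose_mul_self {n : ℕ} {κ : Type*} [DecidableEq κ]
    {u : κ → EuclideanSpace ℝ (Fin n)} (hu : Orthonormal ℝ u) :
    (colMatrix u)ᵀ * colMatrix u = 1 := by
  ext i j
  have := orthonormal_iff_ite.1 hu i j
  rw [PiLp.inner_apply] at this
  simp only [mul_apply, transpose_apply, colMatrix, of_apply, one_apply, ← this]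
  simp [mul_comm]

theorem sum_smul_vecMulVec {κ : Type*} [Fintype κ] [DecidableEq κ]
    (u : κ → EuclideanSpace ℝ (Fin n₁)) (v : κ → EuclideanSpace ℝ (Fin n₂)) (c : κ → ℝ) :
    ∑ j, c j • vecMulVec (u j).ofLp (v j).ofLp =
      colMatrix u * diagonal c * (colMatrix v)ᵀ := by
  ext i k
  rw [Matrix.mul_apply]
  simp only [Matrix.sum_apply, Matrix.smul_apply, vecMulVec_apply, transpose_apply, colMatrix,
    of_apply, mul_diagonal, smul_eq_mul]
  exact Finset.sum_congr rfl fun j _ => by ring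

/-- The singular values of `X` on the index type of a singular value decomposition. -/
noncomputable def svals (X : Matrix (Fin n₁) (Fin n₂) ℝ) (j : Fin (min n₁ n₂)) : ℝ :=
  singularValue X j

theorem svals_nonneg (X : Matrix (Fin n₁) (Fin n₂) ℝ) (j : Fin (min n₁ n₂)) : 0 ≤ svals X j :=
  LinearMap.singularValues_nonneg _ _

theorem IsSVD.eq_mul {X : Matrix (Fin n₁) (Fin n₂) ℝ}
    {u : Fin (min n₁ n₂) → EuclideanSpace ℝ (Fin n₁)}
    {v : Fin (min n₁ n₂) → EuclideanSpace ℝ (Fin n₂)} (h : IsSVD X u v) :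
    X = colMatrix u * diagonal (svals X) * (colMatrix v)ᵀ := by
  rw [← sum_smul_vecMulVec]
  exact h.eq_sum

theorem schattenNorm_one (X : Matrix (Fin n₁) (Fin n₂) ℝ) :
    schattenNorm 1 X = ∑ j, svals X j := by
  simp only [schattenNorm, Real.rpow_one, div_one]
  rw [Finset.sum_range]
  rfl

theorem schattenNorm_one_nonneg (X : Matrix (Fin n₁) (Fin n₂) ℝ) : 0 ≤ schattenNorm 1 X := by
  rw [schattenNorm_one]
  exact Finset.sum_nonneg fun j _ => svals_nonneg X j

theorem frobInner_svd {κ : Type*} [Fintype κ] [DecidableEq κ] {U : Matrix (Fin n₁) κ ℝ}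
    {V : Matrix (Fin n₂) κ ℝ} (hU : Uᵀ * U = 1) (hV : Vᵀ * V = 1) (c d : κ → ℝ) :
    frobInner (U * diagonal c * Vᵀ) (U * diagonal d * Vᵀ) = ∑ j, c j * d j := by
  have e : (U * diagonal c * Vᵀ)ᵀ * (U * diagonal d * Vᵀ) =
      V * (diagonal c * diagonal d * Vᵀ) := by
    calc _ = V * diagonal c * (Uᵀ * U) * diagonal d * Vᵀ := by
          simp only [transpose_mul, transpose_transpose, diagonal_transpose, Matrix.mul_assoc]
      _ = _ := by rw [hU]; simp only [Matrix.mul_one, Matrix.mul_assoc]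
  rw [frobInner, e, trace_mul_comm, Matrix.mul_assoc, hV, Matrix.mul_one, diagonal_mul_diagonal,
    trace_diagonal]

theorem schattenNorm_two (X : Matrix (Fin n₁) (Fin n₂) ℝ) :
    schattenNorm 2 X = √(frobInner X X) := by
  obtain ⟨u, v, h⟩ := exists_isSVD X
  have e : frobInner X X = ∑ j, svals X j * svals X j := by
    conv_lhs => rw [h.eq_mul]
    exact frobInner_svd (colMatrix_transpose_mul_self h.orthonormal_left)
      (colMatrix_transpose_mul_self h.orthonormal_right) _ _
  rw [e, schattenNorm, Real.sqrt_eq_rpow, Finset.sum_range]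
  congr 1
  exact Finset.sum_congr rfl fun j _ => by
    rw [Real.rpow_two, sq]; rfl

theorem frobInner_eq_sum_svals {X : Matrix (Fin n₁) (Fin n₂) ℝ}
    {u : Fin (min n₁ n₂) → EuclideanSpace ℝ (Fin n₁)}
    {v : Fin (min n₁ n₂) → EuclideanSpace ℝ (Fin n₂)} (h : IsSVD X u v)
    (W : Matrix (Fin n₁) (Fin n₂) ℝ) :
    frobInner W X = ∑ j, svals X j * ((u j).ofLp ⬝ᵥ W *ᵥ (v j).ofLp) := by
  conv_lhs => rw [h.eq_mul]
  rw [frobInner_mul_right_right, frobInner_mul_left_right, transpose_transpose, frobInner,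
    transpose_mul, transpose_mul, transpose_transpose]
  simp only [Matrix.trace, diag_apply, mul_diagonal]
  refine Finset.sum_congr rfl fun j _ => ?_
  rw [mul_comm]
  congr 1
  simp only [mul_apply, transpose_apply, colMatrix, of_apply, dotProduct, mulVec,
    Finset.sum_mul, Finset.mul_sum]
  exact Finset.sum_congr rfl fun _ _ => Finset.sum_congr rfl fun _ _ => by ring

theorem dotProduct_self_of_orthonormal {n : ℕ} {κ : Type*} {w : κ → EuclideanSpace ℝ (Fin n)}
    (hw : Orthonormal ℝ w) (j : κ) : (w j).ofLp ⬝ᵥ (w j).ofLp = 1 := by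
  classical
  have := congrFun (congrFun (colMatrix_transpose_mul_self hw) j) j
  rwa [one_apply_eq] at this

/-- The nuclear norm is dual to the operator norm. -/
theorem frobInner_le_schattenNorm_one {W : Matrix (Fin n₁) (Fin n₂) ℝ} (hW : IsContraction W)
    (X : Matrix (Fin n₁) (Fin n₂) ℝ) : frobInner W X ≤ schattenNorm 1 X := by
  obtain ⟨u, v, h⟩ := exists_isSVD X
  rw [frobInner_eq_sum_svals h, schattenNorm_one]
  exact Finset.sum_le_sum fun j _ => mul_le_of_le_one_right (svals_nonneg X j)
    (hW.dotProduct_mulVec_le (dotProduct_self_of_orthonormal h.orthonormal_left j).le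
      (dotProduct_self_of_orthonormal h.orthonormal_right j).le)

/-- Only the norms of `H` at the right singular vectors of `X` are needed to bound `⟨H, X⟩`. -/
theorem neg_frobInner_le_schattenNorm_one_mul {X : Matrix (Fin n₁) (Fin n₂) ℝ}
    {u : Fin (min n₁ n₂) → EuclideanSpace ℝ (Fin n₁)}
    {v : Fin (min n₁ n₂) → EuclideanSpace ℝ (Fin n₂)} (h : IsSVD X u v)
    (H : Matrix (Fin n₁) (Fin n₂) ℝ) {B : ℝ}
    (hB : ∀ j, √(∑ i, (H *ᵥ (v j).ofLp) i ^ 2) ≤ B) :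
    -frobInner H X ≤ schattenNorm 1 X * B := by
  rw [frobInner_eq_sum_svals h, schattenNorm_one, ← Finset.sum_neg_distrib, Finset.sum_mul]
  refine Finset.sum_le_sum fun j _ => ?_
  rw [← mul_neg]
  refine mul_le_mul_of_nonneg_left ?_ (svals_nonneg X j)
  have h1 := Real.sum_mul_le_sqrt_mul_sqrt Finset.univ (fun i => -(u j).ofLp i)
    (H *ᵥ (v j).ofLp)
  have h2 : ∑ i, (-(u j).ofLp i) ^ 2 = 1 := by
    rw [← dotProduct_self_of_orthonormal h.orthonormal_left j]
    exact Finset.sum_congr rfl fun i _ => by ring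
  rw [h2, Real.sqrt_one, one_mul] at h1
  refine le_trans (le_of_eq ?_) (h1.trans (hB j))
  rw [dotProduct, ← Finset.sum_neg_distrib]
  exact Finset.sum_congr rfl fun i _ => by ring

/-- The factor `U Vᵀ` of a singular value decomposition attains the duality. Contractivity of the
transpose is recorded to bound products with a projection on the left. -/
theorem exists_isContraction_frobInner_eq (X : Matrix (Fin n₁) (Fin n₂) ℝ) :
    ∃ W : Matrix (Fin n₁) (Fin n₂) ℝ, IsContraction W ∧ IsContraction Wᵀ ∧
      frobInner W X = schattenNorm 1 X := by
  obtain ⟨u, v, h⟩ := exists_isSVD X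
  have hU := colMatrix_transpose_mul_self h.orthonormal_left
  have hV := colMatrix_transpose_mul_self h.orthonormal_right
  refine ⟨colMatrix u * (colMatrix v)ᵀ, (IsContraction.of_transpose_mul_self hU).mul
    (.transpose_of_transpose_mul_self hV), ?_, ?_⟩
  · rw [transpose_mul, transpose_transpose]
    exact (IsContraction.of_transpose_mul_self hV).mul (.transpose_of_transpose_mul_self hU)
  · conv_lhs => rw [h.eq_mul]
    have := frobInner_svd hU hV (fun _ => 1) (svals X)
    rw [diagonal_one, Matrix.mul_one] at this
    rw [this, schattenNorm_one]
    simp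

theorem schattenNorm_one_smul_le {c : ℝ} (hc : 0 ≤ c) (X : Matrix (Fin n₁) (Fin n₂) ℝ) :
    schattenNorm 1 (c • X) ≤ c * schattenNorm 1 X := by
  obtain ⟨W, hW, -, h⟩ := exists_isContraction_frobInner_eq (c • X)
  have : frobInner W (c • X) = c * frobInner W X := by simp [frobInner]
  rw [← h, this]
  exact mul_le_mul_of_nonneg_left (frobInner_le_schattenNorm_one hW X) hc

/-- If passing from `X` to `X - M` does not increase the nuclear norm, then `M` is nearly of low
rank. Here `P`, `Q` are the projections onto the leading singular subspaces of `X` and `T` is the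
leading part of its polar factor. -/
theorem schattenNorm_one_le_of_projections {X Xc M T : Matrix (Fin n₁) (Fin n₂) ℝ}
    {P : Matrix (Fin n₁) (Fin n₁) ℝ} {Q : Matrix (Fin n₂) (Fin n₂) ℝ} {r : ℝ}
    (hPs : Pᵀ = P) (hPi : P * P = P) (hQs : Qᵀ = Q) (hQi : Q * Q = Q) (hPT : P * T = T)
    (hTT : Tᵀ * T = Q) (hPr : P.trace ≤ r) (hQr : Q.trace ≤ r)
    (hPX : P * (X - Xc) = X - Xc) (hPXc : P * Xc = 0)
    (hX : schattenNorm 1 X ≤ frobInner T (X - Xc) + schattenNorm 1 Xc)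
    (hM : schattenNorm 1 (X - M) ≤ schattenNorm 1 X) :
    schattenNorm 1 M ≤ √5 * √r * schattenNorm 2 M + 2 * schattenNorm 1 Xc := by
  obtain ⟨W, hW, hWt, hWM⟩ := exists_isContraction_frobInner_eq M
  have hcP : (1 - P) * P = 0 := by rw [Matrix.sub_mul, Matrix.one_mul, hPi, sub_self]
  have hcP' : P * (1 - P) = 0 := by rw [Matrix.mul_sub, Matrix.mul_one, hPi, sub_self]
  have hPc : (1 - P)ᵀ = 1 - P := by rw [transpose_sub, transpose_one, hPs]
  have hQc : (1 - Q)ᵀ = 1 - Q := by rw [transpose_sub, transpose_one, hQs]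
  have nnP : ∀ x, 0 ≤ x ⬝ᵥ P *ᵥ x := fun x => by
    have := dotProduct_self_nonneg' (P *ᵥ x)
    rwa [mulVec_dotProduct_mulVec, hPs, hPi] at this
  have nnQ : ∀ x, 0 ≤ x ⬝ᵥ Q *ᵥ x := fun x => by
    have := dotProduct_self_nonneg' (Q *ᵥ x)
    rwa [mulVec_dotProduct_mulVec, hQs, hQi] at this
  have cP : IsContraction (1 - P) := fun x => by
    rw [compl_mulVec_dotProduct_self hPs hPi]
    linarith [nnP x]
  have cQ : IsContraction Q := fun x => by
    have h0 := dotProduct_self_nonneg' ((1 - Q) *ᵥ x)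
    rw [compl_mulVec_dotProduct_self hQs hQi] at h0
    rw [mulVec_dotProduct_mulVec, hQs, hQi]
    linarith
  -- The part of the dual certificate of `M` off the leading singular subspaces. `T - W'` is still a
  -- contraction: the ranges of `T` and `W'` are orthogonal, and `‖T x‖² = ⟨x, Q x⟩` while `‖W' x‖²
  -- ≤ ‖(1 - Q) x‖²`.
  set W' := (1 - P) * W * (1 - Q) with hW'
  have cW : IsContraction (T - W') := fun x => by
    have h1 : T *ᵥ x ⬝ᵥ T *ᵥ x = x ⬝ᵥ Q *ᵥ x := by rw [mulVec_dotProduct_mulVec, hTT]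
    have hz : Tᵀ * W' = 0 := by
      rw [hW', ← hPT, transpose_mul, hPs, Matrix.mul_assoc, ← Matrix.mul_assoc P,
        ← Matrix.mul_assoc P, hcP', Matrix.zero_mul, Matrix.zero_mul, Matrix.mul_zero]
    have h2 : T *ᵥ x ⬝ᵥ W' *ᵥ x = 0 := by
      rw [mulVec_dotProduct_mulVec, hz, zero_mulVec, dotProduct_zero]
    have h3 : W' *ᵥ x ⬝ᵥ W' *ᵥ x ≤ x ⬝ᵥ x - x ⬝ᵥ Q *ᵥ x := by
      rw [← compl_mulVec_dotProduct_self hQs hQi, hW', ← Matrix.mulVec_mulVec]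
      exact (cP.mul hW) _
    rw [sub_mulVec, sub_dotProduct, dotProduct_sub, dotProduct_sub, h1, h2,
      dotProduct_comm (W' *ᵥ x) (T *ᵥ x), h2]
    linarith
  -- Testing `X - M` against `T - W'` yields, once `⟨T, X⟩` and `⟨W', X⟩` are evaluated or bounded
  -- below, `⟨W', M⟩ ≤ ⟨T, M⟩ + 2 ‖X_c‖₁`.
  have dual := (frobInner_le_schattenNorm_one cW (X - M)).trans hM
  set a := √(frobInner (P * M) (P * M)) with ha
  set c := √(frobInner ((1 - P) * M * Q) ((1 - P) * M * Q)) with hc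
  have fP : frobInner P P = P.trace := by rw [frobInner, hPs, hPi]
  have fQ : frobInner Q Q = Q.trace := by rw [frobInner, hQs, hQi]
  have b1 : frobInner W (P * M) ≤ √r * a := by
    have e : frobInner W (P * M) = frobInner (P * W) (P * M) := by
      rw [frobInner_mul_left_right (P * W), hPs, ← Matrix.mul_assoc, hPi, frobInner_mul_left_right,
        hPs]
    rw [e]
    refine (frobInner_le _ _).trans (mul_le_mul_of_nonneg_right (Real.sqrt_le_sqrt ?_)
      (Real.sqrt_nonneg _))
    rw [← frobInner_transpose_self, transpose_mul, hPs]
    exact (hWt.frobInner_mul_le P).trans (fP.trans_le hPr)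
  have b2 : frobInner W ((1 - P) * M * Q) ≤ √r * c := by
    have e : frobInner W ((1 - P) * M * Q) = frobInner (W * Q) ((1 - P) * M * Q) := by
      rw [frobInner_mul_right_right (W * Q), hQs, Matrix.mul_assoc W, hQi,
        frobInner_mul_right_right, hQs]
    rw [e]
    refine (frobInner_le _ _).trans (mul_le_mul_of_nonneg_right (Real.sqrt_le_sqrt ?_)
      (Real.sqrt_nonneg _))
    exact (hW.frobInner_mul_le Q).trans (fQ.trans_le hQr)
  have b3 : frobInner W ((1 - P) * M * (1 - Q)) = frobInner W' M := by
    rw [frobInner_mul_right_right, frobInner_mul_left_right, hPc, hQc, hW', Matrix.mul_assoc]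
  -- The first two blocks cost `√r a` and `√r c`. The last is `⟨W', M⟩`, at most `⟨T, M⟩ + 2 ‖X_c‖₁
  -- ≤ √r a + 2 ‖X_c‖₁`; hence the combination `2a + c`.
  have split : frobInner W M = frobInner W (P * M) + frobInner W ((1 - P) * M * Q) +
      frobInner W ((1 - P) * M * (1 - Q)) := by
    rw [← frobInner_add_right, ← frobInner_add_right]
    congr 1
    simp only [Matrix.mul_sub, Matrix.sub_mul, Matrix.mul_one, Matrix.one_mul]
    abel
  have b4 : frobInner T M ≤ √r * a := by
    have e : frobInner T M = frobInner T (P * M) := by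
      rw [frobInner_mul_left_right, hPs, hPT]
    rw [e]
    refine (frobInner_le _ _).trans (mul_le_mul_of_nonneg_right (Real.sqrt_le_sqrt ?_)
      (Real.sqrt_nonneg _))
    rw [frobInner, hTT]
    exact hQr
  have b5 : frobInner T X = frobInner T (X - Xc) := by
    have : frobInner T Xc = 0 := by
      rw [← hPT, ← hPs, ← frobInner_mul_left_right, hPXc]
      simp [frobInner]
    rw [frobInner_sub_right, this, sub_zero]
  have b6 : frobInner W' X ≤ schattenNorm 1 Xc := by
    have h1 : frobInner W' (X - Xc) = 0 := by
      rw [← hPX, frobInner_mul_left_right, hPs, hW', ← Matrix.mul_assoc, ← Matrix.mul_assoc, hcP']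
      simp [frobInner]
    have cW' : IsContraction W' := (cP.mul hW).mul fun x => by
      rw [compl_mulVec_dotProduct_self hQs hQi]
      linarith [nnQ x]
    rw [frobInner_sub_right] at h1
    linarith [frobInner_le_schattenNorm_one cW' Xc]
  rw [frobInner_sub_left, frobInner_sub_right, frobInner_sub_right] at dual
  have pyth : a ^ 2 + c ^ 2 ≤ frobInner M M := by
    rw [ha, hc, Real.sq_sqrt (frobInner_self_nonneg _), Real.sq_sqrt (frobInner_self_nonneg _)]
    have h1 : frobInner ((1 - P) * M * Q) ((1 - P) * M * Q) ≤
        frobInner ((1 - P) * M) ((1 - P) * M) := by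
      rw [← frobInner_transpose_self, ← frobInner_transpose_self ((1 - P) * M), transpose_mul _ Q,
        hQs]
      exact cQ.frobInner_mul_le _
    have h2 : frobInner (P * M) (P * M) + frobInner ((1 - P) * M) ((1 - P) * M) =
        frobInner M M := by
      have e1 : Pᵀ * (P * M) = P * M := by rw [hPs, ← Matrix.mul_assoc, hPi]
      have e2 : (1 - P)ᵀ * ((1 - P) * M) = M - P * M := by
        rw [hPc, ← Matrix.mul_assoc, Matrix.mul_sub, hcP, Matrix.mul_one, sub_zero,
          Matrix.sub_mul, Matrix.one_mul]
      simp only [frobInner, transpose_mul, Matrix.mul_assoc, e1, e2]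
      rw [← trace_add, ← Matrix.mul_add]
      congr 2
      abel
    linarith
  -- Cauchy–Schwarz against the vector `(2, 1)` is the source of `√5`.
  have cs : 2 * a + c ≤ √5 * √(frobInner M M) := by
    rw [← Real.sqrt_mul (by norm_num)]
    refine Real.le_sqrt_of_sq_le ?_
    nlinarith [sq_nonneg (a - 2 * c)]
  rw [schattenNorm_two, ← hWM, split, b3]
  have := mul_le_mul_of_nonneg_left cs (Real.sqrt_nonneg r)
  nlinarith

/-- A minimizer that does not increase the nuclear norm differs from `X` by a matrix of small
nuclear norm, up to the rank-`r` tail of `X`. -/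
theorem schattenNorm_one_le_of_isRankTail {r : ℕ} {X Xc M : Matrix (Fin n₁) (Fin n₂) ℝ}
    (hXc : IsRankTail r X Xc) (hM : schattenNorm 1 (X - M) ≤ schattenNorm 1 X) :
    schattenNorm 1 M ≤ √5 * √r * schattenNorm 2 M + 2 * schattenNorm 1 Xc := by
  obtain ⟨u, v, h, hc⟩ := hXc
  have hU := colMatrix_transpose_mul_self h.orthonormal_left
  have hV := colMatrix_transpose_mul_self h.orthonormal_right
  have hX := h.eq_mul
  set U := colMatrix u
  set V := colMatrix v
  -- The indicator of the leading indices, which are `j < r` as counting starts at `0`.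
  set d : Fin (min n₁ n₂) → ℝ := fun j => if r ≤ j.val then 0 else 1 with hd
  have hXc' : Xc = U * diagonal (fun j => svals X j * (1 - d j)) * Vᵀ := by
    rw [hc, ← sum_smul_vecMulVec, Finset.sum_filter]
    refine Finset.sum_congr rfl fun j _ => ?_
    by_cases hj : r ≤ j.val <;> simp [hd, hj, svals]
  have hdiff : X - Xc = U * diagonal (fun j => svals X j * d j) * Vᵀ := by
    conv_lhs => rw [hX, hXc']
    rw [← Matrix.sub_mul, ← Matrix.mul_sub, diagonal_sub]
    congr 3
    ext j
    ring
  have hdd : ∀ j, d j * d j = d j := fun j => by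
    by_cases hj : r ≤ j.val <;> simp [hd, hj]
  have hdtr : ∑ j, d j ≤ r := by
    have e : ∑ j, d j = ((Finset.univ.filter fun j : Fin (min n₁ n₂) => ¬ r ≤ j.val).card : ℝ) := by
      rw [Finset.card_filter]
      push_cast
      refine Finset.sum_congr rfl fun j _ => ?_
      by_cases hj : r ≤ j.val <;> simp [hd, hj]
    rw [e]
    have : (Finset.univ.filter fun j : Fin (min n₁ n₂) => ¬ r ≤ j.val).card ≤
        (Finset.range r).card :=
      Finset.card_le_card_of_injOn (fun j => j.val) (fun j hj => by
        simpa using hj) fun i _ j _ hij => Fin.ext hij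
    rw [Finset.card_range] at this
    exact_mod_cast this
  have mulU : ∀ {k : ℕ} (c e : Fin (min n₁ n₂) → ℝ) (Y : Matrix (Fin k) (Fin (min n₁ n₂)) ℝ),
      U * diagonal c * Uᵀ * (U * diagonal e * Yᵀ) = U * diagonal (fun j => c j * e j) * Yᵀ := by
    intro k c e Y
    calc _ = U * diagonal c * (Uᵀ * U) * diagonal e * Yᵀ := by simp only [Matrix.mul_assoc]
      _ = _ := by rw [hU, Matrix.mul_one, Matrix.mul_assoc U, diagonal_mul_diagonal]
  refine schattenNorm_one_le_of_projections (P := U * diagonal d * Uᵀ) (Q := V * diagonal d * Vᵀ)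
    (T := U * diagonal d * Vᵀ) ?_ ?_ ?_ ?_ ?_ ?_ ?_ ?_ ?_ ?_ ?_ hM
  · simp only [transpose_mul, transpose_transpose, diagonal_transpose, Matrix.mul_assoc]
  · simp only [mulU, hdd]
  · simp only [transpose_mul, transpose_transpose, diagonal_transpose, Matrix.mul_assoc]
  · calc _ = V * diagonal d * (Vᵀ * V) * diagonal d * Vᵀ := by simp only [Matrix.mul_assoc]
      _ = _ := by rw [hV, Matrix.mul_one, Matrix.mul_assoc V, diagonal_mul_diagonal]; simp only [hdd]
  · simp only [mulU, hdd]
  · calc _ = V * diagonal d * (Uᵀ * U) * diagonal d * Vᵀ := by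
          simp only [transpose_mul, transpose_transpose, diagonal_transpose, Matrix.mul_assoc]
      _ = _ := by rw [hU, Matrix.mul_one, Matrix.mul_assoc V, diagonal_mul_diagonal]; simp only [hdd]
  · rw [trace_mul_comm, ← Matrix.mul_assoc, hU, Matrix.one_mul, trace_diagonal]
    exact hdtr
  · rw [trace_mul_comm, ← Matrix.mul_assoc, hV, Matrix.one_mul, trace_diagonal]
    exact hdtr
  · rw [hdiff, mulU]
    congr 3
    ext j
    linear_combination svals X j * hdd j
  · rw [hXc', mulU]
    have : (fun j => d j * (svals X j * (1 - d j))) = 0 := by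
      ext j
      simp only [Pi.zero_apply]
      linear_combination -svals X j * hdd j
    rw [this]
    simp
  -- Duality with `U Vᵀ` bounds the tail sum of singular values of `X` by `‖X_c‖₁`, so the singular
  -- values of `X_c` need not be identified.
  · have h1 : frobInner (U * Vᵀ) Xc ≤ schattenNorm 1 Xc :=
      frobInner_le_schattenNorm_one ((IsContraction.of_transpose_mul_self hU).mul
        (.transpose_of_transpose_mul_self hV)) Xc
    have h2 := frobInner_svd hU hV (fun _ => 1) fun j => svals X j * (1 - d j)
    rw [diagonal_one, Matrix.mul_one, ← hXc'] at h2
    rw [h2] at h1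
    rw [hdiff, frobInner_svd hU hV, schattenNorm_one X]
    refine le_trans (le_of_eq ?_) (add_le_add_right h1 _)
    rw [← Finset.sum_add_distrib]
    refine Finset.sum_congr rfl fun j _ => ?_
    linear_combination -svals X j * hdd j

end SVD

end

/-! ### Uniform lower bound on the cone and stable recovery. -/

section

open Matrix

variable {n₁ n₂ m : ℕ}

/-- The unit matrices of nuclear norm at most `K`, as functions on the index pairs. -/
def nuclearSphere (n₁ n₂ : ℕ) (K : ℝ) : Set (Fin n₁ × Fin n₂ → ℝ) :=
  {t | ∑ p, t p ^ 2 = 1 ∧ schattenNorm 1 (Matrix.of fun i k => t (i, k)) ≤ K}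

/-- The Euclidean norm of the measurements of `t` under the Gaussian operator `G`. -/
noncomputable def operatorNorm (G : Fin m × Fin n₁ × Fin n₂ → ℝ) (t : Fin n₁ × Fin n₂ → ℝ) : ℝ :=
  √(∑ j, (∑ p, G (j, p) * t p) ^ 2)

/-- The right singular vectors of all the `t a` serve as the finite family of test vectors: they are
the only places where `‖H v‖` is needed to control `⟨H, t a⟩`, so no net of the sphere is required.
-/
theorem stdGauss_exists_operatorNorm_lt_le {τ : Type*} [Fintype τ] [Nonempty τ] {K : ℝ}
    {t : τ → Fin n₁ × Fin n₂ → ℝ} (ht : ∀ a, t a ∈ nuclearSphere n₁ n₂ K) {x y : ℝ} (hx : 0 ≤ x)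
    (hy : y ≤ m / √(m + 1) - K * (√n₁ + √n₂) - x) :
    (stdGauss (Fin m × Fin n₁ × Fin n₂)).real {G | ∃ a, operatorNorm G (t a) < y} ≤
      Real.exp (-x ^ 2 / 2) := by
  classical
  set M : τ → Matrix (Fin n₁) (Fin n₂) ℝ := fun a => Matrix.of fun i k => t a (i, k) with hM
  choose u v h using fun a => exists_isSVD (M a)
  have a₀ := Classical.arbitrary τ
  -- A matrix of Frobenius norm 1 excludes a zero dimension, so test vectors exist.
  have hn : 0 < min n₁ n₂ := by
    have h1 := (ht a₀).1
    by_contra hn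
    have h2 : IsEmpty (Fin n₁ × Fin n₂) := by
      rcases Nat.min_eq_zero_iff.1 (Nat.eq_zero_of_not_pos hn) with rfl | rfl
      · exact Prod.isEmpty_left
      · exact Prod.isEmpty_right
    simp at h1
  have : Nonempty (Fin (min n₁ n₂)) := ⟨⟨0, hn⟩⟩
  have hK : 0 ≤ K := (schattenNorm_one_nonneg _).trans (ht a₀).2
  refine stdGauss_exists_norm_lt_le (μ := Fin m) (fun a => (ht a).1)
    (v := fun c : τ × Fin (min n₁ n₂) => (v c.1 c.2).ofLp) (fun c => ?_) hK
    (fun H B hB a => ?_) hx (by simpa using hy)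
  · rw [← dotProduct_self_of_orthonormal (h c.1).orthonormal_right c.2]
    simp [dotProduct, sq]
  · have h1 := neg_frobInner_le_schattenNorm_one_mul (h a) (Matrix.of fun i k => H (i, k))
      (B := B) fun j => hB (a, j)
    rw [frobInner_eq_sum] at h1
    have hB0 : 0 ≤ B := (Real.sqrt_nonneg _).trans (hB (a, ⟨0, hn⟩))
    exact h1.trans (mul_le_mul_of_nonneg_right (ht a).2 hB0)

theorem continuous_operatorNorm_left (t : Fin n₁ × Fin n₂ → ℝ) :
    Continuous fun G : Fin m × Fin n₁ × Fin n₂ → ℝ => operatorNorm G t := by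
  unfold operatorNorm
  fun_prop

theorem continuous_operatorNorm_right (G : Fin m × Fin n₁ × Fin n₂ → ℝ) :
    Continuous (operatorNorm G) := by
  unfold operatorNorm
  fun_prop

theorem isClosed_setOf_le_operatorNorm (S : Set (Fin n₁ × Fin n₂ → ℝ)) (y : ℝ) :
    IsClosed {G : Fin m × Fin n₁ × Fin n₂ → ℝ | ∀ t ∈ S, y ≤ operatorNorm G t} := by
  have : {G : Fin m × Fin n₁ × Fin n₂ → ℝ | ∀ t ∈ S, y ≤ operatorNorm G t} =
      ⋂ t ∈ S, {G | y ≤ operatorNorm G t} := by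
    ext G; simp
  rw [this]
  exact isClosed_biInter fun t _ => isClosed_le continuous_const
    (continuous_operatorNorm_left t)

/-- With high probability, the Gaussian operator is bounded below on all unit matrices of small
nuclear norm. -/
theorem one_sub_exp_le_stdGauss {K x y : ℝ} (hx : 0 ≤ x)
    (hy : y ≤ m / √(m + 1) - K * (√n₁ + √n₂) - x) :
    1 - Real.exp (-x ^ 2 / 2) ≤ (stdGauss (Fin m × Fin n₁ × Fin n₂)).real
      {G | ∀ t ∈ nuclearSphere n₁ n₂ K, y ≤ operatorNorm G t} := by
  set S := nuclearSphere n₁ n₂ K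
  set E := {G : Fin m × Fin n₁ × Fin n₂ → ℝ | ∀ t ∈ S, y ≤ operatorNorm G t} with hE
  have hEm : MeasurableSet E := (isClosed_setOf_le_operatorNorm S y).measurableSet
  rcases isEmpty_or_nonempty S with hS | hS
  · have : E = Set.univ := Set.eq_univ_of_forall fun G t ht => (hS.false ⟨t, ht⟩).elim
    rw [this, probReal_univ]
    linarith [Real.exp_nonneg (-x ^ 2 / 2)]
  -- The failure probability for finite families does not depend on their size, so it survives the
  -- increasing union over initial segments of a dense sequence. Density and continuity in `t` then
  -- cover all of `S`.
  set d := TopologicalSpace.denseSeq S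
  set F : ℕ → Set (Fin m × Fin n₁ × Fin n₂ → ℝ) := fun k =>
    {G | ∃ i : Fin (k + 1), operatorNorm G (d i) < y} with hF
  have hmono : Monotone F := by
    rintro k l hkl G ⟨i, hi⟩
    exact ⟨⟨i, by omega⟩, hi⟩
  have hsub : Eᶜ ⊆ ⋃ k, F k := by
    intro G hG
    by_contra hn
    apply hG
    have h1 : ∀ i, y ≤ operatorNorm G (d i) := by
      intro i
      by_contra hi
      exact hn (Set.mem_iUnion.2 ⟨i, ⟨i, by omega⟩, not_le.1 hi⟩)
    have hcl : IsClosed {t : S | y ≤ operatorNorm G t} := isClosed_le continuous_const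
      ((continuous_operatorNorm_right G).comp continuous_subtype_val)
    have h2 : closure (Set.range d) ⊆ {t : S | y ≤ operatorNorm G t} :=
      hcl.closure_subset_iff.2 (by rintro _ ⟨i, rfl⟩; exact h1 i)
    rw [(TopologicalSpace.denseRange_denseSeq S).closure_range] at h2
    intro t ht
    have h3 : (⟨t, ht⟩ : S) ∈ {t : S | y ≤ operatorNorm G t} := h2 (Set.mem_univ _)
    exact h3
  have hle : stdGauss (Fin m × Fin n₁ × Fin n₂) Eᶜ ≤ ENNReal.ofReal (Real.exp (-x ^ 2 / 2)) := by
    refine (measure_mono hsub).trans ?_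
    rw [hmono.measure_iUnion]
    refine iSup_le fun k => ?_
    rw [← ofReal_measureReal]
    exact ENNReal.ofReal_le_ofReal
      (stdGauss_exists_operatorNorm_lt_le (fun i : Fin (k + 1) => (d i).2) hx hy)
  have h3 : (stdGauss (Fin m × Fin n₁ × Fin n₂)).real Eᶜ ≤ Real.exp (-x ^ 2 / 2) :=
    ENNReal.toReal_le_of_le_ofReal (Real.exp_nonneg _) hle
  rw [probReal_compl_eq_one_sub hEm] at h3
  linarith

theorem norm_measurementMap (A : Fin m → Matrix (Fin n₁) (Fin n₂) ℝ)
    (M : Matrix (Fin n₁) (Fin n₂) ℝ) :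
    ‖measurementMap A M‖ = operatorNorm (fun q => A q.1 q.2.1 q.2.2) fun p => M p.1 p.2 := by
  rw [EuclideanSpace.norm_eq, operatorNorm]
  congr 1
  refine Finset.sum_congr rfl fun j _ => ?_
  rw [Real.norm_eq_abs, sq_abs]
  congr 1
  simp only [measurementMap, Matrix.trace, diag_apply, mul_apply, transpose_apply]
  rw [Fintype.sum_prod_type]
  exact Finset.sum_congr rfl fun i _ => Finset.sum_congr rfl fun k _ => mul_comm _ _

theorem measurementMap_sub (A : Fin m → Matrix (Fin n₁) (Fin n₂) ℝ)
    (M N : Matrix (Fin n₁) (Fin n₂) ℝ) :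
    measurementMap A (M - N) = measurementMap A M - measurementMap A N := by
  ext j
  simp [measurementMap, Matrix.sub_mul]

theorem schattenNorm_two_nonneg (M : Matrix (Fin n₁) (Fin n₂) ℝ) : 0 ≤ schattenNorm 2 M := by
  rw [schattenNorm_two]; exact Real.sqrt_nonneg _

/-- A lower bound on the sphere extends to the cone. -/
theorem mul_schattenNorm_two_le_norm_measurementMap {A : Fin m → Matrix (Fin n₁) (Fin n₂) ℝ}
    {K y : ℝ} (hA : ∀ t ∈ nuclearSphere n₁ n₂ K,
      y ≤ operatorNorm (fun q : Fin m × Fin n₁ × Fin n₂ => A q.1 q.2.1 q.2.2) t)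
    {M : Matrix (Fin n₁) (Fin n₂) ℝ} (hM : schattenNorm 1 M ≤ K * schattenNorm 2 M) :
    y * schattenNorm 2 M ≤ ‖measurementMap A M‖ := by
  rcases (schattenNorm_two_nonneg M).eq_or_lt with h0 | h0
  · rw [← h0, mul_zero]; exact norm_nonneg _
  set f := schattenNorm 2 M with hf
  have hf2 : ∑ p : Fin n₁ × Fin n₂, M p.1 p.2 ^ 2 = f ^ 2 := by
    rw [hf, schattenNorm_two, Real.sq_sqrt (frobInner_self_nonneg M), frobInner_eq_sum]
    simp only [sq]
  have h1 := hA (fun p => f⁻¹ * M p.1 p.2) ⟨by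
    simp only [mul_pow]
    rw [← Finset.mul_sum, hf2, inv_pow, inv_mul_cancel₀ (by positivity)], by
    have := schattenNorm_one_smul_le (inv_nonneg.2 h0.le) M
    refine (this.trans (mul_le_mul_of_nonneg_left hM (inv_nonneg.2 h0.le))).trans_eq ?_
    field_simp⟩
  have h2 : operatorNorm (fun q : Fin m × Fin n₁ × Fin n₂ => A q.1 q.2.1 q.2.2)
      (fun p => f⁻¹ * M p.1 p.2) = f⁻¹ * ‖measurementMap A M‖ := by
    rw [norm_measurementMap, operatorNorm, operatorNorm, ← Real.sqrt_sq (inv_nonneg.2 h0.le),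
      ← Real.sqrt_mul (sq_nonneg _), Finset.mul_sum, Real.sqrt_sq (inv_nonneg.2 h0.le)]
    congr 1
    refine Finset.sum_congr rfl fun j _ => ?_
    rw [← mul_pow, Finset.mul_sum]
    congr 1
    exact Finset.sum_congr rfl fun p _ => by ring
  rw [h2, inv_mul_eq_div, le_div_iff₀ h0] at h1
  exact h1

/-- Quantifies how far the cone constant exceeds `√5`, with equality at `ρ = 1`. For `D = ρ⁻¹ - 1`
the right side squared is `5 + 4D + D²`, and `4ρ ≤ (1 + ρ)²` gives `(1 - ρ) / (1 + ρ)² ≤ D / 4`. -/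
theorem sqrt_five_add_le {ρ : ℝ} (hρ0 : 0 < ρ) (hρ1 : ρ < 1) :
    √5 + (1 - ρ) / (1 + ρ) ^ 2 ≤ √(1 + (1 + ρ⁻¹) ^ 2) := by
  have h5 : √5 ≤ 9 / 4 := Real.sqrt_le_iff.2 ⟨by norm_num, by norm_num⟩
  have h5' : √5 ^ 2 = 5 := Real.sq_sqrt (by norm_num)
  set D := ρ⁻¹ - 1 with hD
  have hD0 : 0 < D := sub_pos.2 (one_lt_inv₀ hρ0 |>.2 hρ1)
  have hq : (1 - ρ) / (1 + ρ) ^ 2 ≤ D / 4 := by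
    have e : 1 - ρ = ρ * D := by rw [hD]; field_simp
    rw [div_le_div_iff₀ (by positivity) (by norm_num), e]
    nlinarith [sq_nonneg (1 - ρ)]
  have hq0 : 0 ≤ (1 - ρ) / (1 + ρ) ^ 2 := div_nonneg (by linarith) (by positivity)
  refine Real.le_sqrt_of_sq_le ?_
  have e : ρ⁻¹ = 1 + D := by rw [hD]; ring
  rw [e]
  nlinarith [Real.sqrt_nonneg 5]

/-- Stable recovery from a lower bound of the measurement map on matrices of small nuclear norm. -/
theorem schattenNorm_two_sub_le {r : ℕ} (hr : 1 ≤ r) {ρ y : ℝ} (hρ0 : 0 < ρ) (hρ1 : ρ < 1)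
    (hy : 0 < y) {A : Fin m → Matrix (Fin n₁) (Fin n₂) ℝ}
    (hA : ∀ t ∈ nuclearSphere n₁ n₂ (√r * √(1 + (1 + ρ⁻¹) ^ 2)),
      y ≤ operatorNorm (fun q : Fin m × Fin n₁ × Fin n₂ => A q.1 q.2.1 q.2.2) t)
    {X Xc Xs : Matrix (Fin n₁) (Fin n₂) ℝ} (hXc : IsRankTail r X Xc) {η : ℝ}
    {w b : EuclideanSpace ℝ (Fin m)} (hw : ‖w‖ ≤ η) (hb : b = measurementMap A X + w)
    (hXs : IsNuclearNormSolution A b η Xs) :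
    schattenNorm 2 (X - Xs) ≤ 2 * (1 + ρ) ^ 2 / ((1 - ρ) * √r) * schattenNorm 1 Xc +
      2 * ((3 + ρ) / (1 - ρ)) * y⁻¹ * η := by
  have hη : 0 ≤ η := (norm_nonneg w).trans hw
  have hsr : 0 < √(r : ℝ) := Real.sqrt_pos.2 (by exact_mod_cast hr)
  have h1ρ : 0 < 1 - ρ := by linarith
  set s := √(1 + (1 + ρ⁻¹) ^ 2)
  have hfeas : ‖measurementMap A X - b‖ ≤ η := by
    rw [hb, sub_add_cancel_left, norm_neg]; exact hw
  have hle : schattenNorm 1 (X - (X - Xs)) ≤ schattenNorm 1 X := by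
    rw [sub_sub_cancel]; exact hXs.2 X hfeas
  have hmeas : ‖measurementMap A (X - Xs)‖ ≤ 2 * η := by
    rw [measurementMap_sub, ← sub_sub_sub_cancel_right _ _ b]
    exact (norm_sub_le _ _).trans (by linarith [hXs.1])
  have hc0 := schattenNorm_one_nonneg Xc
  set f := schattenNorm 2 (X - Xs) with hf
  have hf0 : 0 ≤ f := schattenNorm_two_nonneg _
  set c := schattenNorm 1 Xc
  have t1 : 0 ≤ 2 * (1 + ρ) ^ 2 / ((1 - ρ) * √r) * c := by positivity
  have t2 : 0 ≤ 2 * ((3 + ρ) / (1 - ρ)) * y⁻¹ * η := by positivity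
  -- Inside the cone the lower bound on the measurements gives a bound by `η` alone, and `(3 + ρ) /
  -- (1 - ρ) ≥ 1` only weakens it. Outside the cone the nuclear norm inequality gives a bound by
  -- `‖X_c‖₁` alone.
  by_cases hcase : schattenNorm 1 (X - Xs) ≤ √r * s * f
  · have h1 := (mul_schattenNorm_two_le_norm_measurementMap hA hcase).trans hmeas
    have h2 : f ≤ 2 * 1 * y⁻¹ * η := by
      rw [mul_one, mul_assoc, mul_comm y⁻¹, ← mul_assoc, ← div_eq_mul_inv, le_div_iff₀ hy]
      linarith
    have h3 : 1 ≤ (3 + ρ) / (1 - ρ) := by rw [le_div_iff₀ h1ρ]; linarith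
    have h4 : 2 * 1 * y⁻¹ * η ≤ 2 * ((3 + ρ) / (1 - ρ)) * y⁻¹ * η := by gcongr
    linarith
  · have h1 := schattenNorm_one_le_of_isRankTail hXc hle
    rw [← hf] at h1
    have h2 : √r * f * (s - √5) ≤ 2 * c := by linarith [not_le.1 hcase]
    have h3 := sqrt_five_add_le hρ0 hρ1
    have h4 : √r * f * ((1 - ρ) / (1 + ρ) ^ 2) ≤ 2 * c :=
      (mul_le_mul_of_nonneg_left (by linarith) (by positivity)).trans h2
    have h5 : f ≤ 2 * (1 + ρ) ^ 2 / ((1 - ρ) * √r) * c := by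
      rw [div_mul_eq_mul_div, le_div_iff₀ (by positivity)]
      rw [mul_div_assoc', div_le_iff₀ (by positivity)] at h4
      linarith
    linarith

/-- With `e = m / √(m + 1)` and `B = √R N + √L`, the hypothesis says `κ B ≤ (κ - 1) e`, that is, `e
- B ≥ e / κ`. Moreover `m ≥ 1` gives `m + 1 ≤ 2m`, hence `e ≥ √m / √2`. -/
theorem measurements_bound {R κ L N : ℝ} (hR : 0 < R) (hκ : 1 < κ) (hL : 0 < L) (hN : 0 ≤ N)
    (hm : R * κ ^ 2 / (κ - 1) ^ 2 * (N + √(L / R)) ^ 2 ≤ (m : ℝ) ^ 2 / (m + 1)) :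
    0 < (m : ℝ) ∧ √m / (√2 * κ) ≤ m / √(m + 1) - √R * N - √L := by
  have hk : 0 < κ - 1 := by linarith
  have hκ0 : 0 < κ := by linarith
  have hsR : 0 < √R := Real.sqrt_pos.2 hR
  have hsL : 0 < √L := Real.sqrt_pos.2 hL
  have hm1 : (0 : ℝ) < m + 1 := by positivity
  set B := √R * N + √L with hB
  have hB0 : 0 < B := by positivity
  have e1 : R * κ ^ 2 / (κ - 1) ^ 2 * (N + √(L / R)) ^ 2 = (κ / (κ - 1) * B) ^ 2 := by
    have : B = √R * (N + √(L / R)) := by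
      rw [Real.sqrt_div hL.le, mul_add, mul_div_cancel₀ _ hsR.ne']
    rw [this, mul_pow, mul_pow, Real.sq_sqrt hR.le, div_pow]
    ring
  have e2 : (m : ℝ) ^ 2 / (m + 1) = (m / √(m + 1)) ^ 2 := by
    rw [div_pow, Real.sq_sqrt hm1.le]
  rw [e1, e2] at hm
  have h1 : κ / (κ - 1) * B ≤ m / √(m + 1) :=
    (le_abs_self _).trans (abs_le_of_sq_le_sq hm (by positivity))
  have h2 : 0 < (m : ℝ) / √(m + 1) := lt_of_lt_of_le (by positivity) h1
  have hm0 : (0 : ℝ) < m := by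
    rcases (Nat.cast_nonneg (α := ℝ) m).eq_or_lt with h | h
    · rw [← h] at h2; simp at h2
    · exact h
  refine ⟨hm0, ?_⟩
  have hm1' : (1 : ℝ) ≤ m := by exact_mod_cast Nat.one_le_iff_ne_zero.2 (by rintro rfl; simp at hm0)
  set e := (m : ℝ) / √(m + 1) with he
  have h3 : √m / √2 ≤ e := by
    rw [he, div_le_div_iff₀ (by positivity) (by positivity), ← Real.sqrt_mul (by positivity)]
    refine Real.sqrt_le_iff.2 ⟨by positivity, ?_⟩
    rw [mul_pow, Real.sq_sqrt (by norm_num)]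
    nlinarith
  have h4 : κ * B ≤ e * (κ - 1) := by
    rw [div_mul_eq_mul_div, div_le_iff₀ hk] at h1
    exact h1
  have h5 : √m / (√2 * κ) ≤ e / κ := by
    rw [← div_div]
    gcongr
  have h6 : e / κ ≤ e - B := by
    rw [div_le_iff₀ hκ0]
    linarith
  linarith

end

end GaussianRecovery

open GaussianRecovery in
theorem theorem4p1 {Ω : Type*} [MeasurableSpace Ω] (P : Measure Ω) [IsProbabilityMeasure P]
    (n₁ n₂ m r : ℕ) (hr : 1 ≤ r)
    (A : Fin m → Ω → Matrix (Fin n₁) (Fin n₂) ℝ)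
    (hA : GaussianRecovery.IsStandardGaussianSequence A P)
    (ρ κ ε : ℝ) (hρ0 : 0 < ρ) (hρ1 : ρ < 1) (hκ : 1 < κ) (hε0 : 0 < ε) (hε1 : ε < 1)
    (hm : (r * (1 + (1 + ρ⁻¹) ^ 2) * κ ^ 2 / (κ - 1) ^ 2 : ℝ) *
        (√n₁ + √n₂ + √(2 * Real.log ε⁻¹ / (r * (1 + (1 + ρ⁻¹) ^ 2)))) ^ 2 ≤
      (m : ℝ) ^ 2 / (m + 1)) :
    ∃ E : Set Ω, MeasurableSet E ∧ 1 - ε ≤ P.real E ∧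
      ∀ ω ∈ E, ∀ (X Xc : Matrix (Fin n₁) (Fin n₂) ℝ), GaussianRecovery.IsRankTail r X Xc →
        ∀ (η : ℝ) (w b : EuclideanSpace ℝ (Fin m)), ‖w‖ ≤ η →
          b = GaussianRecovery.measurementMap (fun j => A j ω) X + w →
          ∀ Xs : Matrix (Fin n₁) (Fin n₂) ℝ,
            GaussianRecovery.IsNuclearNormSolution (fun j => A j ω) b η Xs →
            GaussianRecovery.schattenNorm 2 (X - Xs) ≤
              2 * (1 + ρ) ^ 2 / ((1 - ρ) * √r) * GaussianRecovery.schattenNorm 1 Xc +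
                2 * √2 * κ * (3 + ρ) / (√m * (1 - ρ)) * η := by
  have hL : 0 < 2 * Real.log ε⁻¹ := by
    have := Real.log_pos ((one_lt_inv₀ hε0).2 hε1)
    linarith
  have hr0 : (0 : ℝ) < r := by exact_mod_cast hr
  obtain ⟨hm0, hy⟩ := measurements_bound (R := r * (1 + (1 + ρ⁻¹) ^ 2)) (by positivity) hκ hL
    (by positivity) hm
  -- The deviation `x` satisfies `exp (-x² / 2) = ε`, and `y` is the value for which `2 (3 + ρ) / (1
  -- - ρ) * y⁻¹` is the stated noise constant.
  set x := √(2 * Real.log ε⁻¹) with hx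
  set y := √m / (√2 * κ) with hy'
  have hκ0 : 0 < κ := by linarith
  have hy0 : 0 < y := by have := Real.sqrt_pos.2 hm0; positivity
  rw [Real.sqrt_mul hr0.le] at hy
  have hexp : Real.exp (-x ^ 2 / 2) = ε := by
    rw [hx, Real.sq_sqrt hL.le, neg_div, mul_div_cancel_left₀ _ two_ne_zero, Real.log_inv, neg_neg,
      Real.exp_log hε0]
  have hprob := one_sub_exp_le_stdGauss (Real.sqrt_nonneg _) hy
  rw [hexp] at hprob
  set S := nuclearSphere n₁ n₂ (√r * √(1 + (1 + ρ⁻¹) ^ 2))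
  set V : Ω → Fin m × Fin n₁ × Fin n₂ → ℝ := fun ω q => A q.1 ω q.2.1 q.2.2 with hV
  have hVm : AEMeasurable V P :=
    aemeasurable_pi_lambda _ fun q => (hA.hasLaw q.1 q.2.1 q.2.2).aemeasurable
  have hlaw : P.map V = stdGauss (Fin m × Fin n₁ × Fin n₂) := by
    have := hA.indep.map_fun_eq_pi_map fun q : Fin m × Fin n₁ × Fin n₂ =>
      (hA.hasLaw q.1 q.2.1 q.2.2).aemeasurable
    simp only [(hA.hasLaw _ _ _).map_eq] at this
    exact this
  have hclosed := (isClosed_setOf_le_operatorNorm (m := m) S y).measurableSet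
  -- The entries are only almost everywhere measurable, so the good event is null measurable; a
  -- measurable subset of the same probability replaces it.
  obtain ⟨E, hsub, hEm, hEae⟩ :=
    (hVm.nullMeasurable hclosed : NullMeasurableSet _ P).exists_measurable_subset_ae_eq
  have hlow : ∀ ω ∈ E, ∀ t ∈ S, y ≤ operatorNorm (V ω) t := fun ω hω => by
    have h1 := hsub hω
    exact h1
  refine ⟨E, hEm, ?_, fun ω hω X Xc hXc η w b hw hb Xs hXs => ?_⟩
  · rw [← hlaw, map_measureReal_apply_of_aemeasurable hVm hclosed] at hprob
    rwa [measureReal_congr hEae]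
  · refine (schattenNorm_two_sub_le (A := fun j => A j ω) hr hρ0 hρ1 hy0 (hlow ω hω) hXc hw hb
      hXs).trans_eq ?_
    rw [hy']
    congr 2
    have := (Real.sqrt_pos.2 hm0).ne'
    have : 1 - ρ ≠ 0 := by linarith
    field_simp
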